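/- **Theorem 1.1 (OBC Spectral Gap).** For integers $a\le b$ let $\Lambda=[a,b]\subset\mathbb Z$, $|\Lambda|=b-a+1$, let $\mathcal H_\Lambda=\ell^2(\mathbb N_0^\Lambda)$ be the bosonic Fock space with orthonormal basis $|\mu\rangle$, $\mu\in\mathbb N_0^\Lambda$, and for $\lambda\in\mathbb C$, $\kappa\ge0$ let $H_\Lambda^{\rm obc}$ be the non-negative self-adjoint operator defined by the closed energy form $$\langle\psi|H_\Lambda^{\rm obc}\psi\rangle=\sum_{\mu}\Big(\sum_{x=a}^{b-1}\mu_x\mu_{x+1}\Big)|\psi(\mu)|^2+\kappa\sum_{\nu}\sum_{x=a+1}^{b-1}|(q_x\psi)(\nu)|^2,$$ $$(q_x\psi)(\nu)=\sqrt{(\nu_x+1)(\nu_x+2)}\,\psi(\nu+2\delta_x)-\lambda\sqrt{(\nu_{x-1}+1)(\nu_{x+1}+1)}\,\psi(\nu+\delta_{x-1}+\delta_{x+1}).$$ Put $\mathcal G_\Lambda=\ker H_\Lambda^{\rm obc}$ and $$E_1^{\rm obc}(\mathcal H_\Lambda)=\inf_{0\ne\psi\in\mathrm{dom}(H_\Lambda^{\rm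 obc})\cap\mathcal G_\Lambda^\perp}\frac{\langle\psi|H_\Lambda^{\rm obc}\psi\rangle}{\|\psi\|^2}.$$ Let $$\gamma^{\rm per}_\kappa(s)=\tfrac14\min\Big\{1,\tfrac{2\kappa}{\kappa+1},\tfrac{2\kappa}{1+\kappa s}\Big\},\qquad \gamma^{\rm obc}_\kappa(s)=\tfrac15\min\Big\{4\gamma^{\rm per}_\kappa(s),\tfrac{2\kappa s}{\kappa+1}\Big\}.$$ For $r\ge0$ let $p_0=p_1=1$, $p_n=p_{n-1}+r\,p_{n-2}$ for $n\ge2$, $\beta_n=p_{n-1}/p_n$ for $n\ge1$, and $$f(r)=\sup_{n\ge4}\; r\,\beta_n\beta_{n-2}\left(\frac{[1-\beta_{n-1}(1+r)]^2}{1+2r}+\frac{r\,\beta_{n-3}(1-\beta_{n-1})^2}{1+r}\right).$$ Then $f:[0,\infty)\to[0,\infty)$ is monotone increasing, and for all $0\ne\lambda\in\mathbb C$ with $f(|\lambda|^2/2)<1/3$ (in particular, whenever $f(|\lambda|^2)<1/3$) and all $\kappa\ge0$: the ground-state space $\mathcal G_\Lambda$ is infinite-dimensional for every interval with $|\Lambda|\ge10$,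 and $$\inf_{\Lambda\subset\mathbb Z,\ |\Lambda|\ge10}E_1^{\rm obc}(\mathcal H_\Lambda)\ \ge\ \min\Big\{\gamma^{\rm obc}_\kappa(|\lambda|^2),\ \tfrac{2\kappa}{3}\big(1-\sqrt{3f(|\lambda|^2/2)}\big)^2\Big\}.$$ The infimum is over all finite intervals $\Lambda$ of that size, and $\mathcal H_\Lambda$ contains all particle numbers. -/

import Mathlib

noncomputable section

namespace Pseudopotential

open scoped InnerProductSpace

/-- Particle configurations on the interval `[a, b]` of `ℤ`: occupation numbers of its sites. -/
abbrev Config (a b : ℤ) : Type := Set.Icc a b → ℕ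

/-- The bosonic Fock space over the orbitals in `[a, b]`: square-summable functions of the
configuration, i.e. the Hilbert space in which the vectors `|μ⟩` are an orthonormal basis. -/
abbrev Fock (a b : ℤ) : Type := lp (fun _ : Config a b => ℂ) 2

/-- The occupation number `μ_x` of the site `x` (zero if `x` is not in the interval). -/
def occ {a b : ℤ} (μ : Config a b) (x : ℤ) : ℕ :=
  if h : x ∈ Set.Icc a b then μ ⟨x, h⟩ else 0

/-- `α*_x`: add one particle at the site `x`. -/
def addAt {a b : ℤ} (x : ℤ) (μ : Config a b) : Config a b :=
  fun y => if (y : ℤ) = x then μ y + 1 else μ y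

/-- The electrostatic energy with open boundary conditions, `∑_{x=a}^{b-1} μ_x μ_{x+1}`. -/
def electro {a b : ℤ} (μ : Config a b) : ℝ :=
  ∑ x ∈ Finset.Ico a b, (occ μ x : ℝ) * (occ μ (x + 1) : ℝ)

/-- The hopping operator `q_x = a_x² - lam a_{x-1} a_{x+1}`, acting on functions of the
configuration. It is used for the interior sites `a < x < b` only. -/
def hop {a b : ℤ} (lam : ℂ) (x : ℤ) (ψ : Config a b → ℂ) (ν : Config a b) : ℂ :=
  (Real.sqrt (((occ ν x : ℝ) + 1) * ((occ ν x : ℝ) + 2)) : ℂ) * ψ (addAt x (addAt x ν))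
    - lam * (Real.sqrt (((occ ν (x - 1) : ℝ) + 1) * ((occ ν (x + 1) : ℝ) + 1)) : ℂ)
      * ψ (addAt (x + 1) (addAt (x - 1) ν))

/-- The hopping density `κ ∑_x conj((q_x φ)(ν)) (q_x ψ)(ν)`, the sum running over the interior
sites `x ∈ [a+1, b-1]`. -/
def hopDensity {a b : ℤ} (lam : ℂ) (κ : ℝ) (φ ψ : Config a b → ℂ) (ν : Config a b) : ℂ :=
  (κ : ℂ) * ∑ x ∈ Finset.Ioo a b, starRingEnd ℂ (hop lam x φ ν) * hop lam x ψ ν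

/-- The electrostatic density `e(μ) conj(φ(μ)) ψ(μ)`. -/
def electroDensity {a b : ℤ} (φ ψ : Config a b → ℂ) (μ : Config a b) : ℂ :=
  (electro μ : ℂ) * (starRingEnd ℂ (φ μ) * ψ μ)

/-- The energy form with open boundary conditions (sesquilinear version). On the diagonal it is
`∑_μ e(μ) |ψ(μ)|² + κ ∑_ν ∑_{x=a+1}^{b-1} |(q_x ψ)(ν)|²`. -/
def energyForm {a b : ℤ} (lam : ℂ) (κ : ℝ) (φ ψ : Config a b → ℂ) : ℂ :=
  ∑' μ, electroDensity φ ψ μ + ∑' ν, hopDensity lam κ φ ψ ν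

/-- Finiteness of the energy form at `ψ`. -/
def FiniteEnergy {a b : ℤ} (lam : ℂ) (κ : ℝ) (ψ : Config a b → ℂ) : Prop :=
  Summable (fun μ : Config a b => electro μ * ‖ψ μ‖ ^ 2) ∧
    Summable (fun ν : Config a b => κ * ∑ x ∈ Finset.Ioo a b, ‖hop lam x ψ ν‖ ^ 2)

section FormFacts

variable {a b : ℤ}

lemma hop_add (lam : ℂ) (x : ℤ) (φ ψ : Config a b → ℂ) (ν : Config a b) :
    hop lam x (φ + ψ) ν = hop lam x φ ν + hop lam x ψ ν := by
  simp only [hop, Pi.add_apply]; ring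

lemma hop_smul (lam : ℂ) (x : ℤ) (c : ℂ) (ψ : Config a b → ℂ) (ν : Config a b) :
    hop lam x (c • ψ) ν = c * hop lam x ψ ν := by
  simp only [hop, Pi.smul_apply, smul_eq_mul]; ring

lemma electro_nonneg (μ : Config a b) : 0 ≤ electro μ :=
  Finset.sum_nonneg fun _ _ => by positivity

lemma sq_norm_add_le (u v : ℂ) : ‖u + v‖ ^ 2 ≤ 2 * ‖u‖ ^ 2 + 2 * ‖v‖ ^ 2 := by
  have h := norm_add_le u v
  have h0 := norm_nonneg (u + v)
  nlinarith [sq_nonneg (‖u‖ - ‖v‖)]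

lemma energyForm_zero_right (lam : ℂ) (κ : ℝ) (φ : Config a b → ℂ) :
    energyForm lam κ φ 0 = 0 := by
  simp [energyForm, electroDensity, hopDensity, hop]

lemma FiniteEnergy.zero (lam : ℂ) (κ : ℝ) :
    FiniteEnergy lam κ (0 : Config a b → ℂ) := by
  refine ⟨?_, ?_⟩
  · simp
  · simp [hop]

lemma FiniteEnergy.add {lam : ℂ} {κ : ℝ} {φ ψ : Config a b → ℂ}
    (hφ : FiniteEnergy lam κ φ) (hψ : FiniteEnergy lam κ ψ) : FiniteEnergy lam κ (φ + ψ) := by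
  refine ⟨?_, ?_⟩
  · refine Summable.of_nonneg_of_le (fun μ => mul_nonneg (electro_nonneg μ) (sq_nonneg _))
      (fun μ => ?_) ((hφ.1.mul_left 2).add (hψ.1.mul_left 2))
    have h := mul_le_mul_of_nonneg_left (sq_norm_add_le (φ μ) (ψ μ)) (electro_nonneg μ)
    simp only [Pi.add_apply]
    linarith
  · refine Summable.of_norm_bounded ((hφ.2.abs.mul_left 2).add (hψ.2.abs.mul_left 2))
      (fun ν => ?_)
    have hA : 0 ≤ ∑ x ∈ Finset.Ioo a b, ‖hop lam x φ ν‖ ^ 2 :=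
      Finset.sum_nonneg fun _ _ => sq_nonneg _
    have hB : 0 ≤ ∑ x ∈ Finset.Ioo a b, ‖hop lam x ψ ν‖ ^ 2 :=
      Finset.sum_nonneg fun _ _ => sq_nonneg _
    have hC : 0 ≤ ∑ x ∈ Finset.Ioo a b, ‖hop lam x (φ + ψ) ν‖ ^ 2 :=
      Finset.sum_nonneg fun _ _ => sq_nonneg _
    have h : ∑ x ∈ Finset.Ioo a b, ‖hop lam x (φ + ψ) ν‖ ^ 2 ≤
        2 * ∑ x ∈ Finset.Ioo a b, ‖hop lam x φ ν‖ ^ 2 +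
          2 * ∑ x ∈ Finset.Ioo a b, ‖hop lam x ψ ν‖ ^ 2 := by
      rw [Finset.mul_sum, Finset.mul_sum, ← Finset.sum_add_distrib]
      refine Finset.sum_le_sum fun x _ => ?_
      rw [hop_add]
      exact sq_norm_add_le _ _
    rw [Real.norm_eq_abs, abs_mul, abs_mul, abs_mul, abs_of_nonneg hA, abs_of_nonneg hB,
      abs_of_nonneg hC]
    nlinarith [mul_le_mul_of_nonneg_left h (abs_nonneg κ)]

lemma FiniteEnergy.smul {lam : ℂ} {κ : ℝ} (c : ℂ) {ψ : Config a b → ℂ}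
    (hψ : FiniteEnergy lam κ ψ) : FiniteEnergy lam κ (c • ψ) := by
  refine ⟨?_, ?_⟩
  · refine (hψ.1.mul_left (‖c‖ ^ 2)).congr fun μ => ?_
    simp only [Pi.smul_apply, smul_eq_mul, norm_mul]; ring
  · refine (hψ.2.mul_left (‖c‖ ^ 2)).congr fun ν => ?_
    simp only [hop_smul, norm_mul, mul_pow, ← Finset.mul_sum]; ring

lemma summable_electroDensity {lam : ℂ} {κ : ℝ} {φ ψ : Config a b → ℂ}
    (hφ : FiniteEnergy lam κ φ) (hψ : FiniteEnergy lam κ ψ) :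
    Summable (electroDensity φ ψ) := by
  refine Summable.of_norm_bounded (hφ.1.add hψ.1) fun μ => ?_
  have he := electro_nonneg μ
  simp only [electroDensity, norm_mul, RCLike.norm_conj, Complex.norm_real, Real.norm_eq_abs,
    abs_of_nonneg he]
  have : ‖φ μ‖ * ‖ψ μ‖ ≤ ‖φ μ‖ ^ 2 + ‖ψ μ‖ ^ 2 := by
    nlinarith [sq_nonneg (‖φ μ‖ - ‖ψ μ‖), sq_nonneg ‖φ μ‖, sq_nonneg ‖ψ μ‖]
  nlinarith [mul_le_mul_of_nonneg_left this he]

lemma summable_hopDensity {lam : ℂ} {κ : ℝ} {φ ψ : Config a b → ℂ}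
    (hφ : FiniteEnergy lam κ φ) (hψ : FiniteEnergy lam κ ψ) :
    Summable (hopDensity lam κ φ ψ) := by
  refine Summable.of_norm_bounded (hφ.2.abs.add hψ.2.abs) fun ν => ?_
  have hA : 0 ≤ ∑ x ∈ Finset.Ioo a b, ‖hop lam x φ ν‖ ^ 2 :=
    Finset.sum_nonneg fun _ _ => sq_nonneg _
  have hB : 0 ≤ ∑ x ∈ Finset.Ioo a b, ‖hop lam x ψ ν‖ ^ 2 :=
    Finset.sum_nonneg fun _ _ => sq_nonneg _
  rw [abs_mul, abs_mul, abs_of_nonneg hA, abs_of_nonneg hB, ← mul_add, hopDensity, norm_mul,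
    Complex.norm_real, Real.norm_eq_abs, ← Finset.sum_add_distrib]
  refine mul_le_mul_of_nonneg_left ((norm_sum_le _ _).trans
    (Finset.sum_le_sum fun x _ => ?_)) (abs_nonneg κ)
  rw [norm_mul, RCLike.norm_conj]
  nlinarith [sq_nonneg (‖hop lam x φ ν‖ - ‖hop lam x ψ ν‖), sq_nonneg ‖hop lam x φ ν‖,
    sq_nonneg ‖hop lam x ψ ν‖]

lemma energyForm_add_right {lam : ℂ} {κ : ℝ} {φ ψ χ : Config a b → ℂ}
    (hφ : FiniteEnergy lam κ φ) (hψ : FiniteEnergy lam κ ψ) (hχ : FiniteEnergy lam κ χ) :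
    energyForm lam κ φ (ψ + χ) = energyForm lam κ φ ψ + energyForm lam κ φ χ := by
  have h1 : electroDensity φ (ψ + χ) = fun μ => electroDensity φ ψ μ + electroDensity φ χ μ := by
    funext μ; simp only [electroDensity, Pi.add_apply]; ring
  have h2 : hopDensity lam κ φ (ψ + χ) =
      fun ν => hopDensity lam κ φ ψ ν + hopDensity lam κ φ χ ν := by
    funext ν
    simp only [hopDensity, hop_add, mul_add, Finset.sum_add_distrib]
  unfold energyForm
  rw [h1, h2, (summable_electroDensity hφ hψ).tsum_add (summable_electroDensity hφ hχ),
    (summable_hopDensity hφ hψ).tsum_add (summable_hopDensity hφ hχ)]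
  ring

lemma energyForm_smul_right (lam : ℂ) (κ : ℝ) (c : ℂ) (φ ψ : Config a b → ℂ) :
    energyForm lam κ φ (c • ψ) = c * energyForm lam κ φ ψ := by
  have h1 : electroDensity φ (c • ψ) = fun μ => c * electroDensity φ ψ μ := by
    funext μ; simp only [electroDensity, Pi.smul_apply, smul_eq_mul]; ring
  have h2 : hopDensity lam κ φ (c • ψ) = fun ν => c * hopDensity lam κ φ ψ ν := by
    funext ν
    simp only [hopDensity, hop_smul, Finset.mul_sum]
    exact Finset.sum_congr rfl fun x _ => by ring
  unfold energyForm
  rw [h1, h2, tsum_mul_left, tsum_mul_left, mul_add]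

lemma addAt_injective (x : ℤ) : Function.Injective (addAt x : Config a b → Config a b) := by
  intro μ ν h
  funext y
  have hy := congrFun h y
  simp only [addAt] at hy
  split_ifs at hy <;> omega

/-- Every finitely supported function has finite energy. -/
lemma finiteEnergy_of_finite_support (lam : ℂ) (κ : ℝ) {ψ : Config a b → ℂ}
    (h : (Function.support ψ).Finite) : FiniteEnergy lam κ ψ := by
  refine ⟨?_, ?_⟩
  · refine summable_of_hasFiniteSupport (h.subset fun μ hμ => ?_)
    simp only [Function.mem_support] at hμ ⊢
    intro h0
    simp [h0] at hμ
  · have hfin : (⋃ x ∈ Finset.Ioo a b,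
        ((fun ν : Config a b => addAt x (addAt x ν)) ⁻¹' Function.support ψ ∪
          (fun ν : Config a b => addAt (x + 1) (addAt (x - 1) ν)) ⁻¹'
            Function.support ψ)).Finite := by
      refine Set.Finite.biUnion (Finset.finite_toSet _) fun x _ => Set.Finite.union ?_ ?_
      · exact h.preimage (((addAt_injective x).comp (addAt_injective x)).injOn)
      · exact h.preimage (((addAt_injective (x + 1)).comp (addAt_injective (x - 1))).injOn)
    refine summable_of_hasFiniteSupport (hfin.subset fun ν hν => ?_)
    by_contra hcon
    apply hν
    simp only [Set.mem_iUnion, Set.mem_union, Set.mem_preimage, Function.mem_support,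
      not_exists, not_or, not_not] at hcon
    have : ∀ x ∈ Finset.Ioo a b, ‖hop lam x ψ ν‖ ^ 2 = 0 := by
      intro x hx
      obtain ⟨e1, e2⟩ := hcon x hx
      simp [hop, e1, e2]
    simp [Finset.sum_eq_zero this]

/-- A vector that represents a functional on the vectors of finite energy is unique. -/
lemma eq_of_inner_eq (lam : ℂ) (κ : ℝ) {η η' : Fock a b}
    (h : ∀ φ : Fock a b, FiniteEnergy lam κ φ → ⟪φ, η⟫_ℂ = ⟪φ, η'⟫_ℂ) : η = η' := by
  classical
  ext μ
  have hs : FiniteEnergy lam κ (lp.single (E := fun _ : Config a b => ℂ) 2 μ (1 : ℂ)) := by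
    refine finiteEnergy_of_finite_support lam κ ((Set.finite_singleton μ).subset fun ν hν => ?_)
    by_contra hne
    exact hν (by rw [lp.single_apply]; exact Pi.single_eq_of_ne hne _)
  have := h _ hs
  simpa [lp.inner_single_left] using this

end FormFacts

/-- The form domain: all vectors of finite energy. -/
def formDomain (a b : ℤ) (lam : ℂ) (κ : ℝ) : Submodule ℂ (Fock a b) where
  carrier := {ψ | FiniteEnergy lam κ ψ}
  zero_mem' := FiniteEnergy.zero lam κ
  add_mem' := fun hφ hψ => FiniteEnergy.add hφ hψ
  smul_mem' := fun c _ hψ => FiniteEnergy.smul c hψ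

/-- The operator domain of the self-adjoint operator associated with the energy form: the vectors
`ψ` of finite energy for which `φ ↦ energyForm φ ψ` is represented by a vector. -/
def hamiltonianDomain (a b : ℤ) (lam : ℂ) (κ : ℝ) : Submodule ℂ (Fock a b) where
  carrier := {ψ | ψ ∈ formDomain a b lam κ ∧
    ∃ η : Fock a b, ∀ φ ∈ formDomain a b lam κ, energyForm lam κ φ ψ = ⟪φ, η⟫_ℂ}
  zero_mem' := by
    refine ⟨Submodule.zero_mem _, 0, fun φ _ => ?_⟩
    rw [inner_zero_right]
    exact energyForm_zero_right lam κ φ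
  add_mem' := by
    rintro ψ χ ⟨hψ, η, hη⟩ ⟨hχ, ζ, hζ⟩
    refine ⟨Submodule.add_mem _ hψ hχ, η + ζ, fun φ hφ => ?_⟩
    rw [inner_add_right, ← hη φ hφ, ← hζ φ hφ]
    exact energyForm_add_right hφ hψ hχ
  smul_mem' := by
    rintro c ψ ⟨hψ, η, hη⟩
    refine ⟨Submodule.smul_mem _ c hψ, c • η, fun φ hφ => ?_⟩
    rw [inner_smul_right, ← hη φ hφ]
    exact energyForm_smul_right lam κ c φ ψ

/-- The Hamiltonian with open boundary conditions on the interval `[a, b]`: the operator associated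
with the (closed, non-negative, densely defined) energy form by the representation theorem, that is
`⟨φ, H ψ⟩ = energyForm φ ψ` for all `φ` of finite energy. The finitely supported vectors are a core
of this form (it splits over the finite-dimensional sectors of fixed particle number), so this is
the Friedrichs extension. -/
def hamiltonian (a b : ℤ) (lam : ℂ) (κ : ℝ) : Fock a b →ₗ.[ℂ] Fock a b where
  domain := hamiltonianDomain a b lam κ
  toFun :=
    { toFun := fun ψ => Classical.choose ψ.2.2
      map_add' := fun ψ χ => eq_of_inner_eq lam κ fun φ hφ => by
        rw [inner_add_right, ← Classical.choose_spec (ψ + χ).2.2 φ hφ,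
          ← Classical.choose_spec ψ.2.2 φ hφ, ← Classical.choose_spec χ.2.2 φ hφ]
        exact energyForm_add_right hφ ψ.2.1 χ.2.1
      map_smul' := fun c ψ => eq_of_inner_eq lam κ fun φ hφ => by
        rw [RingHom.id_apply, inner_smul_right, ← Classical.choose_spec (c • ψ).2.2 φ hφ,
          ← Classical.choose_spec ψ.2.2 φ hφ]
        exact energyForm_smul_right lam κ c φ (ψ : Fock a b) }

/-- The ground-state space `ker H`. -/
def groundSpace (a b : ℤ) (lam : ℂ) (κ : ℝ) : Submodule ℂ (Fock a b) :=
  (LinearMap.ker (hamiltonian a b lam κ).toFun).map (hamiltonian a b lam κ).domain.subtype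

/-- The spectral gap above the ground-state space: the infimum of `⟨ψ, H ψ⟩ / ‖ψ‖²` over all
`0 ≠ ψ ∈ dom H` that are orthogonal to `ker H`. -/
def spectralGap (a b : ℤ) (lam : ℂ) (κ : ℝ) : EReal :=
  ⨅ (ψ : (hamiltonian a b lam κ).domain) (_ : ψ ≠ 0)
    (_ : (ψ : Fock a b) ∈ (groundSpace a b lam κ)ᗮ),
    (((⟪(ψ : Fock a b), hamiltonian a b lam κ ψ⟫_ℂ).re / ‖(ψ : Fock a b)‖ ^ 2 : ℝ) : EReal)

/-- `γ_κ^per` as a function of `s = |lam|²`. -/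
def gammaPer (κ s : ℝ) : ℝ :=
  1 / 4 * min 1 (min (2 * κ / (κ + 1)) (2 * κ / (1 + κ * s)))

/-- `γ_κ^obc` as a function of `s = |lam|²`. -/
def gammaObc (κ s : ℝ) : ℝ :=
  1 / 5 * min (4 * gammaPer κ s) (2 * κ * s / (κ + 1))

/-- The squared norm `‖φ_n‖²` of the squeezed Tao–Thouless state with `n` monomers, as a function
of `r = |lam|²/2`; it satisfies `‖φ_n‖² = ‖φ_{n-1}‖² + r ‖φ_{n-2}‖²`. -/
def normSq (r : ℝ) : ℕ → ℝ
  | 0 => 1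
  | 1 => 1
  | n + 2 => normSq r (n + 1) + r * normSq r n

/-- `β_n = ‖φ_{n-1}‖² / ‖φ_n‖²`, for `n ≥ 1`. -/
def beta (r : ℝ) (n : ℕ) : ℝ := normSq r (n - 1) / normSq r n

/-- The function `f_n`, for `n ≥ 4`. -/
def overlapTerm (n : ℕ) (r : ℝ) : ℝ :=
  r * beta r n * beta r (n - 2) *
    ((1 - beta r (n - 1) * (1 + r)) ^ 2 / (1 + 2 * r) +
      r * beta r (n - 3) * (1 - beta r (n - 1)) ^ 2 / (1 + r))

/-- The function `f = sup_{n ≥ 4} f_n`. -/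
def overlap (r : ℝ) : ℝ := ⨆ n : {n : ℕ // 4 ≤ n}, overlapTerm n r

end Pseudopotential

end

/-!
The energy form splits along a partition of the configurations `μ ∈ ℕ₀^Λ` into those which, by
hops `1 0 1 ↔ 0 2 0`, never reach electrostatic energy (the tilings) and all others.

*Tilings.* A tiling is a root tiling `R` without dimers together with the set `σ` of sites at which
two consecutive monomers of `R` are replaced by a dimer (`tile`); `σ` is any set of bonds of `R`
without two points at distance two. In the sector of `R` the hopping operators become
`√2 (u(σ ∪ {i}) - c u(σ))` with `c = lam / √2`, the ground state is `u(σ) = c^|σ|`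
(`tilingState`), and after division by it the Hamiltonian is `2 κ` times the generator of the
Glauber dynamics of a hard-core lattice gas in one dimension with fugacity `r = |lam|² / 2`. No
martingale argument is needed for its gap: the gradient of an eigenfunction is maximal, relative to
the weight `1 + r k / 2` with `k` the number of free neighbours, at some edge, and the eigenvalue
equation differenced along that edge gives an eigenvalue of at least `1 / (1 + r)`
(`inv_le_eigenvalue`, `hardcore_gap`). Hence the form is at least `2 κ / (1 + r)` on the part of the
tiling space orthogonal to the ground states (`tsum_isTiling_le`).

*Other configurations.* Those without electrostatic energy can be moved by one or two hops to a
configuration with electrostatic energy on an edge next to the move (`isTiling_of_notMem`). The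
Cauchy–Schwarz inequality bounds `gammaObc` times their weight by hopping energy plus one fifth of
the energy of that edge. Each edge is used by at most four configurations, two per orientation
(`tsum_badConfigs_le`), and the last fifth bounds the weight of the configurations with
electrostatic energy; the hopping terms used are disjoint from those inside the tiling space. All
sums are taken in `[0, ∞]`, where they may be rearranged freely.

*The function `f`.* The splitting `p_n = (1 + 2 r) p_{n-3} + r (1 + r) p_{n-4}` gives
`f_n = r² / ((1 + r) (1 + 2 r)) (1 - β_{n-1}) (1 - β_{n-2})` (`overlapTerm_eq`), a product of
increasing functions with values in `[0, 1]`. The condition `f < 1/3` forces `r < 100`, and in that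
range `1 / (1 + r)` is at least `(1 - √(3 f))² / 3` (`sq_one_sub_sqrt_overlap_le`), which turns the
gap of the tiling space into the stated bound.
-/

noncomputable section

namespace Pseudopotential

open scoped InnerProductSpace

/-! ### The overlap function -/

lemma normSq_pos {r : ℝ} (hr : 0 ≤ r) : ∀ n, 0 < normSq r n
  | 0 => by simp [normSq]
  | 1 => by simp [normSq]
  | n + 2 => by
    have h1 := normSq_pos hr (n + 1)
    have h0 := normSq_pos hr n
    rw [normSq]
    positivity

lemma beta_one (r : ℝ) : beta r 1 = 1 := by simp [beta, normSq]

lemma beta_succ {r : ℝ} (hr : 0 ≤ r) (n : ℕ) :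
    beta r (n + 2) = 1 / (1 + r * beta r (n + 1)) := by
  have h0 := normSq_pos hr n
  have h1 := normSq_pos hr (n + 1)
  have e : beta r (n + 2) = normSq r (n + 1) / (normSq r (n + 1) + r * normSq r n) := rfl
  have e' : beta r (n + 1) = normSq r n / normSq r (n + 1) := rfl
  rw [e, e']
  field_simp

lemma beta_pos {r : ℝ} (hr : 0 ≤ r) (n : ℕ) : 0 < beta r n :=
  div_pos (normSq_pos hr _) (normSq_pos hr _)

lemma beta_le_one {r : ℝ} (hr : 0 ≤ r) : ∀ n, beta r (n + 1) ≤ 1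
  | 0 => (beta_one r).le
  | n + 1 => by
    have h := beta_pos hr (n + 1)
    rw [beta_succ hr, div_le_one (by positivity)]
    nlinarith [mul_nonneg hr h.le]

/-- Both monotonicities are proved together, since `β_{n+1} = 1 / (1 + r β_n)` and
`r β_{n+1} = 1 / (1 / r + β_n)`. -/
lemma beta_anti_and_mul_beta_mono {r r' : ℝ} (hr : 0 ≤ r) (h : r ≤ r') :
    ∀ n, beta r' (n + 1) ≤ beta r (n + 1) ∧ r * beta r (n + 1) ≤ r' * beta r' (n + 1)
  | 0 => by simpa [beta_one] using h
  | n + 1 => by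
    obtain ⟨h1, h2⟩ := beta_anti_and_mul_beta_mono hr h n
    have hr' := hr.trans h
    have p := beta_pos hr (n + 1)
    have p' := beta_pos hr' (n + 1)
    have q := mul_nonneg hr p.le
    have q' := mul_nonneg hr' p'.le
    rw [beta_succ hr, beta_succ hr']
    refine ⟨one_div_le_one_div_of_le (by linarith) (by linarith), ?_⟩
    rw [mul_one_div, mul_one_div, div_le_div_iff₀ (by linarith) (by linarith)]
    nlinarith [mul_le_mul_of_nonneg_left h1 (mul_nonneg hr hr')]

/-- Closed form of `f_n`. It rests on the splitting
`‖φ_n‖² = (1 + 2 r) ‖φ_{n-3}‖² + r (1 + r) ‖φ_{n-4}‖²`, which cancels `‖φ_n‖²`. -/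
lemma overlapTerm_eq {r : ℝ} (hr : 0 ≤ r) (k : ℕ) :
    overlapTerm (k + 4) r =
      r ^ 2 / ((1 + r) * (1 + 2 * r)) * ((1 - beta r (k + 3)) * (1 - beta r (k + 2))) := by
  have h0 := normSq_pos hr k
  have h1 := normSq_pos hr (k + 1)
  have e2 : normSq r (k + 2) = normSq r (k + 1) + r * normSq r k := rfl
  have e3 : normSq r (k + 3) = normSq r (k + 2) + r * normSq r (k + 1) := rfl
  have e4 : normSq r (k + 4) = normSq r (k + 3) + r * normSq r (k + 2) := rfl
  have b1 : beta r (k + 1) = normSq r k / normSq r (k + 1) := rfl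
  have b2 : beta r (k + 2) = normSq r (k + 1) / normSq r (k + 2) := rfl
  have b3 : beta r (k + 3) = normSq r (k + 2) / normSq r (k + 3) := rfl
  have b4 : beta r (k + 4) = normSq r (k + 3) / normSq r (k + 4) := rfl
  have e : overlapTerm (k + 4) r = r * beta r (k + 4) * beta r (k + 2) *
    ((1 - beta r (k + 3) * (1 + r)) ^ 2 / (1 + 2 * r) +
      r * beta r (k + 1) * (1 - beta r (k + 3)) ^ 2 / (1 + r)) := rfl
  rw [e, b1, b2, b3, b4, e4, e3, e2]
  generalize normSq r k = x at *
  generalize normSq r (k + 1) = y at *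
  field_simp
  ring

lemma overlapFactor_mono {r r' : ℝ} (hr : 0 ≤ r) (h : r ≤ r') :
    r ^ 2 / ((1 + r) * (1 + 2 * r)) ≤ r' ^ 2 / ((1 + r') * (1 + 2 * r')) := by
  have hr' := hr.trans h
  rw [div_le_div_iff₀ (by positivity) (by positivity)]
  have : r ^ 2 ≤ r' ^ 2 := pow_le_pow_left₀ hr h 2
  nlinarith [mul_le_mul_of_nonneg_left h (mul_nonneg hr hr')]

lemma one_sub_beta_mem {r : ℝ} (hr : 0 ≤ r) (n : ℕ) :
    0 ≤ 1 - beta r (n + 1) ∧ 1 - beta r (n + 1) ≤ 1 :=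
  ⟨by linarith [beta_le_one hr n], by linarith [beta_pos hr (n + 1)]⟩

lemma overlapTerm_nonneg {r : ℝ} (hr : 0 ≤ r) (k : ℕ) : 0 ≤ overlapTerm (k + 4) r := by
  rw [overlapTerm_eq hr]
  have h1 := (one_sub_beta_mem hr (k + 2)).1
  have h2 := (one_sub_beta_mem hr (k + 1)).1
  positivity

lemma overlapTerm_le_one {r : ℝ} (hr : 0 ≤ r) (k : ℕ) : overlapTerm (k + 4) r ≤ 1 := by
  rw [overlapTerm_eq hr]
  obtain ⟨h1, h1'⟩ := one_sub_beta_mem hr (k + 2)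
  obtain ⟨h2, h2'⟩ := one_sub_beta_mem hr (k + 1)
  refine mul_le_one₀ ?_ (mul_nonneg h1 h2) (mul_le_one₀ h1' h2 h2')
  rw [div_le_one (by positivity)]
  nlinarith [sq_nonneg r]

lemma overlapTerm_mono {r r' : ℝ} (hr : 0 ≤ r) (h : r ≤ r') (k : ℕ) :
    overlapTerm (k + 4) r ≤ overlapTerm (k + 4) r' := by
  have hr' := hr.trans h
  rw [overlapTerm_eq hr, overlapTerm_eq hr']
  have h1 := (one_sub_beta_mem hr (k + 2)).1
  have h2 := (one_sub_beta_mem hr (k + 1)).1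
  have h1' := (one_sub_beta_mem hr' (k + 2)).1
  have m1 := (beta_anti_and_mul_beta_mono hr h (k + 2)).1
  have m2 := (beta_anti_and_mul_beta_mono hr h (k + 1)).1
  exact mul_le_mul (overlapFactor_mono hr h)
    (mul_le_mul (by linarith) (by linarith) h2 h1') (mul_nonneg h1 h2) (by positivity)

lemma bddAbove_overlapTerm {r : ℝ} (hr : 0 ≤ r) :
    BddAbove (Set.range fun n : {n : ℕ // 4 ≤ n} => overlapTerm n r) := by
  refine ⟨1, ?_⟩
  rintro _ ⟨⟨n, hn⟩, rfl⟩
  obtain ⟨k, rfl⟩ := Nat.exists_eq_add_of_le' hn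
  exact overlapTerm_le_one hr k

lemma overlapTerm_le_overlap {r : ℝ} (hr : 0 ≤ r) (k : ℕ) : overlapTerm (k + 4) r ≤ overlap r :=
  le_ciSup (bddAbove_overlapTerm hr) ⟨k + 4, by omega⟩

lemma overlap_nonneg {r : ℝ} (hr : 0 ≤ r) : 0 ≤ overlap r :=
  (overlapTerm_nonneg hr 0).trans (overlapTerm_le_overlap hr 0)

lemma monotoneOn_overlap : MonotoneOn overlap (Set.Ici 0) := by
  intro r hr r' _ h
  refine ciSup_mono (bddAbove_overlapTerm (le_trans hr h)) ?_
  rintro ⟨n, hn⟩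
  obtain ⟨k, rfl⟩ := Nat.exists_eq_add_of_le' hn
  exact overlapTerm_mono hr h k

lemma sq_overlapFactor_le_overlap {r : ℝ} (hr : 0 ≤ r) :
    (r ^ 2 / ((1 + r) * (1 + 2 * r))) ^ 2 ≤ overlap r := by
  refine le_trans (le_of_eq ?_) (overlapTerm_le_overlap hr 0)
  have h : (1 : ℝ) + r + r = 1 + 2 * r := by ring
  rw [overlapTerm_eq hr]
  simp only [beta, normSq, Nat.add_one_sub_one, mul_one, zero_add, h]
  field_simp
  ring

/-- `f_8(100) = 0.354…`, so that `f < 1/3` confines `r` to `[0, 100)`. -/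
lemma lt_of_overlap_lt {r : ℝ} (h : overlap r < 1 / 3) : r < 100 := by
  by_contra! hr
  have h1 : overlapTerm (4 + 4) 100 ≤ overlap 100 := overlapTerm_le_overlap (by norm_num) 4
  have h2 := monotoneOn_overlap (by norm_num : (100 : ℝ) ∈ Set.Ici 0)
    (Set.mem_Ici.2 (by linarith)) hr
  have h3 : (1 : ℝ) / 3 ≤ overlapTerm (4 + 4) 100 := by
    norm_num [overlapTerm, beta, normSq]
  linarith

/-- The martingale-type bound `(1 - √(3 f))² / 3` never exceeds the lower bound `1 / (1 + r)` for
the gap of the hard-core chain in the range where `f < 1/3`. -/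
lemma sq_one_sub_sqrt_overlap_le {r : ℝ} (hr : 0 ≤ r) (h : overlap r < 1 / 3) :
    1 / 3 * (1 - √(3 * overlap r)) ^ 2 ≤ 1 / (1 + r) := by
  have hr' := lt_of_overlap_lt h
  set x := r ^ 2 / ((1 + r) * (1 + 2 * r)) with hx
  have hx0 : 0 ≤ x := by positivity
  have hs1 : √(3 * overlap r) ≤ 1 := by
    exact Real.sqrt_le_one.2 (by linarith)
  have hs2 : 17 / 10 * x ≤ √(3 * overlap r) := by
    apply Real.le_sqrt_of_sq_le
    nlinarith [sq_overlapFactor_le_overlap hr, sq_nonneg x]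
  have h1 : (1 - √(3 * overlap r)) ^ 2 ≤ (1 - 17 / 10 * x) ^ 2 :=
    pow_le_pow_left₀ (by linarith) (by linarith) 2
  have h2 : 1 / 3 * (1 - 17 / 10 * x) ^ 2 ≤ 1 / (1 + r) := by
    have e : 1 - 17 / 10 * x = (1 + 3 * r + 3 / 10 * r ^ 2) / ((1 + r) * (1 + 2 * r)) := by
      rw [hx]; field_simp; ring
    rw [e, div_pow, ← mul_div_assoc, div_le_div_iff₀ (by positivity) (by positivity)]
    have : (1 + 3 * r + 3 / 10 * r ^ 2) ^ 2 ≤ 3 * (1 + r) * (1 + 2 * r) ^ 2 := by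
      nlinarith [mul_nonneg (pow_nonneg hr 3) (by linarith : 0 ≤ 100 - r), pow_nonneg hr 2,
        pow_nonneg hr 3]
    nlinarith [mul_le_mul_of_nonneg_left this (by linarith : 0 ≤ 1 + r)]
  linarith

/-! ### Spectral gap of the hard-core chain -/

/-- The subsets of `B` that contain no two points at distance two. -/
def indep (B : Finset ℤ) : Finset (Finset ℤ) :=
  B.powerset.filter fun σ => ∀ x ∈ σ, x + 2 ∉ σ

/-- The points of `B` that can be added to `σ` without creating two points at distance two. -/
def addable (B σ : Finset ℤ) : Finset ℤ :=
  B.filter fun i => i ∉ σ ∧ i + 2 ∉ σ ∧ i - 2 ∉ σ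

lemma mem_indep {B σ : Finset ℤ} : σ ∈ indep B ↔ σ ⊆ B ∧ ∀ x ∈ σ, x + 2 ∉ σ := by
  simp [indep]

lemma mem_addable {B σ : Finset ℤ} {i : ℤ} :
    i ∈ addable B σ ↔ i ∈ B ∧ i ∉ σ ∧ i + 2 ∉ σ ∧ i - 2 ∉ σ := by
  simp [addable]

lemma insert_mem_indep {B σ : Finset ℤ} {i : ℤ} (hσ : σ ∈ indep B) (hi : i ∈ addable B σ) :
    insert i σ ∈ indep B := by
  rw [mem_indep] at *
  rw [mem_addable] at hi
  refine ⟨Finset.insert_subset hi.1 hσ.1, fun x hx => ?_⟩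
  simp only [Finset.mem_insert] at hx ⊢
  rintro (h | h)
  · rcases hx with rfl | hx
    · omega
    · exact hi.2.2.2 (by rwa [show i - 2 = x by omega])
  · rcases hx with rfl | hx
    · exact hi.2.2.1 h
    · exact hσ.2 x hx h

lemma erase_mem_indep {B σ : Finset ℤ} (j : ℤ) (hσ : σ ∈ indep B) : σ.erase j ∈ indep B := by
  rw [mem_indep] at *
  exact ⟨(Finset.erase_subset _ _).trans hσ.1, fun x hx h =>
    hσ.2 x (Finset.mem_of_mem_erase hx) (Finset.mem_of_mem_erase h)⟩

lemma mem_addable_erase {B σ : Finset ℤ} {j : ℤ} (hσ : σ ∈ indep B) (hj : j ∈ σ) :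
    j ∈ addable B (σ.erase j) := by
  rw [mem_indep] at hσ
  rw [mem_addable]
  refine ⟨hσ.1 hj, Finset.notMem_erase _ _, fun h => hσ.2 j hj (Finset.mem_of_mem_erase h),
    fun h => hσ.2 (j - 2) (Finset.mem_of_mem_erase h) (by rwa [sub_add_cancel])⟩

/-- The indicator function of `i` being addable to `σ`. -/
def addInd (B σ : Finset ℤ) (i : ℤ) : ℝ := if i ∈ addable B σ then 1 else 0

/-- The weight of the edge `σ — insert i σ` in the metric that contracts under the Glauber
dynamics at fugacity `r`: the number of neighbours of `i` that are free in `σ` is penalized. -/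
def edgeWeight (r : ℝ) (B σ : Finset ℤ) (i : ℤ) : ℝ :=
  1 + r / 2 * (addInd B σ (i + 2) + addInd B σ (i - 2))

lemma addInd_nonneg (B σ : Finset ℤ) (i : ℤ) : 0 ≤ addInd B σ i := by
  unfold addInd; split_ifs <;> norm_num

lemma addInd_le_one (B σ : Finset ℤ) (i : ℤ) : addInd B σ i ≤ 1 := by
  unfold addInd; split_ifs <;> norm_num

lemma edgeWeight_pos {r : ℝ} (hr : 0 ≤ r) (B σ : Finset ℤ) (i : ℤ) : 0 < edgeWeight r B σ i := by
  have h1 := addInd_nonneg B σ (i + 2)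
  have h2 := addInd_nonneg B σ (i - 2)
  unfold edgeWeight
  positivity

lemma edgeWeight_le {r : ℝ} (hr : 0 ≤ r) (B σ : Finset ℤ) (i : ℤ) :
    edgeWeight r B σ i ≤ 1 + r := by
  have h1 := addInd_le_one B σ (i + 2)
  have h2 := addInd_le_one B σ (i - 2)
  unfold edgeWeight
  nlinarith

/-- Removing `j` frees the neighbour `i + 2` of `i` only if `j = i + 4`. -/
lemma addInd_erase_le {B σ : Finset ℤ} {i j : ℤ} {e : ℤ} (he : e = 2 ∨ e = -2)
    (hi : i ∈ addable B σ) :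
    addInd B (σ.erase j) (i + e) - addInd B σ (i + e) ≤
      if j = i + 2 * e then 1 - addInd B σ (i + e) else 0 := by
  rw [mem_addable] at hi
  unfold addInd
  by_cases h1 : j = i + 2 * e
  · rw [if_pos h1]
    split_ifs <;> norm_num
  · rw [if_neg h1]
    by_cases h2 : i + e ∈ addable B (σ.erase j)
    · have h3 : i + e ∈ addable B σ := by
        rw [mem_addable] at *
        simp only [Finset.mem_erase, not_and] at h2
        rcases he with rfl | rfl
        · refine ⟨h2.1, hi.2.2.1, fun h => h2.2.2.1 (by omega) h, ?_⟩
          simpa using hi.2.1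
        · refine ⟨h2.1, hi.2.2.2, ?_, fun h => h2.2.2.2 (by omega) h⟩
          simpa using hi.2.1
      rw [if_pos h2, if_pos h3]; norm_num
    · rw [if_neg h2]; split_ifs <;> norm_num

/-- Adding `j = i + 4` blocks the neighbour `i + 2` of `i`. -/
lemma addInd_insert_le {B σ : Finset ℤ} {i j : ℤ} {e : ℤ} (he : e = 2 ∨ e = -2) :
    addInd B (insert j σ) (i + e) ≤
      addInd B σ (i + e) - if j = i + 2 * e then addInd B σ (i + e) else 0 := by
  unfold addInd
  by_cases h1 : j = i + 2 * e
  · have h2 : i + e ∉ addable B (insert j σ) := by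
      rw [mem_addable]
      simp only [Finset.mem_insert]
      rcases he with rfl | rfl <;> omega
    rw [if_neg h2, if_pos h1]; simp
  · rw [if_neg h1, sub_zero]
    by_cases h2 : i + e ∈ addable B (insert j σ)
    · have h3 : i + e ∈ addable B σ := by
        rw [mem_addable] at *
        simp only [Finset.mem_insert, not_or] at h2
        tauto
      rw [if_pos h2, if_pos h3]
    · rw [if_neg h2]; split_ifs <;> norm_num

lemma sum_ite_eq_le {s : Finset ℤ} {a : ℤ} {c : ℝ} (hc : 0 ≤ c) :
    ∑ j ∈ s, (if j = a then c else 0) ≤ c := by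
  rw [Finset.sum_ite_eq']
  split_ifs <;> simp [hc]

/-- The points at distance two from `i` that can be added to `σ`. -/
def neighbours (B σ : Finset ℤ) (i : ℤ) : Finset ℤ :=
  (addable B σ).filter fun j => j = i + 2 ∨ j = i - 2

lemma addable_insert {B σ : Finset ℤ} {i j : ℤ} :
    j ∈ addable B (insert i σ) ↔ j ∈ addable B σ ∧ j ≠ i ∧ j ≠ i + 2 ∧ j ≠ i - 2 := by
  simp only [mem_addable, Finset.mem_insert, not_or]
  constructor
  · rintro ⟨h1, h2, h3, h4⟩
    exact ⟨⟨h1, h2.2, h3.2, h4.2⟩, h2.1, by omega, by omega⟩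
  · rintro ⟨⟨h1, h2, h3, h4⟩, h5, h6, h7⟩
    exact ⟨h1, ⟨h5, h2⟩, ⟨by omega, h3⟩, ⟨by omega, h4⟩⟩

lemma sum_addable {M : Type*} [AddCommMonoid M] {B σ : Finset ℤ} {i : ℤ} (hi : i ∈ addable B σ)
    (f : ℤ → M) : ∑ j ∈ addable B σ, f j =
      f i + (∑ j ∈ addable B (insert i σ), f j + ∑ j ∈ neighbours B σ i, f j) := by
  have h1 : addable B (insert i σ) = ((addable B σ).erase i).filter
      fun j => ¬ (j = i + 2 ∨ j = i - 2) := by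
    ext j
    rw [addable_insert, Finset.mem_filter, Finset.mem_erase]
    tauto
  have h2 : neighbours B σ i = ((addable B σ).erase i).filter
      fun j => (j = i + 2 ∨ j = i - 2) := by
    ext j
    rw [neighbours, Finset.mem_filter, Finset.mem_filter, Finset.mem_erase]
    have : (j = i + 2 ∨ j = i - 2) → j ≠ i := by omega
    tauto
  rw [h1, h2, add_comm (∑ j ∈ Finset.filter _ _, f j), Finset.sum_filter_add_sum_filter_not,
    Finset.add_sum_erase _ _ hi]

lemma sum_neighbours {B σ : Finset ℤ} (i : ℤ) (f : ℤ → ℝ) :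
    ∑ j ∈ neighbours B σ i, f j =
      addInd B σ (i + 2) * f (i + 2) + addInd B σ (i - 2) * f (i - 2) := by
  have h : neighbours B σ i = ({i + 2, i - 2} : Finset ℤ).filter (· ∈ addable B σ) := by
    ext j; simp [neighbours, and_comm]
  rw [h, Finset.sum_filter, Finset.sum_pair (by omega)]
  simp [addInd]

/-- The contraction estimate for the weighted metric. With `k` the number of free neighbours of
`i`, the left-hand side is at least
`(1 + r) (1 + r k / 2) - (r / 2) (2 - k) - r (1 + r / 2) k = 1`. -/
lemma one_le_weight_drift {r : ℝ} (hr : 0 ≤ r) {B σ : Finset ℤ} {i : ℤ}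
    (hi : i ∈ addable B σ) :
    1 ≤ (1 + r) * edgeWeight r B σ i
      + ∑ j ∈ σ, (edgeWeight r B σ i - edgeWeight r B (σ.erase j) i)
      + r * ∑ j ∈ addable B (insert i σ), (edgeWeight r B σ i - edgeWeight r B (insert j σ) i)
      - r * ∑ j ∈ neighbours B σ i, edgeWeight r B σ j := by
  set p := addInd B σ (i + 2) with hp
  set m := addInd B σ (i - 2) with hm
  have hp1 := addInd_le_one B σ (i + 2)
  have hm1 := addInd_le_one B σ (i - 2)
  have hp0 := addInd_nonneg B σ (i + 2)
  have hm0 := addInd_nonneg B σ (i - 2)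
  have hW : edgeWeight r B σ i = 1 + r / 2 * (p + m) := rfl
  have e1 : i + -2 = i - 2 := by ring
  have e2 : i + 2 * -2 = i - 4 := by ring
  have e3 : i + 2 * 2 = i + 4 := by ring
  -- removals
  have A : ∑ j ∈ σ, (edgeWeight r B (σ.erase j) i - edgeWeight r B σ i) ≤
      r / 2 * ((1 - p) + (1 - m)) := by
    calc _ ≤ ∑ j ∈ σ, r / 2 * ((if j = i + 4 then 1 - p else 0) +
            (if j = i - 4 then 1 - m else 0)) := by
          refine Finset.sum_le_sum fun j _ => ?_
          have h1 := addInd_erase_le (j := j) (e := 2) (Or.inl rfl) hi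
          have h2 := addInd_erase_le (j := j) (e := -2) (Or.inr rfl) hi
          rw [e1, e2] at h2
          rw [e3] at h1
          rw [hW, edgeWeight]
          have := mul_le_mul_of_nonneg_left (add_le_add h1 h2) (by linarith : 0 ≤ r / 2)
          linarith
      _ ≤ _ := by
          rw [← Finset.mul_sum, Finset.sum_add_distrib]
          exact mul_le_mul_of_nonneg_left (add_le_add (sum_ite_eq_le (by linarith))
            (sum_ite_eq_le (by linarith))) (by linarith)
  -- insertions
  set hq := addInd B σ (i + 4) with hhq
  set hn := addInd B σ (i - 4) with hhn
  have add4 : (if i + 4 ∈ addable B (insert i σ) then p else 0) = hq * p := by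
    rw [hhq, addInd]
    have : i + 4 ∈ addable B (insert i σ) ↔ i + 4 ∈ addable B σ := by
      rw [addable_insert]
      exact ⟨And.left, fun h => ⟨h, by omega, by omega, by omega⟩⟩
    simp [this]
  have sub4 : (if i - 4 ∈ addable B (insert i σ) then m else 0) = hn * m := by
    rw [hhn, addInd]
    have : i - 4 ∈ addable B (insert i σ) ↔ i - 4 ∈ addable B σ := by
      rw [addable_insert]
      exact ⟨And.left, fun h => ⟨h, by omega, by omega, by omega⟩⟩
    simp [this]
  have C : r / 2 * (hq * p + hn * m) ≤
      ∑ j ∈ addable B (insert i σ), (edgeWeight r B σ i - edgeWeight r B (insert j σ) i) := by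
    calc _ = ∑ j ∈ addable B (insert i σ), r / 2 * ((if j = i + 4 then p else 0) +
            (if j = i - 4 then m else 0)) := by
          rw [← Finset.mul_sum, Finset.sum_add_distrib, Finset.sum_ite_eq', Finset.sum_ite_eq',
            add4, sub4]
      _ ≤ _ := by
          refine Finset.sum_le_sum fun j hj => ?_
          have h1 := addInd_insert_le (B := B) (σ := σ) (i := i) (j := j) (e := 2) (Or.inl rfl)
          have h2 := addInd_insert_le (B := B) (σ := σ) (i := i) (j := j) (e := -2) (Or.inr rfl)
          rw [e1, e2] at h2
          rw [e3] at h1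
          rw [hW, edgeWeight]
          have := mul_le_mul_of_nonneg_left (add_le_add h1 h2) (by linarith : 0 ≤ r / 2)
          linarith
  -- edges at the free neighbours
  have D : ∑ j ∈ neighbours B σ i, edgeWeight r B σ j =
      p * (1 + r / 2 * (hq + 1)) + m * (1 + r / 2 * (hn + 1)) := by
    have hii : addInd B σ i = 1 := if_pos hi
    rw [sum_neighbours, edgeWeight, edgeWeight, show i + 2 + 2 = i + 4 by ring,
      show i + 2 - 2 = i by ring, show i - 2 + 2 = i by ring, show i - 2 - 2 = i - 4 by ring, hii]
    ring
  have A' : -(r / 2 * ((1 - p) + (1 - m))) ≤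
      ∑ j ∈ σ, (edgeWeight r B σ i - edgeWeight r B (σ.erase j) i) := by
    rw [neg_le, ← Finset.sum_neg_distrib]
    simpa using A
  have C' := mul_le_mul_of_nonneg_left C hr
  have hW' : (1 + r) * edgeWeight r B σ i = (1 + r) * (1 + r / 2 * (p + m)) := by rw [hW]
  rw [D, hW']
  linarith

/-- An eigenvalue `E ≠ 0` of the Glauber generator of the hard-core chain is at least
`1 / (1 + r)`: the eigenvalue equation is differenced along the edge that maximizes the weighted
gradient of the eigenfunction. -/
lemma inv_le_eigenvalue {r E : ℝ} (hr : 0 ≤ r) (hE : E ≠ 0) {B : Finset ℤ} {g : Finset ℤ → ℂ}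
    (hg : ∃ σ ∈ indep B, g σ ≠ 0)
    (heq : ∀ σ ∈ indep B, (E : ℂ) * g σ = ∑ j ∈ σ, (g σ - g (σ.erase j)) -
      r * ∑ j ∈ addable B σ, (g (insert j σ) - g σ)) :
    1 / (1 + r) ≤ E := by
  set d : Finset ℤ → ℤ → ℂ := fun σ i => g (insert i σ) - g σ with hd
  set P := (indep B ×ˢ B).filter fun p => p.2 ∈ addable B p.1 with hP
  have memP : ∀ σ i, σ ∈ indep B → i ∈ addable B σ → (σ, i) ∈ P := fun σ i hσ hi => by
    rw [hP, Finset.mem_filter, Finset.mem_product]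
    exact ⟨⟨hσ, (mem_addable.1 hi).1⟩, hi⟩
  have dpos : ∃ p ∈ P, d p.1 p.2 ≠ 0 := by
    by_contra! h0
    obtain ⟨σ, hσ, hne⟩ := hg
    have h := heq σ hσ
    rw [Finset.sum_eq_zero, Finset.sum_eq_zero] at h
    · simp [hE, hne] at h
    · intro j hj
      exact h0 _ (memP σ j hσ hj)
    · intro j hj
      have := h0 _ (memP (σ.erase j) j (erase_mem_indep j hσ) (mem_addable_erase hσ hj))
      simpa [hd, Finset.insert_erase hj] using this
  obtain ⟨p0, hp0, hp0'⟩ := dpos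
  obtain ⟨⟨σ, i⟩, hp, hmax⟩ := Finset.exists_max_image P
    (fun p => ‖d p.1 p.2‖ / edgeWeight r B p.1 p.2) ⟨p0, hp0⟩
  set M := ‖d σ i‖ / edgeWeight r B σ i with hM
  have hMpos : 0 < M :=
    lt_of_lt_of_le (div_pos (norm_pos_iff.2 hp0') (edgeWeight_pos hr _ _ _)) (hmax p0 hp0)
  have bound : ∀ τ j, τ ∈ indep B → j ∈ addable B τ → ‖d τ j‖ ≤ M * edgeWeight r B τ j := by
    intro τ j hτ hj
    have := hmax _ (memP τ j hτ hj)
    rwa [div_le_iff₀ (edgeWeight_pos hr _ _ _)] at this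
  rw [hP, Finset.mem_filter, Finset.mem_product] at hp
  obtain ⟨⟨hσ, -⟩, hi⟩ := hp
  dsimp only at hσ hi
  have hiσ : i ∉ σ := (mem_addable.1 hi).2.1
  have hdM : ‖d σ i‖ = M * edgeWeight r B σ i := by
    rw [hM, div_mul_cancel₀ _ (edgeWeight_pos hr _ _ _).ne']
  set T := addable B (insert i σ) with hT
  -- the differenced eigenvalue equation
  have key : ((1 + r + σ.card + r * T.card - E : ℝ) : ℂ) * d σ i =
      ∑ j ∈ σ, d (σ.erase j) i + r * ∑ j ∈ T, d (insert j σ) i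
        - r * ∑ j ∈ neighbours B σ i, d σ j := by
    have h1 := heq σ hσ
    have h2 := heq _ (insert_mem_indep hσ hi)
    rw [Finset.sum_insert hiσ, Finset.erase_insert hiσ] at h2
    rw [sum_addable hi] at h1
    have h3 : ∑ j ∈ σ, (g (insert i σ) - g ((insert i σ).erase j)) =
        ∑ j ∈ σ, (g σ - g (σ.erase j)) + (σ.card * d σ i - ∑ j ∈ σ, d (σ.erase j) i) := by
      rw [← nsmul_eq_mul, ← Finset.sum_const, ← Finset.sum_sub_distrib, ← Finset.sum_add_distrib]
      refine Finset.sum_congr rfl fun j hj => ?_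
      rw [Finset.erase_insert_of_ne (by rintro rfl; exact hiσ hj)]
      simp only [hd]; ring
    have h4 : ∑ j ∈ T, (g (insert j (insert i σ)) - g (insert i σ)) =
        ∑ j ∈ T, (g (insert j σ) - g σ) + (∑ j ∈ T, d (insert j σ) i - T.card * d σ i) := by
      rw [← nsmul_eq_mul, ← Finset.sum_const, ← Finset.sum_sub_distrib, ← Finset.sum_add_distrib]
      refine Finset.sum_congr rfl fun j hj => ?_
      simp only [hd, Finset.insert_comm i j]; ring
    rw [h3, h4] at h2
    have h5 : (E : ℂ) * d σ i = E * g (insert i σ) - E * g σ := by simp only [hd]; ring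
    push_cast
    rw [h1, h2] at h5
    have h6 : ∑ j ∈ neighbours B σ i, d σ j =
      ∑ j ∈ neighbours B σ i, (g (insert j σ) - g σ) := rfl
    have h7 : g (insert i σ) - g σ = d σ i := rfl
    rw [h6]
    rw [h7] at h5
    linear_combination -h5
  have hn := congrArg norm key
  rw [norm_mul, Complex.norm_real, Real.norm_eq_abs] at hn
  have hup : ‖∑ j ∈ σ, d (σ.erase j) i + r * ∑ j ∈ T, d (insert j σ) i
        - r * ∑ j ∈ neighbours B σ i, d σ j‖ ≤
      ∑ j ∈ σ, M * edgeWeight r B (σ.erase j) i + r * ∑ j ∈ T, M * edgeWeight r B (insert j σ) i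
        + r * ∑ j ∈ neighbours B σ i, M * edgeWeight r B σ j := by
    refine (norm_sub_le _ _).trans (add_le_add ((norm_add_le _ _).trans (add_le_add ?_ ?_)) ?_)
    · refine (norm_sum_le _ _).trans (Finset.sum_le_sum fun j hj => ?_)
      refine bound _ _ (erase_mem_indep j hσ) ?_
      rw [mem_addable] at hi ⊢
      simp only [Finset.mem_erase]
      tauto
    · rw [norm_mul, Complex.norm_real, Real.norm_of_nonneg hr]
      refine mul_le_mul_of_nonneg_left ?_ hr
      refine (norm_sum_le _ _).trans (Finset.sum_le_sum fun j hj => ?_)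
      rw [hT, addable_insert] at hj
      refine bound _ _ (insert_mem_indep hσ hj.1) ?_
      rw [addable_insert]
      exact ⟨hi, hj.2.1.symm, by omega, by omega⟩
    · rw [norm_mul, Complex.norm_real, Real.norm_of_nonneg hr]
      refine mul_le_mul_of_nonneg_left ?_ hr
      refine (norm_sum_le _ _).trans (Finset.sum_le_sum fun j hj => ?_)
      exact bound _ _ hσ (Finset.mem_filter.1 hj).1
  rw [← hn, hdM, ← Finset.mul_sum, ← Finset.mul_sum, ← Finset.mul_sum] at hup
  set w := edgeWeight r B σ i with hw
  have hwpos : 0 < w := edgeWeight_pos hr _ _ _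
  have hlow : (1 + r + σ.card + r * T.card - E) * w ≤
      ∑ j ∈ σ, edgeWeight r B (σ.erase j) i + r * ∑ j ∈ T, edgeWeight r B (insert j σ) i
        + r * ∑ j ∈ neighbours B σ i, edgeWeight r B σ j := by
    refine le_of_mul_le_mul_left ?_ hMpos
    have := mul_le_mul_of_nonneg_right (le_abs_self (1 + r + σ.card + r * T.card - E))
      (mul_pos hMpos hwpos).le
    linarith
  have hdrift := one_le_weight_drift hr hi
  rw [← hw, Finset.sum_sub_distrib, Finset.sum_sub_distrib, Finset.sum_const, Finset.sum_const,
    nsmul_eq_mul, nsmul_eq_mul, ← hT] at hdrift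
  have h1 : 1 ≤ E * w := by linarith
  have hEpos : 0 < E := by
    by_contra! h
    nlinarith [mul_nonneg (neg_nonneg.2 h) hwpos.le]
  rw [div_le_iff₀ (by linarith)]
  have := mul_le_mul_of_nonneg_left (edgeWeight_le hr B σ i) hEpos.le
  linarith

/-- If every non-zero eigenvalue of `Q† Q` is at least `γ`, then `Q† Q ≥ γ` on the orthogonal
complement of `ker Q`. -/
lemma mul_norm_sq_le_of_eigenvalues {V W : Type*} [NormedAddCommGroup V] [InnerProductSpace ℂ V]
    [FiniteDimensional ℂ V] [NormedAddCommGroup W] [InnerProductSpace ℂ W]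
    [FiniteDimensional ℂ W] (Q : V →ₗ[ℂ] W) {γ : ℝ}
    (h : ∀ (t : ℝ) (u : V), u ≠ 0 → t ≠ 0 → (∀ v, ⟪Q v, Q u⟫_ℂ = t * ⟪v, u⟫_ℂ) → γ ≤ t)
    {u : V} (hu : ∀ v, Q v = 0 → ⟪v, u⟫_ℂ = 0) : γ * ‖u‖ ^ 2 ≤ ‖Q u‖ ^ 2 := by
  set T := LinearMap.adjoint Q ∘ₗ Q with hTdef
  have hTin : ∀ v w, ⟪v, T w⟫_ℂ = ⟪Q v, Q w⟫_ℂ := fun v w => by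
    rw [hTdef, LinearMap.comp_apply, LinearMap.adjoint_inner_right]
  have hT : T.IsSymmetric := fun v w => by
    rw [hTin, ← inner_conj_symm, hTin, inner_conj_symm]
  obtain ⟨b, μ, hb⟩ : ∃ (b : OrthonormalBasis (Fin (Module.finrank ℂ V)) ℂ V)
      (μ : Fin (Module.finrank ℂ V) → ℝ), ∀ i, T (b i) = (μ i : ℂ) • b i :=
    ⟨hT.eigenvectorBasis rfl, hT.eigenvalues rfl, fun i => hT.apply_eigenvectorBasis rfl i⟩
  have hμ : ∀ i, γ * ‖⟪b i, u⟫_ℂ‖ ^ 2 ≤ μ i * ‖⟪b i, u⟫_ℂ‖ ^ 2 := by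
    intro i
    by_cases h0 : μ i = 0
    · have hQ : Q (b i) = 0 := by
        rw [← inner_self_eq_zero (𝕜 := ℂ), ← hTin, hb, h0]
        simp
      rw [hu _ hQ]; simp
    · refine mul_le_mul_of_nonneg_right (h (μ i) (b i) (b.orthonormal.ne_zero i) h0 fun v => ?_)
        (sq_nonneg _)
      rw [← hTin, hb, inner_smul_right]
  have e1 : ‖u‖ ^ 2 = ∑ i, ‖⟪b i, u⟫_ℂ‖ ^ 2 := (b.sum_sq_norm_inner_right u).symm
  have e2 : ‖Q u‖ ^ 2 = ∑ i, μ i * ‖⟪b i, u⟫_ℂ‖ ^ 2 := by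
    have : ((‖Q u‖ ^ 2 : ℝ) : ℂ) = ((∑ i, μ i * ‖⟪b i, u⟫_ℂ‖ ^ 2 : ℝ) : ℂ) := by
      push_cast
      have hq : ((‖Q u‖ : ℝ) : ℂ) ^ 2 = ⟪Q u, Q u⟫_ℂ := by
        exact_mod_cast (inner_self_eq_norm_sq_to_K (𝕜 := ℂ) (Q u)).symm
      rw [hq, ← hTin, ← b.sum_inner_mul_inner]
      refine Finset.sum_congr rfl fun i _ => ?_
      rw [← hT, hb, inner_smul_left, Complex.conj_ofReal, ← inner_conj_symm u (b i),
        ← Complex.conj_mul']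
      ring
    exact_mod_cast this
  rw [e1, e2, Finset.mul_sum]
  exact Finset.sum_le_sum fun i _ => hμ i

/-- Extension by zero of a function on the independent sets. -/
def extendIndep {B : Finset ℤ} (u : EuclideanSpace ℂ (indep B)) (σ : Finset ℤ) : ℂ :=
  if h : σ ∈ indep B then u ⟨σ, h⟩ else 0

/-- The gradient `(σ, i) ↦ u(σ ∪ {i}) - c u(σ)`, extended by zero to all pairs `(σ, i)`. -/
def grad (c : ℂ) (B : Finset ℤ) :
    EuclideanSpace ℂ (indep B) →ₗ[ℂ] EuclideanSpace ℂ (indep B × B) where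
  toFun u := WithLp.toLp 2 fun p => if (p.2 : ℤ) ∈ addable B p.1 then
    extendIndep u (insert (p.2 : ℤ) (p.1 : Finset ℤ)) - c * extendIndep u p.1 else 0
  map_add' u v := by
    ext p
    simp only [extendIndep, PiLp.add_apply]
    split_ifs <;> ring
  map_smul' a u := by
    ext p
    simp only [extendIndep, PiLp.smul_apply, smul_eq_mul, RingHom.id_apply]
    split_ifs <;> ring

lemma grad_apply (c : ℂ) {B : Finset ℤ} (u : EuclideanSpace ℂ (indep B)) (p : indep B × B) :
    grad c B u p = if (p.2 : ℤ) ∈ addable B p.1 then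
      extendIndep u (insert (p.2 : ℤ) (p.1 : Finset ℤ)) - c * extendIndep u p.1 else 0 := rfl

lemma sum_indep_prod {M : Type*} [AddCommMonoid M] {B : Finset ℤ} (F : Finset ℤ → ℤ → M) :
    ∑ p : indep B × B, (if (p.2 : ℤ) ∈ addable B p.1 then F p.1 p.2 else 0) =
      ∑ σ ∈ indep B, ∑ i ∈ addable B σ, F σ i := by
  rw [Fintype.sum_prod_type, ← Finset.sum_coe_sort (indep B)]
  refine Finset.sum_congr rfl fun σ _ => ?_
  rw [Finset.sum_coe_sort B (fun i => if i ∈ addable B (σ : Finset ℤ) then F σ i else 0),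
    ← Finset.sum_filter]
  refine Finset.sum_congr ?_ fun _ _ => rfl
  ext i
  rw [Finset.mem_filter]
  exact ⟨And.right, fun h => ⟨(mem_addable.1 h).1, h⟩⟩

/-- Summation over the edges of the hard-core chain, indexed by the upper or the lower endpoint. -/
lemma sum_edges {M : Type*} [AddCommMonoid M] {B : Finset ℤ} (F : Finset ℤ → ℤ → M) :
    ∑ σ ∈ indep B, ∑ i ∈ addable B σ, F σ i =
      ∑ σ ∈ indep B, ∑ i ∈ σ, F (σ.erase i) i := by
  rw [Finset.sum_sigma', Finset.sum_sigma']
  refine Finset.sum_bij' (fun p _ => ⟨insert p.2 p.1, p.2⟩) (fun p _ => ⟨p.1.erase p.2, p.2⟩)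
    ?_ ?_ ?_ ?_ ?_
  · rintro ⟨σ, i⟩ h
    simp only [Finset.mem_sigma] at h ⊢
    exact ⟨insert_mem_indep h.1 h.2, Finset.mem_insert_self _ _⟩
  · rintro ⟨σ, i⟩ h
    simp only [Finset.mem_sigma] at h ⊢
    exact ⟨erase_mem_indep _ h.1, mem_addable_erase h.1 h.2⟩
  · rintro ⟨σ, i⟩ h
    simp only [Finset.mem_sigma] at h
    simp [Finset.erase_insert (mem_addable.1 h.2).2.1]
  · rintro ⟨σ, i⟩ h
    simp only [Finset.mem_sigma] at h
    simp [Finset.insert_erase h.2]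
  · rintro ⟨σ, i⟩ h
    simp only [Finset.mem_sigma] at h
    simp [Finset.erase_insert (mem_addable.1 h.2).2.1]

lemma extendIndep_single {B : Finset ℤ} (σ : indep B) (τ : Finset ℤ) :
    extendIndep (EuclideanSpace.single σ (1 : ℂ)) τ = if τ = σ then 1 else 0 := by
  unfold extendIndep
  by_cases h : τ ∈ indep B
  · rw [dif_pos h, PiLp.single_apply]
    simp only [Subtype.ext_iff]
  · rw [dif_neg h, if_neg]
    rintro rfl
    exact h σ.2

/-- The gap of the hard-core chain, before division by the ground state `σ ↦ c ^ |σ|`. -/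
lemma hardcore_gap {c : ℂ} (hc : c ≠ 0) (B : Finset ℤ) (u : Finset ℤ → ℂ)
    (hu : ∑ σ ∈ indep B, starRingEnd ℂ (c ^ σ.card) * u σ = 0) :
    1 / (1 + ‖c‖ ^ 2) * ∑ σ ∈ indep B, ‖u σ‖ ^ 2 ≤
      ∑ σ ∈ indep B, ∑ i ∈ addable B σ, ‖u (insert i σ) - c * u σ‖ ^ 2 := by
  have hr : 0 ≤ ‖c‖ ^ 2 := sq_nonneg _
  set U : EuclideanSpace ℂ (indep B) := WithLp.toLp 2 fun σ => u σ with hU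
  have extU : ∀ σ ∈ indep B, extendIndep U σ = u σ := fun σ hσ => by
    rw [extendIndep, dif_pos hσ]
  have main := mul_norm_sq_le_of_eigenvalues (grad c B) (γ := 1 / (1 + ‖c‖ ^ 2)) (u := U) ?_ ?_
  · rw [EuclideanSpace.norm_sq_eq, EuclideanSpace.norm_sq_eq,
      Finset.sum_coe_sort (indep B) (fun σ => ‖u σ‖ ^ 2)] at main
    refine main.trans (le_of_eq ?_)
    rw [← sum_indep_prod (fun σ i => ‖u (insert i σ) - c * u σ‖ ^ 2)]
    refine Finset.sum_congr rfl fun p _ => ?_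
    rw [grad_apply]
    split_ifs with h
    · rw [extU _ p.1.2, extU _ (insert_mem_indep p.1.2 h)]
    · simp
  · intro t v hv ht heq
    set w := extendIndep v with hw
    refine inv_le_eigenvalue (g := fun σ => w σ / c ^ σ.card) (B := B) hr ht ?_ ?_
    · by_contra! h0
      apply hv
      ext σ
      have := h0 σ σ.2
      rw [div_eq_zero_iff, or_iff_left (pow_ne_zero _ hc), hw, extendIndep, dif_pos σ.2] at this
      exact this
    · intro σ hσ
      have h1 := heq (EuclideanSpace.single ⟨σ, hσ⟩ 1)
      rw [EuclideanSpace.inner_single_left, map_one, one_mul, PiLp.inner_apply] at h1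
      obtain ⟨G, hG⟩ : ∃ G : Finset ℤ → ℤ → ℂ, ∀ τ i, G τ i =
          (if insert i τ = σ then w (insert i τ) - c * w τ else 0)
            - starRingEnd ℂ c * (if τ = σ then w (insert i τ) - c * w τ else 0) :=
        ⟨_, fun _ _ => rfl⟩
      have h2 : ∑ p : indep B × B, ⟪grad c B (EuclideanSpace.single ⟨σ, hσ⟩ 1) p, grad c B v p⟫_ℂ =
          ∑ p : indep B × B, (if (p.2 : ℤ) ∈ addable B p.1 then
            G p.1 p.2 else 0) := by
        refine Finset.sum_congr rfl fun p _ => ?_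
        rw [hG, grad_apply, grad_apply, extendIndep_single, extendIndep_single]
        simp only [RCLike.inner_apply]
        split_ifs <;> simp [hw] <;> ring
      have h3 : v ⟨σ, hσ⟩ = w σ := by rw [hw, extendIndep, dif_pos hσ]
      rw [h2, sum_indep_prod] at h1
      simp only [hG, Finset.sum_sub_distrib, ← Finset.mul_sum] at h1
      rw [sum_edges (fun τ i => if insert i τ = σ then w (insert i τ) - c * w τ else 0)] at h1
      have h4 : ∑ τ ∈ indep B, ∑ i ∈ τ, (if insert i (τ.erase i) = σ then
          w (insert i (τ.erase i)) - c * w (τ.erase i) else 0) =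
          ∑ i ∈ σ, (w σ - c * w (σ.erase i)) := by
        rw [Finset.sum_eq_single_of_mem σ hσ]
        · refine Finset.sum_congr rfl fun i hi => ?_
          rw [Finset.insert_erase hi, if_pos rfl]
        · intro τ _ hne
          refine Finset.sum_eq_zero fun i hi => ?_
          rw [Finset.insert_erase hi, if_neg hne]
      have h5 : ∑ τ ∈ indep B, ∑ i ∈ addable B τ,
          (if τ = σ then w (insert i τ) - c * w τ else 0) =
          ∑ i ∈ addable B σ, (w (insert i σ) - c * w σ) := by
        rw [Finset.sum_eq_single_of_mem σ hσ]
        · simp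
        · intro τ _ hne
          simp [hne]
      rw [h4, h5, h3] at h1
      have hcp : c ^ σ.card ≠ 0 := pow_ne_zero _ hc
      have h6 : ∑ i ∈ σ, (w σ / c ^ σ.card - w (σ.erase i) / c ^ (σ.erase i).card) =
          (∑ i ∈ σ, (w σ - c * w (σ.erase i))) / c ^ σ.card := by
        rw [Finset.sum_div]
        refine Finset.sum_congr rfl fun i hi => ?_
        rw [← Finset.card_erase_add_one hi, pow_succ]
        have := pow_ne_zero (σ.erase i).card hc
        field_simp
      have h7 : ∑ i ∈ addable B σ, (w (insert i σ) / c ^ (insert i σ).card - w σ / c ^ σ.card) =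
          (∑ i ∈ addable B σ, (w (insert i σ) - c * w σ)) / c ^ σ.card / c := by
        rw [Finset.sum_div, Finset.sum_div]
        refine Finset.sum_congr rfl fun i hi => ?_
        rw [Finset.card_insert_of_notMem (mem_addable.1 hi).2.1, pow_succ]
        field_simp
      rw [h6, h7]
      have h8 : ((‖c‖ ^ 2 : ℝ) : ℂ) = starRingEnd ℂ c * c := by
        rw [Complex.conj_mul']; push_cast; rfl
      rw [h8]
      generalize ∑ i ∈ σ, (w σ - c * w (σ.erase i)) = X at h1 ⊢
      generalize ∑ i ∈ addable B σ, (w (insert i σ) - c * w σ) = Y at h1 ⊢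
      field_simp
      linear_combination -h1
  · intro v hv
    -- a vector in the kernel of the gradient is a multiple of `σ ↦ c ^ |σ|`
    set w := extendIndep v with hw
    have hstep : ∀ σ ∈ indep B, ∀ i ∈ addable B σ, w (insert i σ) = c * w σ := by
      intro σ hσ i hi
      have h : grad c B v (⟨σ, hσ⟩, ⟨i, (mem_addable.1 hi).1⟩) = 0 := by rw [hv]; rfl
      rw [grad_apply, if_pos hi] at h
      exact sub_eq_zero.1 h
    have hpow : ∀ (n : ℕ) (σ : Finset ℤ), σ.card = n → σ ∈ indep B → w σ = c ^ n * w ∅ := by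
      intro n
      induction n with
      | zero =>
        intro σ h0 _
        rw [Finset.card_eq_zero.1 h0]; simp
      | succ n ih =>
        intro σ hn hσ
        obtain ⟨i, hi⟩ : σ.Nonempty := Finset.card_pos.1 (by omega)
        have h1 := hstep _ (erase_mem_indep i hσ) i (mem_addable_erase hσ hi)
        rw [Finset.insert_erase hi] at h1
        rw [h1, ih _ (by rw [Finset.card_erase_of_mem hi]; omega) (erase_mem_indep i hσ)]
        ring
    rw [PiLp.inner_apply]
    have : ∀ σ : indep B, ⟪v σ, U σ⟫_ℂ =
        starRingEnd ℂ (w ∅) * (starRingEnd ℂ (c ^ (σ : Finset ℤ).card) * u σ) := by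
      intro σ
      have h1 : v σ = w σ := by rw [hw, extendIndep, dif_pos σ.2]
      rw [h1, hpow _ σ rfl σ.2, RCLike.inner_apply, map_mul]
      simp only [hU]
      ring
    simp only [this]
    rw [← Finset.mul_sum, Finset.sum_coe_sort (indep B)
      (fun σ => starRingEnd ℂ (c ^ σ.card) * u σ), hu, mul_zero]

/-! ### Configurations -/

section Configurations

variable {a b : ℤ}

lemma occ_of_notMem (μ : Config a b) {x : ℤ} (h : x ∉ Set.Icc a b) : occ μ x = 0 := dif_neg h

lemma mem_Icc_of_occ {μ : Config a b} {x : ℤ} (h : 1 ≤ occ μ x) : x ∈ Set.Icc a b := by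
  by_contra hx
  rw [occ_of_notMem μ hx] at h
  omega

lemma occ_coe (μ : Config a b) (y : Set.Icc a b) : occ μ y = μ y := dif_pos y.2

lemma config_ext {μ ν : Config a b} (h : ∀ y ∈ Set.Icc a b, occ μ y = occ ν y) : μ = ν := by
  funext y
  rw [← occ_coe μ, ← occ_coe ν]
  exact h y y.2

/-- The configuration with prescribed occupation numbers on `[a, b]`. -/
def ofOcc (a b : ℤ) (f : ℤ → ℕ) : Config a b := fun y => f y

lemma occ_ofOcc (f : ℤ → ℕ) {y : ℤ} (h : y ∈ Set.Icc a b) : occ (ofOcc a b f) y = f y := dif_pos h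

lemma occ_addAt {x : ℤ} (hx : x ∈ Set.Icc a b) (μ : Config a b) (y : ℤ) :
    occ (addAt x μ) y = occ μ y + if y = x then 1 else 0 := by
  unfold occ addAt
  by_cases hy : y ∈ Set.Icc a b
  · simp only [dif_pos hy]
    split_ifs <;> rfl
  · rw [dif_neg hy, dif_neg hy, if_neg]
    rintro rfl
    exact hy hx

lemma addAt_comm (x y : ℤ) (μ : Config a b) : addAt x (addAt y μ) = addAt y (addAt x μ) := by
  funext z
  simp only [addAt]
  split_ifs <;> rfl

/-- The hopping term is symmetric under exchange of the two neighbours of the center. -/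
lemma hop_eq (lam : ℂ) (x : ℤ) (ψ : Config a b → ℂ) (ν : Config a b) {ε : ℤ}
    (hε : ε = 1 ∨ ε = -1) :
    hop lam x ψ ν =
      (√(((occ ν x : ℝ) + 1) * ((occ ν x : ℝ) + 2)) : ℂ) * ψ (addAt x (addAt x ν))
      - lam * (√(((occ ν (x - ε) : ℝ) + 1) * ((occ ν (x + ε) : ℝ) + 1)) : ℂ)
        * ψ (addAt (x + ε) (addAt (x - ε) ν)) := by
  rcases hε with rfl | rfl
  · rfl
  · rw [hop, addAt_comm (x + 1), mul_comm ((occ ν (x - 1) : ℝ) + 1), sub_neg_eq_add,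
      ← sub_eq_add_neg]

end Configurations

/-! ### Energy form, ground states and spectral gap -/

section Form

variable {a b : ℤ}

/-- The probability weight `|ψ(μ)|²` in `[0, ∞]`. -/
def weight (ψ : Config a b → ℂ) (μ : Config a b) : ENNReal :=
  ENNReal.ofReal (‖ψ μ‖ ^ 2)

/-- The hopping energy `|(q_x ψ)(ν)|²` in `[0, ∞]`, set to zero unless `x` is an interior site. -/
def hopWeight (lam : ℂ) (ψ : Config a b → ℂ) (p : ℤ × Config a b) : ENNReal :=
  if p.1 ∈ Finset.Ioo a b then ENNReal.ofReal (‖hop lam p.1 ψ p.2‖ ^ 2) else 0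

/-- The electrostatic energy in `[0, ∞]`. -/
def electroWeight (ψ : Config a b → ℂ) (μ : Config a b) : ENNReal :=
  ENNReal.ofReal (electro μ) * weight ψ μ

lemma tsum_hopWeight (lam : ℂ) (ψ : Config a b → ℂ) :
    ∑' p, hopWeight lam ψ p =
      ∑' ν, ENNReal.ofReal (∑ x ∈ Finset.Ioo a b, ‖hop lam x ψ ν‖ ^ 2) := by
  rw [ENNReal.tsum_prod', ENNReal.tsum_comm]
  refine tsum_congr fun ν => ?_
  rw [tsum_eq_sum (s := Finset.Ioo a b) (fun x hx => by rw [hopWeight, if_neg hx]),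
    ENNReal.ofReal_sum_of_nonneg fun _ _ => sq_nonneg _]
  exact Finset.sum_congr rfl fun x hx => by rw [hopWeight, if_pos hx]

lemma energyForm_self (lam : ℂ) (κ : ℝ) (ψ : Config a b → ℂ) :
    energyForm lam κ ψ ψ = ((∑' μ, electro μ * ‖ψ μ‖ ^ 2 +
      ∑' ν, κ * ∑ x ∈ Finset.Ioo a b, ‖hop lam x ψ ν‖ ^ 2 : ℝ) : ℂ) := by
  rw [energyForm, Complex.ofReal_add, Complex.ofReal_tsum, Complex.ofReal_tsum]
  congr 1
  · refine tsum_congr fun μ => ?_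
    rw [electroDensity, Complex.conj_mul']
    push_cast; rfl
  · refine tsum_congr fun ν => ?_
    rw [hopDensity]
    push_cast
    congr 1
    exact Finset.sum_congr rfl fun x _ => Complex.conj_mul' _

lemma tsum_weight (ψ : Fock a b) : ∑' μ, weight ψ μ = ENNReal.ofReal (‖ψ‖ ^ 2) := by
  have h := lp.hasSum_norm (p := 2) (by norm_num) ψ
  simp only [ENNReal.toReal_ofNat, Real.rpow_ofNat] at h
  rw [← h.tsum_eq, ENNReal.ofReal_tsum_of_nonneg (fun _ => sq_nonneg _) h.summable]
  rfl

lemma ofReal_energyForm {lam : ℂ} {κ : ℝ} (hκ : 0 ≤ κ) {ψ : Config a b → ℂ}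
    (hψ : FiniteEnergy lam κ ψ) :
    ENNReal.ofReal (energyForm lam κ ψ ψ).re =
      ∑' μ, electroWeight ψ μ + ENNReal.ofReal κ * ∑' p, hopWeight lam ψ p := by
  have h1 : ∀ μ : Config a b, 0 ≤ electro μ * ‖ψ μ‖ ^ 2 := fun μ =>
    mul_nonneg (electro_nonneg μ) (sq_nonneg _)
  have h2 : ∀ ν : Config a b, 0 ≤ κ * ∑ x ∈ Finset.Ioo a b, ‖hop lam x ψ ν‖ ^ 2 := fun ν =>
    mul_nonneg hκ (Finset.sum_nonneg fun _ _ => sq_nonneg _)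
  rw [energyForm_self, Complex.ofReal_re, ENNReal.ofReal_add (tsum_nonneg h1) (tsum_nonneg h2),
    ENNReal.ofReal_tsum_of_nonneg h1 hψ.1, ENNReal.ofReal_tsum_of_nonneg h2 hψ.2, tsum_hopWeight,
    ← ENNReal.tsum_mul_left]
  congr 1
  · exact tsum_congr fun μ => ENNReal.ofReal_mul (electro_nonneg μ)
  · exact tsum_congr fun ν => ENNReal.ofReal_mul hκ

lemma energyForm_hamiltonian {lam : ℂ} {κ : ℝ} (ψ : (hamiltonian a b lam κ).domain) (φ : Fock a b)
    (hφ : φ ∈ formDomain a b lam κ) :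
    energyForm lam κ φ (ψ : Fock a b) = ⟪φ, hamiltonian a b lam κ ψ⟫_ℂ :=
  Classical.choose_spec ψ.2.2 φ hφ

/-- Vectors without electrostatic and without hopping energy are ground states. -/
lemma mem_groundSpace {lam : ℂ} {κ : ℝ} {ψ : Fock a b} (h1 : ∀ μ, electro μ ≠ 0 → ψ μ = 0)
    (h2 : ∀ x ∈ Finset.Ioo a b, ∀ ν, hop lam x ψ ν = 0) : ψ ∈ groundSpace a b lam κ := by
  have h3 : ∀ φ : Config a b → ℂ, energyForm lam κ φ ψ = 0 := by
    intro φ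
    have e1 : electroDensity φ ψ = 0 := by
      funext μ
      by_cases h : electro μ = 0
      · simp [electroDensity, h]
      · simp [electroDensity, h1 μ h]
    have e2 : hopDensity lam κ φ ψ = 0 := by
      funext ν
      rw [hopDensity, Finset.sum_eq_zero fun x hx => by rw [h2 x hx, mul_zero], mul_zero]
      rfl
    rw [energyForm, e1, e2]
    simp
  have hfin : FiniteEnergy lam κ ψ := by
    refine ⟨summable_zero.congr fun μ => ?_, summable_zero.congr fun ν => ?_⟩
    · by_cases h : electro μ = 0
      · simp [h]
      · simp [h1 μ h]
    · rw [Finset.sum_eq_zero fun x hx => by rw [h2 x hx, norm_zero, zero_pow two_ne_zero],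
        mul_zero]
  have hdom : ψ ∈ (hamiltonian a b lam κ).domain :=
    ⟨hfin, 0, fun φ _ => by rw [inner_zero_right]; exact h3 φ⟩
  refine ⟨⟨ψ, hdom⟩, ?_, rfl⟩
  rw [SetLike.mem_coe, LinearMap.mem_ker]
  refine eq_of_inner_eq lam κ fun φ hφ => ?_
  rw [inner_zero_right]
  exact (energyForm_hamiltonian ⟨ψ, hdom⟩ φ hφ).symm.trans (h3 φ)

/-- A lower bound of the energy form on the vectors orthogonal to the ground states bounds the
spectral gap from below. -/
lemma le_spectralGap {lam : ℂ} {κ c : ℝ} (hκ : 0 ≤ κ) (hc : 0 ≤ c)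
    (h : ∀ ψ : Fock a b, ψ ∈ (groundSpace a b lam κ)ᗮ → ENNReal.ofReal c * ∑' μ, weight ψ μ ≤
      ∑' μ, electroWeight ψ μ + ENNReal.ofReal κ * ∑' p, hopWeight lam ψ p) :
    (c : EReal) ≤ spectralGap a b lam κ := by
  refine le_iInf fun ψ => le_iInf fun hne => le_iInf fun horth => ?_
  rw [EReal.coe_le_coe_iff, ← energyForm_hamiltonian ψ ψ ψ.2.1]
  have hψ : (ψ : Fock a b) ≠ 0 := fun h0 => hne (Subtype.ext h0)
  have hn : 0 < ‖(ψ : Fock a b)‖ ^ 2 := by positivity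
  rw [le_div_iff₀ hn]
  have h1 := h ψ horth
  rw [tsum_weight, ← ENNReal.ofReal_mul hc, ← ofReal_energyForm hκ ψ.2.1,
    ENNReal.ofReal_le_ofReal_iff] at h1
  · exact h1
  · rw [energyForm_self, Complex.ofReal_re]
    exact add_nonneg (tsum_nonneg fun μ => mul_nonneg (electro_nonneg μ) (sq_nonneg _))
      (tsum_nonneg fun ν => mul_nonneg hκ (Finset.sum_nonneg fun _ _ => sq_nonneg _))

/-- The configurations with `n` particles, all of them at the edge `a`, are ground states. -/
lemma infinite_groundSpace (lam : ℂ) (κ : ℝ) (hab : a ≤ b) :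
    ¬ FiniteDimensional ℂ (groundSpace a b lam κ) := by
  classical
  intro hfin
  have ha : a ∈ Set.Icc a b := ⟨le_refl a, hab⟩
  let e : ℕ → Config a b := fun n => ofOcc a b fun y => if y = a then n else 0
  have he : ∀ n y, y ≠ a → occ (e n) y = 0 := by
    intro n y hy
    by_cases h : y ∈ Set.Icc a b
    · rw [occ_ofOcc _ h, if_neg hy]
    · exact occ_of_notMem _ h
  have hinj : Function.Injective e := fun m n h => by
    have := congrArg (fun μ => occ μ a) h
    simpa [e, occ_ofOcc _ ha] using this
  let v : ℕ → Fock a b := fun n => lp.single (E := fun _ : Config a b => ℂ) 2 (e n) (1 : ℂ)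
  have hv : ∀ n μ, v n μ = if μ = e n then 1 else 0 := fun n μ => by
    simp only [v, lp.single_apply, Pi.single_apply]
  have hmem : ∀ n, v n ∈ groundSpace a b lam κ := by
    intro n
    refine mem_groundSpace (fun μ hμ => ?_) fun x hx ν => ?_
    · rw [hv, if_neg]
      rintro rfl
      refine hμ (Finset.sum_eq_zero fun x hx => ?_)
      rw [Finset.mem_Ico] at hx
      rw [he n (x + 1) (by omega)]
      simp
    · rw [Finset.mem_Ioo] at hx
      have h1 : addAt x (addAt x ν) ≠ e n := fun h => by
        have := congrArg (fun μ => occ μ x) h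
        rw [he n x (by omega), occ_addAt ⟨by omega, by omega⟩, if_pos rfl] at this
        omega
      have h2 : addAt (x + 1) (addAt (x - 1) ν) ≠ e n := fun h => by
        have := congrArg (fun μ => occ μ (x + 1)) h
        rw [he n (x + 1) (by omega), occ_addAt ⟨by omega, by omega⟩, if_pos rfl] at this
        omega
      rw [hop, hv, hv, if_neg h1, if_neg h2]
      simp
  have hlin : LinearIndependent ℂ v := by
    rw [linearIndependent_iff']
    intro s g hg n hn
    have hin : ∀ m, ⟪v n, v m⟫_ℂ = if n = m then 1 else 0 := fun m => by
      rw [lp.inner_single_left, hv]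
      simp [hinj.eq_iff]
    have := congrArg (fun ψ : Fock a b => ⟪v n, ψ⟫_ℂ) hg
    simpa [inner_sum, inner_smul_right, hin, hn] using this
  have hlin' : LinearIndependent ℂ (fun n => (⟨v n, hmem n⟩ : groundSpace a b lam κ)) :=
    LinearIndependent.of_comp (groundSpace a b lam κ).subtype hlin
  have := hlin'.finite
  exact not_finite ℕ

end Form

/-! ### Elementary estimates -/

lemma sq_norm_add_add_le {α β γ : ℝ} (hα : 0 < α) (hβ : 0 < β) (hγ : 0 < γ) (u v w : ℂ) :
    ‖u + v + w‖ ^ 2 ≤ (1 / α + 1 / β + 1 / γ) *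
      (α * ‖u‖ ^ 2 + β * ‖v‖ ^ 2 + γ * ‖w‖ ^ 2) := by
  have h1 : ‖u + v + w‖ ≤ ‖u‖ + ‖v‖ + ‖w‖ := norm_add₃_le
  have h2 : ‖u + v + w‖ ^ 2 ≤ (‖u‖ + ‖v‖ + ‖w‖) ^ 2 := pow_le_pow_left₀ (norm_nonneg _) h1 2
  refine h2.trans ?_
  have e : (1 / α + 1 / β + 1 / γ) * (α * ‖u‖ ^ 2 + β * ‖v‖ ^ 2 + γ * ‖w‖ ^ 2)
      - (‖u‖ + ‖v‖ + ‖w‖) ^ 2 =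
      (α * ‖u‖ - β * ‖v‖) ^ 2 / (α * β) + (α * ‖u‖ - γ * ‖w‖) ^ 2 / (α * γ)
        + (β * ‖v‖ - γ * ‖w‖) ^ 2 / (β * γ) := by
    field_simp
    ring
  have : 0 ≤ (α * ‖u‖ - β * ‖v‖) ^ 2 / (α * β) + (α * ‖u‖ - γ * ‖w‖) ^ 2 / (α * γ)
        + (β * ‖v‖ - γ * ‖w‖) ^ 2 / (β * γ) := by positivity
  linarith

lemma sq_norm_add_le_weighted {α β : ℝ} (hα : 0 < α) (hβ : 0 < β) (u v : ℂ) :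
    ‖u + v‖ ^ 2 ≤ (1 / α + 1 / β) * (α * ‖u‖ ^ 2 + β * ‖v‖ ^ 2) := by
  have h2 : ‖u + v‖ ^ 2 ≤ (‖u‖ + ‖v‖) ^ 2 :=
    pow_le_pow_left₀ (norm_nonneg _) (norm_add_le u v) 2
  refine h2.trans ?_
  have e : (1 / α + 1 / β) * (α * ‖u‖ ^ 2 + β * ‖v‖ ^ 2) - (‖u‖ + ‖v‖) ^ 2 =
      (α * ‖u‖ - β * ‖v‖) ^ 2 / (α * β) := by
    field_simp
    ring
  have : 0 ≤ (α * ‖u‖ - β * ‖v‖) ^ 2 / (α * β) := by positivity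
  linarith

section Gamma

variable {κ s : ℝ}

lemma gammaObc_eq (κ s : ℝ) : gammaObc κ s =
    1 / 5 * min (min 1 (min (2 * κ / (κ + 1)) (2 * κ / (1 + κ * s)))) (2 * κ * s / (κ + 1)) := by
  rw [gammaObc, gammaPer, ← mul_assoc]
  norm_num

lemma gammaObc_nonneg (hκ : 0 ≤ κ) (hs : 0 ≤ s) : 0 ≤ gammaObc κ s := by
  rw [gammaObc_eq]
  positivity

lemma gammaObc_le_fifth (κ s : ℝ) : gammaObc κ s ≤ 1 / 5 := by
  have h : min (min 1 (min (2 * κ / (κ + 1)) (2 * κ / (1 + κ * s)))) (2 * κ * s / (κ + 1)) ≤ 1 :=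
    (min_le_left _ _).trans (min_le_left _ _)
  rw [gammaObc_eq]
  linarith

lemma five_mul_gammaObc_le (κ s : ℝ) : 5 * gammaObc κ s ≤ 2 * κ / (κ + 1) ∧
    5 * gammaObc κ s ≤ 2 * κ / (1 + κ * s) ∧ 5 * gammaObc κ s ≤ 2 * κ * s / (κ + 1) := by
  have e : 5 * gammaObc κ s = min (min 1 (min (2 * κ / (κ + 1)) (2 * κ / (1 + κ * s))))
    (2 * κ * s / (κ + 1)) := by rw [gammaObc_eq]; ring
  rw [e]
  exact ⟨(min_le_left _ _).trans ((min_le_right _ _).trans (min_le_left _ _)),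
    (min_le_left _ _).trans ((min_le_right _ _).trans (min_le_right _ _)), min_le_right _ _⟩

lemma gammaObc_mul_le_two (hκ : 0 < κ) (hs : 0 ≤ s) : gammaObc κ s * (2 / κ + 5 * s) ≤ 2 := by
  have h := (five_mul_gammaObc_le κ s).2.1
  have h0 : 0 ≤ κ * s := by positivity
  have h1 := mul_le_mul_of_nonneg_right h (by positivity : 0 ≤ 2 / κ + 5 * s)
  have h2 : 2 * κ / (1 + κ * s) * (2 / κ + 5 * s) ≤ 10 := by
    rw [show 2 * κ / (1 + κ * s) * (2 / κ + 5 * s) = (4 + 10 * (κ * s)) / (1 + κ * s) by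
      field_simp; ring, div_le_iff₀ (by linarith)]
    linarith
  linarith

lemma gammaObc_mul_le_two_mul (hκ : 0 < κ) (hs : 0 ≤ s) :
    gammaObc κ s * (4 / κ + 5) ≤ 2 * s := by
  have h := (five_mul_gammaObc_le κ s).2.2
  have h1 := mul_le_mul_of_nonneg_right h (by positivity : 0 ≤ 4 / κ + 5)
  have h2 : 2 * κ * s / (κ + 1) * (4 / κ + 5) ≤ 10 * s := by
    rw [show 2 * κ * s / (κ + 1) * (4 / κ + 5) = 2 * s * (4 + 5 * κ) / (κ + 1) by field_simp,
      div_le_iff₀ (by linarith)]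
    nlinarith
  linarith

lemma gammaObc_mul_le_two_of_far (hκ : 0 < κ) : gammaObc κ s * (4 / κ + 5 / 2) ≤ 2 := by
  have h := (five_mul_gammaObc_le κ s).1
  have h1 := mul_le_mul_of_nonneg_right h (by positivity : 0 ≤ 4 / κ + 5 / 2)
  have h2 : 2 * κ / (κ + 1) * (4 / κ + 5 / 2) ≤ 10 := by
    rw [show 2 * κ / (κ + 1) * (4 / κ + 5 / 2) = (8 + 5 * κ) / (κ + 1) by field_simp; ring,
      div_le_iff₀ (by linarith)]
    linarith
  linarith

end Gamma

/-! ### Configurations outside the tiling space -/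

section Bad

variable {a b : ℤ} {lam : ℂ} {κ : ℝ}

lemma sq_norm_sqrt_mul {A : ℝ} (hA : 0 ≤ A) (z : ℂ) : ‖(√A : ℂ) * z‖ ^ 2 = A * ‖z‖ ^ 2 := by
  rw [norm_mul, Complex.norm_real, Real.norm_eq_abs, abs_of_nonneg (Real.sqrt_nonneg _), mul_pow,
    Real.sq_sqrt hA]

/-- A configuration with two particles at `x` and none at `x ± 1` is controlled by the
electrostatic energy of the configuration reached by moving the two particles apart. -/
lemma gammaObc_mul_le_of_spread (hlam : lam ≠ 0) (hκ : 0 < κ) (ψ : Config a b → ℂ)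
    (ν : Config a b) {x ε : ℤ} (hε : ε = 1 ∨ ε = -1) (h1 : occ ν (x - ε) = 0)
    (h2 : occ ν (x + ε) = 0) :
    gammaObc κ (‖lam‖ ^ 2) * ‖ψ (addAt x (addAt x ν))‖ ^ 2 ≤
      κ / 2 * ‖hop lam x ψ ν‖ ^ 2 + 1 / 5 * ‖ψ (addAt (x + ε) (addAt (x - ε) ν))‖ ^ 2 := by
  have hg := gammaObc_nonneg hκ.le (sq_nonneg ‖lam‖)
  have hg2 := gammaObc_mul_le_two hκ (sq_nonneg ‖lam‖)
  rw [hop_eq lam x ψ ν hε, h1, h2]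
  set X := ψ (addAt x (addAt x ν))
  set Z := ψ (addAt (x + ε) (addAt (x - ε) ν))
  set A := ((occ ν x : ℝ) + 1) * ((occ ν x : ℝ) + 2) with hA
  have hA2 : 2 ≤ A := by
    have : (0 : ℝ) ≤ occ ν x := Nat.cast_nonneg _
    nlinarith
  have e : (√((((0 : ℕ) : ℝ) + 1) * (((0 : ℕ) : ℝ) + 1)) : ℂ) = 1 := by simp
  rw [e, mul_one]
  set h := (√A : ℂ) * X - lam * Z with hh
  have hs : 0 < ‖lam‖ ^ 2 := by positivity
  have key := sq_norm_add_le_weighted (half_pos hκ)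
    (by positivity : 0 < 1 / (5 * ‖lam‖ ^ 2)) h (lam * Z)
  rw [hh, sub_add_cancel, sq_norm_sqrt_mul (by linarith), ← hh, norm_mul, mul_pow] at key
  have e1 : 1 / (5 * ‖lam‖ ^ 2) * (‖lam‖ ^ 2 * ‖Z‖ ^ 2) = 1 / 5 * ‖Z‖ ^ 2 := by
    field_simp
  have e2 : 1 / (κ / 2) + 1 / (1 / (5 * ‖lam‖ ^ 2)) = 2 / κ + 5 * ‖lam‖ ^ 2 := by
    field_simp
  rw [e1, e2] at key
  set cost := κ / 2 * ‖h‖ ^ 2 + 1 / 5 * ‖Z‖ ^ 2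
  have hcost : 0 ≤ cost := by positivity
  have s1 : 2 * ‖X‖ ^ 2 ≤ A * ‖X‖ ^ 2 := mul_le_mul_of_nonneg_right hA2 (sq_nonneg _)
  have s2 := mul_le_mul_of_nonneg_left (s1.trans key) hg
  have s3 := mul_le_mul_of_nonneg_right hg2 hcost
  linarith

/-- A configuration with one particle at `x - ε`, none at `x` and at least two at `x + ε` is
controlled by the electrostatic energy of the configuration reached by moving one particle from
each side to `x`. -/
lemma gammaObc_mul_le_of_merge (hlam : lam ≠ 0) (hκ : 0 < κ) (ψ : Config a b → ℂ)
    (ν : Config a b) {x ε : ℤ}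
    (hε : ε = 1 ∨ ε = -1) (h0 : occ ν x = 0) (h1 : occ ν (x - ε) = 0) (h2 : 1 ≤ occ ν (x + ε)) :
    gammaObc κ (‖lam‖ ^ 2) * ‖ψ (addAt (x + ε) (addAt (x - ε) ν))‖ ^ 2 ≤
      κ / 4 * ‖hop lam x ψ ν‖ ^ 2 + 2 / 5 * ‖ψ (addAt x (addAt x ν))‖ ^ 2 := by
  have hg := gammaObc_nonneg hκ.le (sq_nonneg ‖lam‖)
  have hg2 := gammaObc_mul_le_two_mul hκ (sq_nonneg ‖lam‖)
  rw [hop_eq lam x ψ ν hε, h0, h1]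
  set Z := ψ (addAt x (addAt x ν))
  set X := ψ (addAt (x + ε) (addAt (x - ε) ν))
  set A := ((((0 : ℕ) : ℝ) + 1) * ((occ ν (x + ε) : ℝ) + 1)) with hA
  have hA2 : 2 ≤ A := by
    have : (1 : ℝ) ≤ occ ν (x + ε) := by exact_mod_cast h2
    rw [hA]; push_cast; linarith
  have e : ((((0 : ℕ) : ℝ) + 1) * (((0 : ℕ) : ℝ) + 2)) = 2 := by norm_num
  rw [e, mul_assoc]
  set h := (√2 : ℂ) * Z - lam * ((√A : ℂ) * X) with hh
  have hs : 0 < ‖lam‖ ^ 2 := by positivity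
  have key := sq_norm_add_le_weighted (by positivity : 0 < κ / 4) (by norm_num : (0 : ℝ) < 1 / 5)
    (-h) ((√2 : ℂ) * Z)
  have e1 : -h + (√2 : ℂ) * Z = lam * ((√A : ℂ) * X) := by rw [hh]; ring
  rw [e1, norm_mul, mul_pow, sq_norm_sqrt_mul (by linarith), norm_neg,
    sq_norm_sqrt_mul (by norm_num)] at key
  have e2 : 1 / (κ / 4) + 1 / (1 / 5 : ℝ) = 4 / κ + 5 := by field_simp
  rw [e2] at key
  set cost := κ / 4 * ‖h‖ ^ 2 + 2 / 5 * ‖Z‖ ^ 2 with hcost'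
  have e3 : κ / 4 * ‖h‖ ^ 2 + 1 / 5 * (2 * ‖Z‖ ^ 2) = cost := by rw [hcost']; ring
  rw [e3] at key
  have hcost : 0 ≤ cost := by positivity
  have s1 : ‖lam‖ ^ 2 * (2 * ‖X‖ ^ 2) ≤ ‖lam‖ ^ 2 * (A * ‖X‖ ^ 2) :=
    mul_le_mul_of_nonneg_left (mul_le_mul_of_nonneg_right hA2 (sq_nonneg _)) hs.le
  have s2 := mul_le_mul_of_nonneg_left (s1.trans key) hg
  have s3 := mul_le_mul_of_nonneg_right hg2 hcost
  refine le_of_mul_le_mul_left ?_ (mul_pos two_pos hs)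
  linarith

/-- Two particles at `x` and at least two at `x + 3 ε`: the pair at `x` is moved apart, then one
of its particles and one from `x + 3 ε` are moved to `x + 2 ε`, next to the remaining ones. -/
lemma gammaObc_mul_le_of_two_step (hκ : 0 < κ) (ψ : Config a b → ℂ) (ν : Config a b) {x ε : ℤ}
    (hε : ε = 1 ∨ ε = -1) (hx : x ∈ Finset.Ioo a b) (h0 : occ ν x = 0) (h1 : occ ν (x - ε) = 0)
    (h2 : occ ν (x + ε) = 0) (h3 : occ ν (x + 2 * ε) = 0) (h4 : 1 ≤ occ ν (x + 3 * ε)) :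
    gammaObc κ (‖lam‖ ^ 2) * ‖ψ (addAt x (addAt x (addAt (x + 3 * ε) ν)))‖ ^ 2 ≤
      κ / 2 * ‖hop lam x ψ (addAt (x + 3 * ε) ν)‖ ^ 2
        + κ / 4 * ‖hop lam (x + 2 * ε) ψ (addAt (x - ε) ν)‖ ^ 2
        + 2 / 5 * ‖ψ (addAt (x + 2 * ε) (addAt (x + 2 * ε) (addAt (x - ε) ν)))‖ ^ 2 := by
  have hg := gammaObc_nonneg hκ.le (sq_nonneg ‖lam‖)
  have hg2 := gammaObc_mul_le_two_of_far (s := ‖lam‖ ^ 2) hκ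
  have h5 := mem_Icc_of_occ h4
  rw [Finset.mem_Ioo] at hx
  have h6 : x - ε ∈ Set.Icc a b := by constructor <;> omega
  rw [hop_eq lam x ψ _ hε, hop_eq lam (x + 2 * ε) ψ _ hε]
  have o1 : occ (addAt (x + 3 * ε) ν) x = 0 := by
    rw [occ_addAt h5, if_neg (by omega), h0]
  have o2 : occ (addAt (x + 3 * ε) ν) (x - ε) = 0 := by
    rw [occ_addAt h5, if_neg (by omega), h1]
  have o3 : occ (addAt (x + 3 * ε) ν) (x + ε) = 0 := by
    rw [occ_addAt h5, if_neg (by omega), h2]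
  have o4 : occ (addAt (x - ε) ν) (x + 2 * ε) = 0 := by
    rw [occ_addAt h6, if_neg (by omega), h3]
  have o5 : occ (addAt (x - ε) ν) (x + ε) = 0 := by
    rw [occ_addAt h6, if_neg (by omega), h2]
  have o6 : occ (addAt (x - ε) ν) (x + 3 * ε) = occ ν (x + 3 * ε) := by
    rw [occ_addAt h6, if_neg (by omega), add_zero]
  rw [show x + 2 * ε - ε = x + ε by ring, show x + 2 * ε + ε = x + 3 * ε by ring, o1, o2, o3, o4,
    o5, o6, addAt_comm (x - ε) (x + 3 * ε), addAt_comm (x + ε) (x + 3 * ε)]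
  set X := ψ (addAt x (addAt x (addAt (x + 3 * ε) ν)))
  set Y := ψ (addAt (x + 3 * ε) (addAt (x + ε) (addAt (x - ε) ν)))
  set Z := ψ (addAt (x + 2 * ε) (addAt (x + 2 * ε) (addAt (x - ε) ν)))
  set A := ((((0 : ℕ) : ℝ) + 1) * ((occ ν (x + 3 * ε) : ℝ) + 1)) with hA
  have hA2 : 2 ≤ A := by
    have : (1 : ℝ) ≤ occ ν (x + 3 * ε) := by exact_mod_cast h4
    rw [hA]; push_cast; linarith
  have e : ((((0 : ℕ) : ℝ) + 1) * (((0 : ℕ) : ℝ) + 2)) = 2 := by norm_num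
  have e' : (√((((0 : ℕ) : ℝ) + 1) * (((0 : ℕ) : ℝ) + 1)) : ℂ) = 1 := by simp
  rw [e, e', mul_one]
  set f := (√2 : ℂ) * X - lam * Y with hf
  set h := (√2 : ℂ) * Z - lam * (√A : ℂ) * Y with hh
  have hA0 : 0 < A := by linarith
  have hsq : (√A : ℂ) ≠ 0 := by
    rw [Ne, Complex.ofReal_eq_zero]
    exact (Real.sqrt_pos.2 hA0).ne'
  have n1 : ∀ z : ℂ, ‖z / (√A : ℂ)‖ ^ 2 ≤ ‖z‖ ^ 2 / 2 := by
    intro z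
    rw [norm_div, Complex.norm_real, Real.norm_eq_abs, abs_of_nonneg (Real.sqrt_nonneg _),
      div_pow, Real.sq_sqrt hA0.le]
    exact div_le_div_of_nonneg_left (sq_nonneg _) two_pos hA2
  have key := sq_norm_add_add_le (half_pos hκ) (half_pos hκ) (by norm_num : (0 : ℝ) < 2 / 5)
    f (-(h / (√A : ℂ))) ((√2 : ℂ) * Z / (√A : ℂ))
  have e1 : f + -(h / (√A : ℂ)) + (√2 : ℂ) * Z / (√A : ℂ) = (√2 : ℂ) * X := by
    rw [hf, hh]
    field_simp
    ring
  have n2 := n1 h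
  have n3 := n1 ((√2 : ℂ) * Z)
  rw [sq_norm_sqrt_mul (by norm_num)] at n3
  rw [e1, norm_neg, sq_norm_sqrt_mul (by norm_num)] at key
  have e2 : 1 / (κ / 2) + 1 / (κ / 2) + 1 / (2 / 5 : ℝ) = 4 / κ + 5 / 2 := by field_simp; ring
  rw [e2] at key
  set cost := κ / 2 * ‖f‖ ^ 2 + κ / 4 * ‖h‖ ^ 2 + 2 / 5 * ‖Z‖ ^ 2 with hcost'
  have hle : κ / 2 * ‖f‖ ^ 2 + κ / 2 * ‖h / (√A : ℂ)‖ ^ 2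
      + 2 / 5 * ‖(√2 : ℂ) * Z / (√A : ℂ)‖ ^ 2 ≤ cost := by
    rw [hcost']
    have := mul_le_mul_of_nonneg_left n2 (half_pos hκ).le
    linarith
  have hcost : 0 ≤ cost := by positivity
  have s1 := mul_le_mul_of_nonneg_left hle (by positivity : 0 ≤ 4 / κ + 5 / 2)
  have s2 := mul_le_mul_of_nonneg_left (key.trans s1) hg
  have s3 := mul_le_mul_of_nonneg_right hg2 hcost
  linarith

end Bad

section BadSum

variable {a b : ℤ} {lam : ℂ} {κ : ℝ}

/-- Hopping terms `(x, ν)` that remove a pair from a site `x` carrying at least three particles.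
Here and below `ε = ±1` is the direction, seen from `x`, of the edge whose electrostatic energy is
used; for crowded sites it orients the edge towards `x`. -/
def crowdedHops (a b ε : ℤ) : Set (ℤ × Config a b) :=
  {p | p.1 ∈ Finset.Ioo a b ∧ 1 ≤ occ p.2 p.1 ∧ occ p.2 (p.1 - ε) = 0 ∧ occ p.2 (p.1 + ε) = 0}

/-- Hopping terms `(x, ν)` that spread a pair at `x`, with a particle present at `x + 2 ε`. -/
def closeHops (a b ε : ℤ) : Set (ℤ × Config a b) :=
  {p | p.1 ∈ Finset.Ioo a b ∧ occ p.2 p.1 = 0 ∧ occ p.2 (p.1 - ε) = 0 ∧ occ p.2 (p.1 + ε) = 0 ∧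
    1 ≤ occ p.2 (p.1 + 2 * ε)}

/-- Hopping terms `(x, ν)` that merge one particle from each of `x - ε` and `x + ε`, with a
particle left behind at `x + ε` only. -/
def mergeHops (a b ε : ℤ) : Set (ℤ × Config a b) :=
  {p | p.1 ∈ Finset.Ioo a b ∧ occ p.2 p.1 = 0 ∧ occ p.2 (p.1 - ε) = 0 ∧ 1 ≤ occ p.2 (p.1 + ε)}

/-- Hopping terms `(x, ν)` that spread a pair at `x`, with `x + 2 ε` empty and at least two
particles at `x + 3 ε`. -/
def farHops (a b ε : ℤ) : Set (ℤ × Config a b) :=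
  {p | p.1 ∈ Finset.Ioo a b ∧ occ p.2 p.1 = 0 ∧ occ p.2 (p.1 - ε) = 0 ∧ occ p.2 (p.1 + ε) = 0 ∧
    occ p.2 (p.1 + 2 * ε) = 0 ∧ 2 ≤ occ p.2 (p.1 + 3 * ε)}

/-- The pairs `(x, ν)` for which adding a particle at `x + 3 ε` gives an element of `farHops`: the
configurations of a two-step move have this common part `ν`. -/
def farBase (a b ε : ℤ) : Set (ℤ × Config a b) :=
  {p | p.1 ∈ Finset.Ioo a b ∧ occ p.2 p.1 = 0 ∧ occ p.2 (p.1 - ε) = 0 ∧ occ p.2 (p.1 + ε) = 0 ∧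
    occ p.2 (p.1 + 2 * ε) = 0 ∧ 1 ≤ occ p.2 (p.1 + 3 * ε)}

/-- The hopping terms used to bound the energy of the configurations outside the tiling space. -/
def badHops (a b ε : ℤ) : Set (ℤ × Config a b) :=
  crowdedHops a b ε ∪ closeHops a b ε ∪ mergeHops a b ε ∪ farHops a b ε

/-- Configuration `ν` with two particles added at `x`. -/
def addPair (p : ℤ × Config a b) : Config a b := addAt p.1 (addAt p.1 p.2)

/-- Configuration `ν` with one particle added at each of `x - ε` and `x + ε`. -/
def addSplit (ε : ℤ) (p : ℤ × Config a b) : Config a b :=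
  addAt (p.1 + ε) (addAt (p.1 - ε) p.2)

lemma occ_addPair {p : ℤ × Config a b} (hp : p.1 ∈ Finset.Ioo a b) (y : ℤ) :
    occ (addPair p) y = occ p.2 y + if y = p.1 then 2 else 0 := by
  rw [Finset.mem_Ioo] at hp
  have h : p.1 ∈ Set.Icc a b := ⟨by omega, by omega⟩
  rw [addPair, occ_addAt h, occ_addAt h]
  split_ifs <;> omega

lemma occ_addSplit {ε : ℤ} (hε : ε = 1 ∨ ε = -1) {p : ℤ × Config a b}
    (hp : p.1 ∈ Finset.Ioo a b) (y : ℤ) :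
    occ (addSplit ε p) y = occ p.2 y + if y = p.1 - ε ∨ y = p.1 + ε then 1 else 0 := by
  rw [Finset.mem_Ioo] at hp
  have h : p.1 - ε ∈ Set.Icc a b := ⟨by omega, by omega⟩
  have h' : p.1 + ε ∈ Set.Icc a b := ⟨by omega, by omega⟩
  rw [addSplit, occ_addAt h', occ_addAt h]
  split_ifs <;> omega

/-- The electrostatic energy of the oriented edge from `z` to `z + ε`. -/
def edgeEnergy (ε : ℤ) (ψ : Config a b → ℂ) (q : ℤ × Config a b) : ENNReal :=
  ENNReal.ofReal ((occ q.2 q.1 : ℝ) * (occ q.2 (q.1 + ε) : ℝ)) * weight ψ q.2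

/-- Oriented edges that start at a site with `j` particles. -/
def startOcc (a b : ℤ) (j : ℕ) : Set (ℤ × Config a b) := {q | occ q.2 q.1 = j}

lemma sum_edges_eq_electro {ε : ℤ} (hε : ε = 1 ∨ ε = -1) (μ : Config a b) :
    ∑ z ∈ Finset.Icc a b, (occ μ z : ℝ) * (occ μ (z + ε) : ℝ) = electro μ := by
  rcases hε with rfl | rfl
  · rw [electro]
    refine (Finset.sum_subset Finset.Ico_subset_Icc_self fun z hz hz' => ?_).symm
    rw [Finset.mem_Icc] at hz
    rw [Finset.mem_Ico] at hz'
    rw [occ_of_notMem μ (x := z + 1) (fun h => by have := h.2; omega)]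
    simp
  · have h : ∑ z ∈ Finset.Ioc a b, (occ μ z : ℝ) * (occ μ (z + -1) : ℝ) = electro μ := by
      refine (Finset.sum_nbij (· + 1) ?_ ?_ ?_ ?_).symm
      · intro z hz
        rw [Finset.mem_Ico] at hz
        rw [Finset.mem_Ioc]
        omega
      · exact fun x _ y _ h => by simpa using h
      · intro z hz
        rw [Finset.mem_coe, Finset.mem_Ioc] at hz
        exact ⟨z - 1, by rw [Finset.mem_coe, Finset.mem_Ico]; omega, by simp⟩
      · intro z _
        rw [add_neg_cancel_right, mul_comm]
    rw [← h]
    refine (Finset.sum_subset Finset.Ioc_subset_Icc_self fun z hz hz' => ?_).symm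
    rw [Finset.mem_Icc] at hz
    rw [Finset.mem_Ioc] at hz'
    rw [occ_of_notMem μ (x := z + -1) (fun h => by have := h.1; omega)]
    simp

lemma tsum_edgeEnergy {ε : ℤ} (hε : ε = 1 ∨ ε = -1) (ψ : Config a b → ℂ) :
    ∑' q, edgeEnergy ε ψ q = ∑' μ, electroWeight ψ μ := by
  rw [ENNReal.tsum_prod', ENNReal.tsum_comm]
  refine tsum_congr fun μ => ?_
  simp only [edgeEnergy, electroWeight]
  rw [ENNReal.tsum_mul_right, ← sum_edges_eq_electro hε,
    ENNReal.ofReal_sum_of_nonneg fun _ _ => by positivity,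
    tsum_eq_sum (s := Finset.Icc a b) (fun x hx => ?_)]
  rw [occ_of_notMem μ (by rwa [Finset.mem_Icc] at hx)]
  simp

lemma tsum_indicator_le_of_surjOn {α β : Type*} {S : Set β} {C : Set α} {f : α → β}
    (h : ∀ y ∈ S, ∃ x ∈ C, f x = y) (w : β → ENNReal) :
    ∑' y, S.indicator w y ≤ ∑' x, C.indicator (w ∘ f) x := by
  choose g hg hfg using h
  rw [← tsum_subtype]
  let G : S → α := fun y => g y y.2
  have hG : ∀ y : S, f (G y) = y := fun y => hfg y y.2
  have hinj : Function.Injective G := fun y y' hyy => by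
    have := congrArg f hyy
    rw [hG, hG] at this
    exact Subtype.ext this
  refine le_trans (le_of_eq (tsum_congr fun y => ?_))
    (ENNReal.tsum_comp_le_tsum_of_injective hinj _)
  rw [Set.indicator_of_mem (hg y y.2), Function.comp_apply, hG]

lemma tsum_indicator_comp_le {α β : Type*} {C : Set α} {D : Set β} {f : α → β}
    (hf : Set.InjOn f C) (h : ∀ x ∈ C, f x ∈ D) (w : β → ENNReal) :
    ∑' x, C.indicator (w ∘ f) x ≤ ∑' y, D.indicator w y := by
  rw [← tsum_subtype]
  refine le_trans (le_of_eq (tsum_congr fun x => ?_))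
    (ENNReal.tsum_comp_le_tsum_of_injective hf.injective (D.indicator w))
  rw [Set.domRestrict_apply, Set.indicator_of_mem (h x x.2)]
  rfl

lemma indicator_smul_add_le {α : Type*} {C : Set α} {F G H : α → ENNReal} {k t : ENNReal}
    (h : ∀ x ∈ C, F x ≤ k * G x + t * H x) :
    ∑' x, C.indicator F x ≤ k * ∑' x, C.indicator G x + t * ∑' x, C.indicator H x := by
  rw [← ENNReal.tsum_mul_left, ← ENNReal.tsum_mul_left, ← ENNReal.tsum_add]
  refine ENNReal.tsum_le_tsum fun x => ?_
  by_cases hx : x ∈ C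
  · simpa [hx] using h x hx
  · simp [hx]

lemma ofReal_mul_weight {c : ℝ} (hc : 0 ≤ c) (ψ : Config a b → ℂ) (μ : Config a b) :
    ENNReal.ofReal c * weight ψ μ = ENNReal.ofReal (c * ‖ψ μ‖ ^ 2) := (ENNReal.ofReal_mul hc).symm

lemma ofReal_mul_hopWeight {c : ℝ} (hc : 0 ≤ c) (ψ : Config a b → ℂ) {p : ℤ × Config a b}
    (hp : p.1 ∈ Finset.Ioo a b) :
    ENNReal.ofReal c * hopWeight lam ψ p = ENNReal.ofReal (c * ‖hop lam p.1 ψ p.2‖ ^ 2) := by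
  rw [hopWeight, if_pos hp, ENNReal.ofReal_mul hc]

lemma ofReal_mul_edgeEnergy {c : ℝ} (hc : 0 ≤ c) (ε : ℤ) (ψ : Config a b → ℂ)
    (q : ℤ × Config a b) : ENNReal.ofReal c * edgeEnergy ε ψ q =
      ENNReal.ofReal (c * (occ q.2 q.1 * occ q.2 (q.1 + ε) * ‖ψ q.2‖ ^ 2)) := by
  rw [edgeEnergy, weight, ← ENNReal.ofReal_mul (by positivity), ← ENNReal.ofReal_mul hc]

lemma addSplit_edge_injective (ε c : ℤ) :
    Function.Injective fun p : ℤ × Config a b => (p.1 + c, addSplit ε p) := by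
  rintro ⟨x, ν⟩ ⟨x', ν'⟩ h
  simp only [Prod.mk.injEq, addSplit] at h
  obtain rfl : x = x' := by omega
  rw [addAt_injective _ (addAt_injective _ h.2)]

lemma addPair_edge_injective (c : ℤ) :
    Function.Injective fun p : ℤ × Config a b => (p.1 + c, addPair p) := by
  rintro ⟨x, ν⟩ ⟨x', ν'⟩ h
  simp only [Prod.mk.injEq, addPair] at h
  obtain rfl : x = x' := by omega
  rw [addAt_injective _ (addAt_injective _ h.2)]

lemma addAt_edge_injective (c d : ℤ) :
    Function.Injective fun p : ℤ × Config a b => (p.1 + c, addAt (p.1 + d) p.2) := by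
  rintro ⟨x, ν⟩ ⟨x', ν'⟩ h
  simp only [Prod.mk.injEq] at h
  obtain rfl : x = x' := by omega
  rw [addAt_injective _ h.2]

/-- Summation of a pointwise estimate over the hopping terms in `C`. The injection `f` names the
edge of the final configuration whose electrostatic energy is used. -/
lemma tsum_hops_le {ψ : Config a b → ℂ} {ε : ℤ} {C D : Set (ℤ × Config a b)}
    {f : ℤ × Config a b → ℤ × Config a b} {A : ℤ × Config a b → Config a b} {g k : ℝ}
    (hg : 0 ≤ g) (hk : 0 ≤ k) (hf : Function.Injective f) (hD : ∀ p ∈ C, f p ∈ D)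
    (h : ∀ p ∈ C, p.1 ∈ Finset.Ioo a b ∧ g * ‖ψ (A p)‖ ^ 2 ≤ k * ‖hop lam p.1 ψ p.2‖ ^ 2 +
      1 / 5 * (occ (f p).2 (f p).1 * occ (f p).2 ((f p).1 + ε) * ‖ψ (f p).2‖ ^ 2)) :
    ∑' p, C.indicator (fun p => ENNReal.ofReal g * weight ψ (A p)) p ≤
      ENNReal.ofReal k * ∑' p, C.indicator (hopWeight lam ψ) p +
        ENNReal.ofReal (1 / 5) * ∑' q, D.indicator (edgeEnergy ε ψ) q := by
  have h1 : ∀ p ∈ C, ENNReal.ofReal g * weight ψ (A p) ≤ ENNReal.ofReal k * hopWeight lam ψ p +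
      ENNReal.ofReal (1 / 5) * (edgeEnergy ε ψ ∘ f) p := by
    intro p hp
    obtain ⟨hx, hle⟩ := h p hp
    rw [ofReal_mul_weight hg, ofReal_mul_hopWeight hk ψ hx, Function.comp_apply,
      ofReal_mul_edgeEnergy (by norm_num), ← ENNReal.ofReal_add (by positivity) (by positivity)]
    exact ENNReal.ofReal_le_ofReal hle
  refine (indicator_smul_add_le h1).trans (add_le_add le_rfl
    (mul_le_mul_right (tsum_indicator_comp_le hf.injOn hD _) _))

lemma mul_sq_le_of_one_le {A B C : ℝ} {n : ℕ} (h : A ≤ B + C) (hn : 1 ≤ n) (hC : 0 ≤ C) :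
    A ≤ B + n * C := by
  have : (1 : ℝ) ≤ n := by exact_mod_cast hn
  nlinarith

/-- Sites with at least three particles. -/
lemma tsum_crowded_le (hlam : lam ≠ 0) (hκ : 0 < κ) (ψ : Config a b → ℂ) {ε : ℤ}
    (hε : ε = 1 ∨ ε = -1) :
    ∑' p, (crowdedHops a b ε).indicator
        (fun p => ENNReal.ofReal (gammaObc κ (‖lam‖ ^ 2)) * weight ψ (addPair p)) p ≤
      ENNReal.ofReal (κ / 2) * ∑' p, (crowdedHops a b ε).indicator (hopWeight lam ψ) p +
        ENNReal.ofReal (1 / 5) * ∑' q, (startOcc a b 1).indicator (edgeEnergy ε ψ) q := by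
  have ho : ∀ p ∈ crowdedHops a b ε, occ (addSplit ε p) (p.1 + -ε) = 1 := by
    rintro p ⟨hx, h0, h1, h2⟩
    rw [occ_addSplit hε hx, if_pos (by omega), ← sub_eq_add_neg, h1]
  refine tsum_hops_le (gammaObc_nonneg hκ.le (sq_nonneg _)) (half_pos hκ).le
    (addSplit_edge_injective ε (-ε)) ho fun p hp => ⟨hp.1, ?_⟩
  have o1 := ho p hp
  obtain ⟨hx, h0, h1, h2⟩ := hp
  have o2 : occ (addSplit ε p) (p.1 + -ε + ε) = occ p.2 p.1 := by
    rw [occ_addSplit hε hx, if_neg (by omega), neg_add_cancel_right, add_zero]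
  dsimp only
  rw [o1, o2, Nat.cast_one, one_mul, ← mul_left_comm]
  exact mul_sq_le_of_one_le (gammaObc_mul_le_of_spread hlam hκ ψ p.2 hε h1 h2) h0 (by positivity)

/-- A pair with another particle at distance two. -/
lemma tsum_close_le (hlam : lam ≠ 0) (hκ : 0 < κ) (ψ : Config a b → ℂ) {ε : ℤ}
    (hε : ε = 1 ∨ ε = -1) :
    ∑' p, (closeHops a b ε).indicator
        (fun p => ENNReal.ofReal (gammaObc κ (‖lam‖ ^ 2)) * weight ψ (addPair p)) p ≤
      ENNReal.ofReal (κ / 2) * ∑' p, (closeHops a b ε).indicator (hopWeight lam ψ) p +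
        ENNReal.ofReal (1 / 5) * ∑' q, (startOcc a b 1).indicator (edgeEnergy ε ψ) q := by
  have ho : ∀ p ∈ closeHops a b ε, occ (addSplit ε p) (p.1 + ε) = 1 := by
    rintro p ⟨hx, h0, h1, h2, h3⟩
    rw [occ_addSplit hε hx, if_pos (by omega), h2]
  refine tsum_hops_le (gammaObc_nonneg hκ.le (sq_nonneg _)) (half_pos hκ).le
    (addSplit_edge_injective ε ε) ho fun p hp => ⟨hp.1, ?_⟩
  have o1 := ho p hp
  obtain ⟨hx, h0, h1, h2, h3⟩ := hp
  have o2 : occ (addSplit ε p) (p.1 + ε + ε) = occ p.2 (p.1 + 2 * ε) := by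
    rw [occ_addSplit hε hx, if_neg (by omega), add_zero, show p.1 + ε + ε = p.1 + 2 * ε by ring]
  dsimp only
  rw [o1, o2, Nat.cast_one, one_mul, ← mul_left_comm]
  exact mul_sq_le_of_one_le (gammaObc_mul_le_of_spread hlam hκ ψ p.2 hε h1 h2) h3 (by positivity)

/-- A single particle at distance two from a site with several particles. -/
lemma tsum_merge_le (hlam : lam ≠ 0) (hκ : 0 < κ) (ψ : Config a b → ℂ) {ε : ℤ}
    (hε : ε = 1 ∨ ε = -1) :
    ∑' p, (mergeHops a b ε).indicator
        (fun p => ENNReal.ofReal (gammaObc κ (‖lam‖ ^ 2)) * weight ψ (addSplit ε p)) p ≤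
      ENNReal.ofReal (κ / 4) * ∑' p, (mergeHops a b ε).indicator (hopWeight lam ψ) p +
        ENNReal.ofReal (1 / 5) * ∑' q, (startOcc a b 2).indicator (edgeEnergy ε ψ) q := by
  have ho : ∀ p ∈ mergeHops a b ε, occ (addPair p) (p.1 + 0) = 2 := by
    rintro p ⟨hx, h0, h1, h2⟩
    rw [occ_addPair hx, if_pos (by omega), add_zero, h0]
  refine tsum_hops_le (gammaObc_nonneg hκ.le (sq_nonneg _)) (by positivity)
    (addPair_edge_injective 0) ho fun p hp => ⟨hp.1, ?_⟩
  have o1 := ho p hp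
  obtain ⟨hx, h0, h1, h2⟩ := hp
  have o2 : occ (addPair p) (p.1 + 0 + ε) = occ p.2 (p.1 + ε) := by
    rw [occ_addPair hx, if_neg (by omega), add_zero, add_zero]
  have h := mul_sq_le_of_one_le (gammaObc_mul_le_of_merge hlam hκ ψ p.2 hε h0 h1 h2) h2
    (by positivity)
  dsimp only
  rw [o1, o2, Nat.cast_ofNat]
  refine h.trans (le_of_eq ?_)
  rw [addPair]
  ring

/-- A pair at distance three from a site with several particles. -/
lemma tsum_far_le (hκ : 0 < κ) (ψ : Config a b → ℂ) {ε : ℤ}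
    (hε : ε = 1 ∨ ε = -1) :
    ∑' p, (farBase a b ε).indicator (fun p => ENNReal.ofReal (gammaObc κ (‖lam‖ ^ 2)) *
        weight ψ (addPair (p.1, addAt (p.1 + 3 * ε) p.2))) p ≤
      (ENNReal.ofReal (κ / 2) * ∑' p, (farHops a b ε).indicator (hopWeight lam ψ) p +
        ENNReal.ofReal (κ / 4) * ∑' p, (mergeHops a b ε).indicator (hopWeight lam ψ) p) +
        ENNReal.ofReal (1 / 5) * ∑' q, (startOcc a b 2).indicator (edgeEnergy ε ψ) q := by
  have hcenter : ∀ p ∈ farBase a b ε, p.1 + 2 * ε ∈ Finset.Ioo a b ∧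
      p.1 - ε ∈ Set.Icc a b ∧ p.1 + 3 * ε ∈ Set.Icc a b := by
    rintro p ⟨hx, -, -, -, -, h4⟩
    have h5 := mem_Icc_of_occ h4
    rw [Finset.mem_Ioo] at hx
    have h5' := h5.1
    have h5'' := h5.2
    exact ⟨by rw [Finset.mem_Ioo]; omega, ⟨by omega, by omega⟩, h5⟩
  set f₁ : ℤ × Config a b → ℤ × Config a b := fun p => (p.1 + 0, addAt (p.1 + 3 * ε) p.2)
  set f₂ : ℤ × Config a b → ℤ × Config a b := fun p => (p.1 + 2 * ε, addAt (p.1 + -ε) p.2)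
  set f₃ : ℤ × Config a b → ℤ × Config a b := fun p =>
    (p.1 + 2 * ε, addPair (f₂ p))
  have hf₃ : Function.Injective f₃ := by
    have : f₃ = (fun p : ℤ × Config a b => (p.1 + 0, addPair p)) ∘ f₂ := by
      funext p
      simp [f₃, f₂]
    rw [this]
    exact (addPair_edge_injective 0).comp (addAt_edge_injective _ _)
  have hpoint : ∀ p ∈ farBase a b ε, ENNReal.ofReal (gammaObc κ (‖lam‖ ^ 2)) *
      weight ψ (addPair (p.1, addAt (p.1 + 3 * ε) p.2)) ≤
      1 * (ENNReal.ofReal (κ / 2) * (hopWeight lam ψ ∘ f₁) p +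
        ENNReal.ofReal (κ / 4) * (hopWeight lam ψ ∘ f₂) p)
      + ENNReal.ofReal (1 / 5) * (edgeEnergy ε ψ ∘ f₃) p := by
    intro p hp
    obtain ⟨hx, h0, h1, h2, h3, h4⟩ := hp
    obtain ⟨c1, c2, c3⟩ := hcenter p ⟨hx, h0, h1, h2, h3, h4⟩
    have h := gammaObc_mul_le_of_two_step (lam := lam) hκ ψ p.2 hε hx h0 h1 h2 h3 h4
    rw [sub_eq_add_neg p.1 ε] at h c2
    have o1 : occ (f₃ p).2 (f₃ p).1 = 2 := by
      simp only [f₃, f₂]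
      rw [occ_addPair c1, if_pos rfl]
      dsimp only
      rw [occ_addAt c2, if_neg (by omega), h3]
    have o2 : occ (f₃ p).2 ((f₃ p).1 + ε) = occ p.2 (p.1 + 3 * ε) := by
      simp only [f₃, f₂]
      rw [occ_addPair c1, if_neg (by dsimp only; omega)]
      dsimp only
      rw [occ_addAt c2, if_neg (by omega), show p.1 + 2 * ε + ε = p.1 + 3 * ε by ring, add_zero,
        add_zero]
    have hx1 : (f₁ p).1 ∈ Finset.Ioo a b := by simpa [f₁] using hx
    rw [ofReal_mul_weight (gammaObc_nonneg hκ.le (sq_nonneg _)), one_mul, Function.comp_apply,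
      Function.comp_apply, Function.comp_apply, ofReal_mul_hopWeight (by positivity) ψ hx1,
      ofReal_mul_hopWeight (by positivity) ψ c1,
      ofReal_mul_edgeEnergy (by norm_num), ← ENNReal.ofReal_add (by positivity) (by positivity),
      ← ENNReal.ofReal_add (by positivity) (by positivity)]
    refine ENNReal.ofReal_le_ofReal (h.trans ?_)
    rw [o1, o2]
    have h0' : (1 : ℝ) ≤ occ p.2 (p.1 + 3 * ε) := by exact_mod_cast h4
    have := mul_le_mul_of_nonneg_right h0' (sq_nonneg ‖ψ (f₃ p).2‖)
    simp only [f₁, f₂, f₃, addPair, add_zero] at this ⊢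
    push_cast
    linarith
  refine (indicator_smul_add_le hpoint).trans (add_le_add ?_ (mul_le_mul_right
    (tsum_indicator_comp_le hf₃.injOn (fun p hp => ?_) _) _))
  · rw [one_mul]
    refine (indicator_smul_add_le fun p _ => le_rfl).trans (add_le_add
      (mul_le_mul_right (tsum_indicator_comp_le (addAt_edge_injective _ _).injOn (fun p hp => ?_) _) _)
      (mul_le_mul_right (tsum_indicator_comp_le (addAt_edge_injective _ _).injOn (fun p hp => ?_) _) _))
    · obtain ⟨c1, c2, c3⟩ := hcenter p hp
      obtain ⟨hx, h0, h1, h2, h3, h4⟩ := hp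
      simp only [farHops, Set.mem_ofPred_eq, add_zero]
      refine ⟨hx, ?_, ?_, ?_, ?_, ?_⟩
      · rw [occ_addAt c3, if_neg (by omega), h0]
      · rw [occ_addAt c3, if_neg (by omega), h1]
      · rw [occ_addAt c3, if_neg (by omega), h2]
      · rw [occ_addAt c3, if_neg (by omega), h3]
      · rw [occ_addAt c3, if_pos rfl]; omega
    · obtain ⟨c1, c2, c3⟩ := hcenter p hp
      obtain ⟨hx, h0, h1, h2, h3, h4⟩ := hp
      rw [sub_eq_add_neg p.1 ε] at c2
      simp only [mergeHops, Set.mem_ofPred_eq]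
      refine ⟨c1, ?_, ?_, ?_⟩
      · rw [occ_addAt c2, if_neg (by omega), h3]
      · rw [occ_addAt c2, if_neg (by omega), show p.1 + 2 * ε - ε = p.1 + ε by ring, h2]
      · rw [occ_addAt c2, show p.1 + 2 * ε + ε = p.1 + 3 * ε by ring]
        omega
  · obtain ⟨c1, c2, c3⟩ := hcenter p hp
    obtain ⟨hx, h0, h1, h2, h3, h4⟩ := hp
    rw [sub_eq_add_neg p.1 ε] at c2
    simp only [f₃, f₂, startOcc, Set.mem_ofPred_eq]
    rw [occ_addPair c1, if_pos rfl]
    dsimp only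
    rw [occ_addAt c2, if_neg (by omega), h3]

/-- Configurations that are controlled by a move of direction `ε`. Those for `ε = 1` and
`ε = -1` together include all configurations without electrostatic energy that are not tilings, see
`isTiling_of_notMem`. -/
def badConfigs (a b ε : ℤ) : Set (Config a b) :=
  addPair '' crowdedHops a b ε ∪ addPair '' closeHops a b ε ∪ addSplit ε '' mergeHops a b ε ∪
    (fun p => addPair (p.1, addAt (p.1 + 3 * ε) p.2)) '' farBase a b ε

lemma indicator_union_le_add {α : Type*} (S T : Set α) (w : α → ENNReal) (x : α) :
    (S ∪ T).indicator w x ≤ S.indicator w x + T.indicator w x := by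
  by_cases h1 : x ∈ S
  · simp [h1]
  · by_cases h2 : x ∈ T <;> simp [h1, h2]

lemma indicator_badHops {ε : ℤ} (w : ℤ × Config a b → ENNReal) (p : ℤ × Config a b) :
    (crowdedHops a b ε).indicator w p + (closeHops a b ε).indicator w p +
      (mergeHops a b ε).indicator w p + (farHops a b ε).indicator w p =
        (badHops a b ε).indicator w p := by
  have d1 : Disjoint (crowdedHops a b ε) (closeHops a b ε) := by
    refine Set.disjoint_left.2 ?_
    rintro p ⟨-, h, -⟩ ⟨-, h', -⟩
    omega
  have d2 : Disjoint (crowdedHops a b ε ∪ closeHops a b ε) (mergeHops a b ε) := by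
    refine Set.disjoint_left.2 ?_
    rintro p (⟨-, h1, h2, h3⟩ | ⟨-, h1, h2, h3, h4⟩) ⟨-, g1, g2, g3⟩ <;> omega
  have d3 : Disjoint (crowdedHops a b ε ∪ closeHops a b ε ∪ mergeHops a b ε) (farHops a b ε) := by
    refine Set.disjoint_left.2 ?_
    rintro p ((⟨-, h1, h2, h3⟩ | ⟨-, h1, h2, h3, h4⟩) | ⟨-, h1, h2, h3⟩)
      ⟨-, g1, g2, g3, g4, g5⟩ <;> omega
  rw [badHops, Set.indicator_union_of_disjoint d3, Set.indicator_union_of_disjoint d2,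
    Set.indicator_union_of_disjoint d1]

/-- Each hopping term is used with total weight at most `κ / 2`, and each oriented edge serves at
most two configurations: those starting at a singly occupied site serve crowded and close pairs,
those starting at a doubly occupied site serve merges and far pairs. -/
lemma tsum_badConfigs_le (hlam : lam ≠ 0) (hκ : 0 < κ) (ψ : Config a b → ℂ) {ε : ℤ}
    (hε : ε = 1 ∨ ε = -1) :
    ENNReal.ofReal (gammaObc κ (‖lam‖ ^ 2)) * ∑' μ, (badConfigs a b ε).indicator (weight ψ) μ ≤
      ENNReal.ofReal (κ / 2) * ∑' p, (badHops a b ε).indicator (hopWeight lam ψ) p +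
        ENNReal.ofReal (2 / 5) * ∑' μ, electroWeight ψ μ := by
  set g := ENNReal.ofReal (gammaObc κ (‖lam‖ ^ 2))
  set w : Config a b → ENNReal := fun μ => g * weight ψ μ
  have h0 : g * ∑' μ, (badConfigs a b ε).indicator (weight ψ) μ =
      ∑' μ, (badConfigs a b ε).indicator w μ := by
    rw [← ENNReal.tsum_mul_left]
    refine tsum_congr fun μ => ?_
    by_cases h : μ ∈ badConfigs a b ε <;> simp [h, w]
  have h1 : ∑' μ, (badConfigs a b ε).indicator w μ ≤
      ∑' p, (crowdedHops a b ε).indicator (w ∘ addPair) p +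
      ∑' p, (closeHops a b ε).indicator (w ∘ addPair) p +
      ∑' p, (mergeHops a b ε).indicator (w ∘ addSplit ε) p +
      ∑' p, (farBase a b ε).indicator
        (w ∘ fun p => addPair (p.1, addAt (p.1 + 3 * ε) p.2)) p := by
    refine le_trans (ENNReal.tsum_le_tsum fun μ => (indicator_union_le_add _ _ w μ).trans
      (add_le_add ((indicator_union_le_add _ _ w μ).trans (add_le_add
        (indicator_union_le_add _ _ w μ) le_rfl)) le_rfl)) ?_
    rw [ENNReal.tsum_add, ENNReal.tsum_add, ENNReal.tsum_add]
    gcongr <;> exact tsum_indicator_le_of_surjOn (fun y hy => hy) w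
  have hE : ∑' q, (startOcc a b 1).indicator (edgeEnergy ε ψ) q +
      ∑' q, (startOcc a b 2).indicator (edgeEnergy ε ψ) q ≤ ∑' μ, electroWeight ψ μ := by
    rw [← tsum_edgeEnergy hε, ← ENNReal.tsum_add]
    refine ENNReal.tsum_le_tsum fun q => ?_
    have hd : Disjoint (startOcc a b 1) (startOcc a b 2) := by
      refine Set.disjoint_left.2 fun q h h' => ?_
      simp only [startOcc, Set.mem_ofPred_eq] at h h'
      omega
    have := congrFun (Set.indicator_union_of_disjoint hd (edgeEnergy ε ψ)) q
    rw [← this]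
    exact Set.indicator_le_self _ _ q
  have hH := tsum_congr (L := .unconditional _)
    (indicator_badHops (a := a) (b := b) (ε := ε) (hopWeight lam ψ))
  rw [ENNReal.tsum_add, ENNReal.tsum_add, ENNReal.tsum_add] at hH
  rw [h0]
  refine h1.trans ((add_le_add (add_le_add (add_le_add (tsum_crowded_le hlam hκ ψ hε)
    (tsum_close_le hlam hκ ψ hε)) (tsum_merge_le hlam hκ ψ hε)) (tsum_far_le hκ ψ hε)).trans ?_)
  rw [← hH]
  have e1 : ENNReal.ofReal (κ / 2) = ENNReal.ofReal (κ / 4) + ENNReal.ofReal (κ / 4) := by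
    rw [← ENNReal.ofReal_add (by positivity) (by positivity)]
    congr 1; ring
  have e2 : ENNReal.ofReal (2 / 5) = ENNReal.ofReal (1 / 5) + ENNReal.ofReal (1 / 5) := by
    rw [← ENNReal.ofReal_add (by norm_num) (by norm_num)]
    norm_num
  have hE' := mul_le_mul_right hE (ENNReal.ofReal (1 / 5) + ENNReal.ofReal (1 / 5))
  rw [e1, e2]
  refine le_trans (le_of_eq ?_) (add_le_add le_rfl hE')
  ring

end BadSum

/-! ### Tilings -/

section Tilings

variable {a b : ℤ}

/-- Configurations without electrostatic energy from which no sequence of hops leads to a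
configuration with electrostatic energy, in terms of local patterns: tilings of the interval by
voids, monomers and dimers,
with arbitrarily many particles allowed at an edge that is separated from the next particle. -/
structure IsTiling (X : Config a b) : Prop where
  apart : ∀ y, occ X y = 0 ∨ occ X (y + 1) = 0
  le_two : ∀ x ∈ Finset.Ioo a b, occ X x ≤ 2
  pair : ∀ x ∈ Finset.Ioo a b, occ X x = 2 → occ X (x + 2) = 0 ∧ occ X (x - 2) = 0 ∧
    occ X (x + 3) ≤ 1 ∧ occ X (x - 3) ≤ 1
  monomers : ∀ x ∈ Finset.Ioo a b, 1 ≤ occ X (x - 1) → 1 ≤ occ X (x + 1) →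
    occ X (x - 1) = 1 ∧ occ X (x + 1) = 1

/-- Root tilings: those without dimers. -/
structure IsRoot (R : Config a b) : Prop where
  apart : ∀ y, occ R y = 0 ∨ occ R (y + 1) = 0
  le_one : ∀ x ∈ Finset.Ioo a b, occ R x ≤ 1
  monomers : ∀ x ∈ Finset.Ioo a b, 1 ≤ occ R (x - 1) → 1 ≤ occ R (x + 1) →
    occ R (x - 1) = 1 ∧ occ R (x + 1) = 1

/-- The sites at which two consecutive monomers of `R` can be replaced by a dimer. -/
def bonds (R : Config a b) : Finset ℤ :=
  (Finset.Ioo a b).filter fun x => 1 ≤ occ R (x - 1) ∧ 1 ≤ occ R (x + 1)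

lemma mem_bonds {R : Config a b} {x : ℤ} :
    x ∈ bonds R ↔ x ∈ Finset.Ioo a b ∧ 1 ≤ occ R (x - 1) ∧ 1 ≤ occ R (x + 1) := by
  simp [bonds]

/-- The tiling with root `R` and dimers at the sites in `σ`. -/
def tile (R : Config a b) (σ : Finset ℤ) : Config a b :=
  ofOcc a b fun y => if y ∈ σ then 2 else if y - 1 ∈ σ ∨ y + 1 ∈ σ then 0 else occ R y

lemma occ_tile {R : Config a b} {σ : Finset ℤ} (hσ : σ ⊆ bonds R) (y : ℤ) :
    occ (tile R σ) y = if y ∈ σ then 2 else if y - 1 ∈ σ ∨ y + 1 ∈ σ then 0 else occ R y := by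
  by_cases hy : y ∈ Set.Icc a b
  · exact occ_ofOcc _ hy
  · have h : ∀ z ∈ σ, a < z ∧ z < b := fun z hz =>
      Finset.mem_Ioo.1 (mem_bonds.1 (hσ hz)).1
    rw [occ_of_notMem _ hy, occ_of_notMem _ hy, if_neg (fun h' => hy ?_)]
    · split_ifs <;> rfl
    · have := h y h'
      constructor <;> omega

/-- The interior sites with two particles. -/
def dimers (X : Config a b) : Finset ℤ := (Finset.Ioo a b).filter fun x => occ X x = 2

lemma mem_dimers {X : Config a b} {x : ℤ} :
    x ∈ dimers X ↔ x ∈ Finset.Ioo a b ∧ occ X x = 2 := by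
  simp [dimers]

/-- The root of a tiling: every dimer is replaced by two monomers. -/
def rootOf (X : Config a b) : Config a b :=
  ofOcc a b fun y => if y ∈ dimers X then 0 else
    if y - 1 ∈ dimers X ∨ y + 1 ∈ dimers X then 1 else occ X y

lemma occ_rootOf (X : Config a b) (y : ℤ) : occ (rootOf X) y = if y ∈ dimers X then 0 else
    if y - 1 ∈ dimers X ∨ y + 1 ∈ dimers X then 1 else occ X y := by
  by_cases hy : y ∈ Set.Icc a b
  · exact occ_ofOcc _ hy
  · have h : ∀ z ∈ dimers X, a < z ∧ z < b := fun z hz => Finset.mem_Ioo.1 (mem_dimers.1 hz).1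
    rw [occ_of_notMem _ hy, occ_of_notMem _ hy, if_neg fun h' => hy ?_, if_neg fun h' => hy ?_]
    · rcases h' with h' | h' <;> have := h _ h' <;> constructor <;> omega
    · have := h y h'
      constructor <;> omega

lemma IsRoot.bond {R : Config a b} (hR : IsRoot R) {x : ℤ} (hx : x ∈ bonds R) :
    (a < x ∧ x < b) ∧ occ R (x - 1) = 1 ∧ occ R x = 0 ∧ occ R (x + 1) = 1 := by
  obtain ⟨h1, h2, h3⟩ := mem_bonds.1 hx
  obtain ⟨h4, h5⟩ := hR.monomers x h1 h2 h3
  refine ⟨Finset.mem_Ioo.1 h1, h4, ?_, h5⟩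
  rcases hR.apart x with h | h
  · exact h
  · omega

lemma IsRoot.dimers_tile {R : Config a b} (hR : IsRoot R) {σ : Finset ℤ} (hσ : σ ⊆ bonds R) :
    dimers (tile R σ) = σ := by
  ext x
  rw [mem_dimers, occ_tile hσ]
  constructor
  · rintro ⟨hx, h⟩
    have := hR.le_one x hx
    by_contra hxσ
    rw [if_neg hxσ] at h
    split_ifs at h
    omega
  · intro hx
    exact ⟨(mem_bonds.1 (hσ hx)).1, if_pos hx⟩

lemma IsRoot.rootOf_tile {R : Config a b} (hR : IsRoot R) {σ : Finset ℤ} (hσ : σ ⊆ bonds R) :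
    rootOf (tile R σ) = R := by
  refine config_ext fun y _ => ?_
  rw [occ_rootOf, hR.dimers_tile hσ, occ_tile hσ]
  split_ifs with h1 h2
  · exact (hR.bond (hσ h1)).2.2.1.symm
  · rcases h2 with h2 | h2
    · have := (hR.bond (hσ h2)).2.2.2
      rw [sub_add_cancel] at this
      exact this.symm
    · have := (hR.bond (hσ h2)).2.1
      rw [add_sub_cancel_right] at this
      exact this.symm
  · rfl

lemma IsTiling.isRoot_rootOf {X : Config a b} (hX : IsTiling X) : IsRoot (rootOf X) := by
  have ap := hX.apart
  refine ⟨fun y => ?_, fun x hx => ?_, fun x hx h1 h2 => ?_⟩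
  · rw [occ_rootOf, occ_rootOf]
    have a1 := ap (y - 1)
    have a2 := ap y
    have a3 := ap (y + 1)
    have p1 := hX.pair (y - 1)
    have p2 := hX.pair (y + 2)
    rw [show y - 1 + 1 = y by ring] at a1
    rw [show y + 1 + 1 = y + 2 by ring] at a3 ⊢
    rw [show y - 1 + 2 = y + 1 by ring, show y - 1 + 3 = y + 2 by ring] at p1
    rw [show y + 2 - 2 = y by ring] at p2
    rw [show y + 1 - 1 = y by ring]
    simp only [mem_dimers, Finset.mem_Ioo] at *
    split_ifs <;> omega
  · rw [occ_rootOf]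
    have := hX.le_two x hx
    simp only [mem_dimers]
    split_ifs with g1 g2
    · omega
    · omega
    · have : occ X x ≠ 2 := fun h => g1 ⟨hx, h⟩
      omega
  · rw [occ_rootOf] at h1 h2 ⊢
    rw [occ_rootOf]
    rw [show x - 1 - 1 = x - 2 by ring, show x - 1 + 1 = x by ring] at h1 ⊢
    rw [show x + 1 + 1 = x + 2 by ring, show x + 1 - 1 = x by ring] at h2 ⊢
    have n1 : x - 1 ∉ dimers X := fun h => by rw [if_pos h] at h1; omega
    have n2 : x + 1 ∉ dimers X := fun h => by rw [if_pos h] at h2; omega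
    rw [if_neg n1] at h1 ⊢
    rw [if_neg n2] at h2 ⊢
    by_cases h0 : x ∈ dimers X
    · simp [h0]
    by_cases d1 : x - 2 ∈ dimers X
    · rw [if_pos (Or.inl d1)] at h1 ⊢
      refine ⟨rfl, ?_⟩
      by_cases d2 : x + 2 ∈ dimers X
      · rw [if_pos (Or.inr d2)]
      · have d := mem_dimers.1 d1
        have p := (hX.pair _ d.1 d.2).2.2.1
        rw [show x - 2 + 3 = x + 1 by ring] at p
        rw [if_neg (by tauto)] at h2 ⊢
        omega
    · rw [if_neg (by tauto)] at h1 ⊢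
      by_cases d2 : x + 2 ∈ dimers X
      · have d := mem_dimers.1 d2
        have p := (hX.pair _ d.1 d.2).2.2.2
        rw [show x + 2 - 3 = x - 1 by ring] at p
        rw [if_pos (Or.inr d2)]
        exact ⟨by omega, rfl⟩
      · rw [if_neg (by tauto)] at h2 ⊢
        exact hX.monomers x hx h1 h2

lemma IsTiling.dimers_mem {X : Config a b} (hX : IsTiling X) :
    dimers X ∈ indep (bonds (rootOf X)) := by
  rw [mem_indep]
  refine ⟨fun x hx => ?_, fun x hx h => ?_⟩
  · have a1 := hX.apart (x - 1)
    have a2 := hX.apart x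
    rw [show x - 1 + 1 = x by ring] at a1
    rw [mem_bonds, occ_rootOf, occ_rootOf, show x - 1 + 1 = x by ring,
      show x + 1 - 1 = x by ring]
    have h2 := (mem_dimers.1 hx).2
    have n1 : x - 1 ∉ dimers X := fun h => by have := (mem_dimers.1 h).2; omega
    have n2 : x + 1 ∉ dimers X := fun h => by have := (mem_dimers.1 h).2; omega
    rw [if_neg n1, if_neg n2, if_pos (Or.inr hx), if_pos (Or.inl hx)]
    exact ⟨(mem_dimers.1 hx).1, le_rfl, le_rfl⟩
  · have h1 := mem_dimers.1 hx
    have h2 := (mem_dimers.1 h).2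
    have := (hX.pair x h1.1 h1.2).1
    omega

lemma IsTiling.tile_rootOf {X : Config a b} (hX : IsTiling X) :
    tile (rootOf X) (dimers X) = X := by
  refine config_ext fun y _ => ?_
  rw [occ_tile (mem_indep.1 hX.dimers_mem).1, occ_rootOf]
  split_ifs with h1 h2
  · exact (mem_dimers.1 h1).2.symm
  · rcases h2 with h2 | h2
    · have := (mem_dimers.1 h2).2
      have h3 := hX.apart (y - 1)
      rw [sub_add_cancel] at h3
      omega
    · have := (mem_dimers.1 h2).2
      have h3 := hX.apart y
      omega
  · rfl

/-- The common part `ν` of the tilings `tile R σ` and `tile R (insert i σ)`. -/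
def tileHole (R : Config a b) (σ : Finset ℤ) (i : ℤ) : Config a b :=
  ofOcc a b fun y => if y = i then 0 else occ (tile R (insert i σ)) y

section Hole

variable {R : Config a b} {σ : Finset ℤ} {i : ℤ}

lemma occ_tileHole (y : ℤ) :
    occ (tileHole R σ i) y = if y = i then 0 else occ (tile R (insert i σ)) y := by
  by_cases hy : y ∈ Set.Icc a b
  · exact occ_ofOcc _ hy
  · rw [occ_of_notMem _ hy, occ_of_notMem _ hy]
    split_ifs <;> rfl

lemma subset_bonds_insert (hσ : σ ∈ indep (bonds R)) (hi : i ∈ addable (bonds R) σ) :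
    insert i σ ⊆ bonds R := (mem_indep.1 (insert_mem_indep hσ hi)).1

lemma addPair_tileHole (hσ : σ ∈ indep (bonds R)) (hi : i ∈ addable (bonds R) σ) :
    addPair (i, tileHole R σ i) = tile R (insert i σ) := by
  have hb := (mem_bonds.1 (mem_addable.1 hi).1).1
  refine config_ext fun y _ => ?_
  rw [occ_addPair hb, occ_tileHole, occ_tile (subset_bonds_insert hσ hi)]
  by_cases h : y = i
  · subst h; simp
  · simp [h]

lemma addSplit_tileHole (hR : IsRoot R) (hσ : σ ∈ indep (bonds R))
    (hi : i ∈ addable (bonds R) σ) : addSplit 1 (i, tileHole R σ i) = tile R σ := by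
  have hi' := mem_addable.1 hi
  have hb := hR.bond hi'.1
  refine config_ext fun y _ => ?_
  rw [occ_addSplit (Or.inl rfl) (mem_bonds.1 hi'.1).1, occ_tileHole,
    occ_tile (subset_bonds_insert hσ hi), occ_tile (mem_indep.1 hσ).1]
  simp only [Finset.mem_insert]
  have hσb : ∀ z ∈ σ, occ R (z - 1) = 1 ∧ occ R z = 0 ∧ occ R (z + 1) = 1 := fun z hz =>
    (hR.bond ((mem_indep.1 hσ).1 hz)).2
  by_cases h0 : y = i
  · subst h0
    have n1 : y - 1 ∉ σ := fun h => by
      have := (hσb _ h).2.1; omega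
    have n2 : y + 1 ∉ σ := fun h => by
      have := (hσb _ h).2.1; omega
    have e1 : y ≠ y - 1 := by omega
    simp [hi'.2.1, n1, n2, hb.2.2.1, e1]
  by_cases h1 : y = i + 1
  · subst h1
    have n1 : i + 1 ∉ σ := fun h => by
      have := (hσb _ h).2.1; omega
    have n2 : i + 1 + 1 ∉ σ := by rw [add_assoc]; exact hi'.2.2.1
    simp [n1, n2, hi'.2.1, hb.2.2.2]
  by_cases h2 : y = i - 1
  · subst h2
    have n1 : i - 1 ∉ σ := fun h => by
      have := (hσb _ h).2.1; omega
    have n2 : i - 1 - 1 ∉ σ := by rw [sub_sub]; exact hi'.2.2.2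
    simp [n1, n2, hi'.2.1, hb.2.1]
  have e1 : y - 1 ≠ i := by omega
  have e2 : y + 1 ≠ i := by omega
  simp [h0, h1, h2, e1, e2]

/-- Occupation numbers around a bond that carries no dimer of `σ`. -/
lemma occ_tileHole_near (hR : IsRoot R) (hσ : σ ∈ indep (bonds R))
    (hi : i ∈ addable (bonds R) σ) {e : ℤ} (he : e = 1 ∨ e = -1) :
    occ (tileHole R σ i) i = 0 ∧ occ (tileHole R σ i) (i + e) = 0 ∧
      occ (tileHole R σ i) (i + 2 * e) = 0 ∧ occ (tileHole R σ i) (i + 3 * e) ≤ 1 := by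
  have hi' := mem_addable.1 hi
  have hb := hR.bond hi'.1
  have hsub := subset_bonds_insert hσ hi
  have hσb : ∀ z ∈ insert i σ, occ R (z - 1) = 1 ∧ occ R z = 0 ∧ occ R (z + 1) = 1 := fun z hz =>
    (hR.bond (hsub hz)).2
  have hii : i ∈ insert i σ := Finset.mem_insert_self i σ
  have hne : ∀ z, 1 ≤ occ R z → z ∉ insert i σ := fun z hz h => by
    have := (hσb z h).2.1; omega
  have h1 : 1 ≤ occ R (i + e) := by
    rcases he with rfl | rfl
    · omega
    · rw [← sub_eq_add_neg]
      omega
  have h2 : occ R (i + 2 * e) = 0 := by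
    rcases he with rfl | rfl
    · have := hR.apart (i + 1)
      rw [show i + 1 + 1 = i + 2 * 1 by ring] at this
      omega
    · have := hR.apart (i - 2)
      rw [show i - 2 + 1 = i - 1 by ring] at this
      rw [show i + 2 * -1 = i - 2 by ring]
      omega
  have n2 : i + 2 * e ∉ insert i σ := by
    rw [Finset.mem_insert, not_or]
    refine ⟨by omega, ?_⟩
    rcases he with rfl | rfl
    · exact hi'.2.2.1
    · exact hi'.2.2.2
  refine ⟨by rw [occ_tileHole, if_pos rfl], ?_, ?_, ?_⟩
  · rw [occ_tileHole, if_neg (by omega), occ_tile hsub, if_neg (hne _ h1), if_pos]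
    rcases he with rfl | rfl
    · left; rwa [add_sub_cancel_right]
    · right; rwa [neg_add_cancel_right]
  · rw [occ_tileHole, if_neg (by omega), occ_tile hsub, if_neg n2, h2]
    split_ifs <;> rfl
  · -- a particle at distance three is a dimer only if the site at distance two is occupied
    have n3 : i + 3 * e ∉ insert i σ := fun h => by
      have := hσb _ h
      rcases he with rfl | rfl
      · rw [show i + 3 * 1 - 1 = i + 2 * 1 by ring] at this; omega
      · rw [show i + 3 * -1 + 1 = i + 2 * -1 by ring] at this; omega
    rw [occ_tileHole, if_neg (by omega), occ_tile hsub, if_neg n3]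
    split_ifs
    · omega
    by_contra! hlt
    have hI := mem_Icc_of_occ (show 1 ≤ occ R (i + 3 * e) by omega)
    have hm := hR.monomers (i + 2 * e)
    have hI1 := hI.1
    have hI2 := hI.2
    rw [Finset.mem_Ioo] at hm
    rcases he with rfl | rfl
    · rw [show i + 2 * 1 - 1 = i + 1 by ring, show i + 2 * 1 + 1 = i + 3 * 1 by ring] at hm
      omega
    · rw [show i + 2 * -1 - 1 = i + 3 * -1 by ring, show i + 2 * -1 + 1 = i + -1 by ring] at hm
      omega

/-- The hopping terms inside the tiling space are disjoint from those used outside of it. -/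
lemma tileHole_notMem_badHops (hR : IsRoot R) (hσ : σ ∈ indep (bonds R))
    (hi : i ∈ addable (bonds R) σ) {e : ℤ} (he : e = 1 ∨ e = -1) :
    (i, tileHole R σ i) ∉ badHops a b e := by
  obtain ⟨h0, h1, h2, h3⟩ := occ_tileHole_near hR hσ hi he
  rintro (((⟨-, g, -⟩ | ⟨-, -, -, -, g⟩) | ⟨-, -, -, g⟩) | ⟨-, -, -, -, -, g⟩) <;>
    dsimp only at g <;> omega

/-- Inside the tiling space the hopping operator acts as the gradient of the hard-core chain. -/
lemma hop_tileHole (hR : IsRoot R) (hσ : σ ∈ indep (bonds R)) (hi : i ∈ addable (bonds R) σ)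
    (lam : ℂ) (ψ : Config a b → ℂ) :
    hop lam i ψ (tileHole R σ i) =
      (√2 : ℂ) * (ψ (tile R (insert i σ)) - lam / (√2 : ℂ) * ψ (tile R σ)) := by
  have h1 := occ_tileHole_near hR hσ hi (e := 1) (Or.inl rfl)
  have h2 := occ_tileHole_near hR hσ hi (e := -1) (Or.inr rfl)
  have p1 := addPair_tileHole hσ hi
  have p2 := addSplit_tileHole hR hσ hi
  simp only [addPair] at p1
  simp only [addSplit] at p2
  rw [hop, h1.1, h1.2.1, sub_eq_add_neg i 1, h2.2.1, ← sub_eq_add_neg, p1, p2]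
  have h : (√2 : ℂ) ≠ 0 := by
    rw [Ne, Complex.ofReal_eq_zero]
    positivity
  have e1 : (((0 : ℕ) : ℝ) + 1) * (((0 : ℕ) : ℝ) + 2) = 2 := by norm_num
  have e2 : (((0 : ℕ) : ℝ) + 1) * (((0 : ℕ) : ℝ) + 1) = 1 := by norm_num
  rw [e1, e2, Real.sqrt_one]
  field_simp
  simp

end Hole

end Tilings

section Classification

variable {a b : ℤ}

lemma occ_ofOcc_le {X : Config a b} {f : ℤ → ℕ} (h : ∀ y, f y ≤ occ X y) (y : ℤ) :
    occ (ofOcc a b f) y = f y := by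
  by_cases hy : y ∈ Set.Icc a b
  · exact occ_ofOcc _ hy
  · have := h y
    rw [occ_of_notMem _ hy] at *
    omega

/-- Removal of particles from a configuration. -/
lemma exists_occ_sub (X : Config a b) (d : ℤ → ℕ) :
    ∃ ν : Config a b, ∀ y, occ ν y = occ X y - d y :=
  ⟨ofOcc a b fun y => occ X y - d y, occ_ofOcc_le (X := X) fun _ => Nat.sub_le _ _⟩

variable {X : Config a b} {x ε : ℤ}

lemma occ_le_two_of_notMem (hX : X ∉ badConfigs a b ε) (hx : x ∈ Finset.Ioo a b)
    (hε : ε = 1 ∨ ε = -1) (h1 : occ X (x - ε) = 0) (h2 : occ X (x + ε) = 0) : occ X x ≤ 2 := by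
  by_contra! h
  obtain ⟨ν, hν⟩ := exists_occ_sub X fun y => if y = x then 2 else 0
  refine hX (Or.inl (Or.inl (Or.inl ⟨(x, ν), ⟨hx, ?_, ?_, ?_⟩, config_ext fun y _ => ?_⟩)))
  · dsimp only
    rw [hν, if_pos rfl]; omega
  · dsimp only
    rw [hν, if_neg (by omega), h1]
  · dsimp only
    rw [hν, if_neg (by omega), h2]
  · rw [occ_addPair hx, hν]
    dsimp only
    split_ifs with hy
    · subst hy; omega
    · omega

lemma occ_eq_zero_of_notMem (hX : X ∉ badConfigs a b ε) (hx : x ∈ Finset.Ioo a b)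
    (hε : ε = 1 ∨ ε = -1) (h0 : occ X x = 2) (h1 : occ X (x - ε) = 0) (h2 : occ X (x + ε) = 0) :
    occ X (x + 2 * ε) = 0 := by
  by_contra! h
  obtain ⟨ν, hν⟩ := exists_occ_sub X fun y => if y = x then 2 else 0
  refine hX (Or.inl (Or.inl (Or.inr ⟨(x, ν), ⟨hx, ?_, ?_, ?_, ?_⟩, config_ext fun y _ => ?_⟩)))
  · dsimp only
    rw [hν, if_pos rfl]; omega
  · dsimp only
    rw [hν, if_neg (by omega), h1]
  · dsimp only
    rw [hν, if_neg (by omega), h2]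
  · dsimp only
    rw [hν, if_neg (by omega)]; omega
  · rw [occ_addPair hx, hν]
    dsimp only
    split_ifs with hy
    · subst hy; omega
    · omega

lemma occ_le_one_of_notMem (hX : X ∉ badConfigs a b ε) (hx : x ∈ Finset.Ioo a b)
    (hε : ε = 1 ∨ ε = -1) (h0 : occ X x = 0) (h1 : occ X (x - ε) = 1) : occ X (x + ε) ≤ 1 := by
  by_contra! h
  obtain ⟨ν, hν⟩ := exists_occ_sub X fun y => if y = x - ε ∨ y = x + ε then 1 else 0
  refine hX (Or.inl (Or.inr ⟨(x, ν), ⟨hx, ?_, ?_, ?_⟩, config_ext fun y _ => ?_⟩))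
  · dsimp only
    rw [hν, if_neg (by omega)]; omega
  · dsimp only
    rw [hν, if_pos (by omega), h1]
  · dsimp only
    rw [hν, if_pos (by omega)]; omega
  · rw [occ_addSplit hε hx, hν]
    dsimp only
    split_ifs with hy
    · rcases hy with rfl | rfl <;> omega
    · omega

lemma occ_far_le_one_of_notMem (hX : X ∉ badConfigs a b ε) (hx : x ∈ Finset.Ioo a b)
    (hε : ε = 1 ∨ ε = -1) (h0 : occ X x = 2) (h1 : occ X (x - ε) = 0) (h2 : occ X (x + ε) = 0)
    (h3 : occ X (x + 2 * ε) = 0) : occ X (x + 3 * ε) ≤ 1 := by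
  by_contra! h
  have h4 := mem_Icc_of_occ (show 1 ≤ occ X (x + 3 * ε) by omega)
  obtain ⟨ν, hν⟩ := exists_occ_sub X fun y => if y = x then 2 else if y = x + 3 * ε then 1 else 0
  refine hX (Or.inr ⟨(x, ν), ⟨hx, ?_, ?_, ?_, ?_, ?_⟩, config_ext fun y _ => ?_⟩)
  · dsimp only
    rw [hν, if_pos rfl]; omega
  · dsimp only
    rw [hν, if_neg (by omega), if_neg (by omega), h1]
  · dsimp only
    rw [hν, if_neg (by omega), if_neg (by omega), h2]
  · dsimp only
    rw [hν, if_neg (by omega), if_neg (by omega), h3]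
  · dsimp only
    rw [hν, if_neg (by omega), if_pos rfl]; omega
  · dsimp only
    rw [occ_addPair hx]
    dsimp only
    rw [occ_addAt h4, hν]
    by_cases hy : y = x
    · subst hy
      simp only [if_true]
      split_ifs <;> omega
    · by_cases hy' : y = x + 3 * ε
      · subst hy'
        simp only [if_neg hy, if_true]
        omega
      · simp only [if_neg hy, if_neg hy']
        omega

lemma electro_eq_natCast (X : Config a b) :
    electro X = ((∑ x ∈ Finset.Ico a b, occ X x * occ X (x + 1) : ℕ) : ℝ) := by
  rw [electro]; push_cast; rfl

lemma one_le_electro (h : electro X ≠ 0) : 1 ≤ electro X := by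
  rw [electro_eq_natCast] at *
  have : (∑ x ∈ Finset.Ico a b, occ X x * occ X (x + 1)) ≠ 0 := fun h0 => h (by rw [h0]; simp)
  exact_mod_cast Nat.one_le_iff_ne_zero.2 this

lemma electro_eq_zero_iff : electro X = 0 ↔ ∀ y, occ X y = 0 ∨ occ X (y + 1) = 0 := by
  rw [electro_eq_natCast, Nat.cast_eq_zero, Finset.sum_eq_zero_iff]
  refine ⟨fun h y => ?_, fun h x _ => Nat.mul_eq_zero.2 (h x)⟩
  by_cases hy : y ∈ Finset.Ico a b
  · exact Nat.mul_eq_zero.1 (h y hy)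
  · rw [Finset.mem_Ico] at hy
    by_cases hya : a ≤ y
    · right
      exact occ_of_notMem _ fun h' => by have := h'.2; omega
    · left
      exact occ_of_notMem _ fun h' => by have := h'.1; omega

/-- Every configuration without electrostatic energy is a tiling or is controlled by a move. -/
lemma isTiling_of_notMem (hab : 3 ≤ b - a) (h0 : electro X = 0) (h1 : X ∉ badConfigs a b 1)
    (h2 : X ∉ badConfigs a b (-1)) : IsTiling X := by
  rw [electro_eq_zero_iff] at h0
  have near : ∀ x, 1 ≤ occ X x → occ X (x - 1) = 0 ∧ occ X (x + 1) = 0 := fun x hx => by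
    have g1 := h0 (x - 1)
    have g2 := h0 x
    rw [sub_add_cancel] at g1
    omega
  have le_two : ∀ x ∈ Finset.Ioo a b, occ X x ≤ 2 := fun x hx => by
    by_contra! h
    have := near x (by omega)
    have := occ_le_two_of_notMem h1 hx (Or.inl rfl) this.1 this.2
    omega
  have pair : ∀ x ∈ Finset.Ioo a b, occ X x = 2 → occ X (x + 2) = 0 ∧ occ X (x - 2) = 0 ∧
      occ X (x + 3) ≤ 1 ∧ occ X (x - 3) ≤ 1 := fun x hx h => by
    obtain ⟨n1, n2⟩ := near x (by omega)
    have n1' : occ X (x + -1) = 0 := by rwa [← sub_eq_add_neg]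
    have n2' : occ X (x - -1) = 0 := by rwa [sub_neg_eq_add]
    have g1 := occ_eq_zero_of_notMem h1 hx (Or.inl rfl) h n1 n2
    have g2 := occ_eq_zero_of_notMem h2 hx (Or.inr rfl) h n2' n1'
    have g3 := occ_far_le_one_of_notMem h1 hx (Or.inl rfl) h n1 n2 g1
    have g4 := occ_far_le_one_of_notMem h2 hx (Or.inr rfl) h n2' n1' g2
    exact ⟨g1, g2, g3, g4⟩
  refine ⟨h0, le_two, pair, fun x hx m1 m2 => ?_⟩
  have hx0 : occ X x = 0 := by
    have := (near _ m2).1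
    rwa [add_sub_cancel_right] at this
  have hx' := Finset.mem_Ioo.1 hx
  have e1 : occ X (x - 1) = 1 → occ X (x + 1) ≤ 1 := fun h =>
    occ_le_one_of_notMem h1 hx (Or.inl rfl) hx0 h
  have e2 : occ X (x + 1) = 1 → occ X (x - 1) ≤ 1 := fun h => by
    have := occ_le_one_of_notMem h2 hx (Or.inr rfl) hx0 (by rwa [sub_neg_eq_add])
    rwa [← sub_eq_add_neg] at this
  -- one of the two sites is an interior one, and cannot carry a pair
  by_cases hxa : a < x - 1
  · have hi : x - 1 ∈ Finset.Ioo a b := Finset.mem_Ioo.2 ⟨hxa, by omega⟩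
    have := le_two _ hi
    have := pair _ hi
    rw [show x - 1 + 2 = x + 1 by ring] at this
    omega
  · have hi : x + 1 ∈ Finset.Ioo a b := Finset.mem_Ioo.2 ⟨by omega, by omega⟩
    have := le_two _ hi
    have := pair _ hi
    rw [show x + 1 - 2 = x - 1 by ring] at this
    omega

end Classification

/-! ### Ground states of the tiling space -/

section GroundStates

variable {a b : ℤ}

/-- The squeezed Tao–Thouless state with root tiling `R`. -/
def tilingState (c : ℂ) (R : Config a b) : Fock a b :=
  ∑ σ ∈ indep (bonds R), c ^ σ.card • lp.single (E := fun _ : Config a b => ℂ) 2 (tile R σ) (1 : ℂ)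

lemma apply_eq_inner (ψ : Fock a b) (X : Config a b) :
    ψ X = ⟪lp.single (E := fun _ : Config a b => ℂ) 2 X (1 : ℂ), ψ⟫_ℂ := by
  rw [lp.inner_single_left]
  simp

lemma inner_tilingState (c : ℂ) (R : Config a b) (ψ : Fock a b) :
    ⟪tilingState c R, ψ⟫_ℂ =
      ∑ σ ∈ indep (bonds R), starRingEnd ℂ (c ^ σ.card) * ψ (tile R σ) := by
  rw [tilingState, sum_inner]
  exact Finset.sum_congr rfl fun σ _ => by rw [inner_smul_left, ← apply_eq_inner]

lemma tilingState_apply (c : ℂ) (R X : Config a b) :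
    tilingState c R X = ∑ σ ∈ indep (bonds R), c ^ σ.card * if X = tile R σ then 1 else 0 := by
  rw [apply_eq_inner, tilingState, inner_sum]
  refine Finset.sum_congr rfl fun σ _ => ?_
  rw [inner_smul_right, ← apply_eq_inner, lp.single_apply, Pi.single_apply]

variable {R : Config a b}

lemma IsRoot.tile_inj (hR : IsRoot R) {σ τ : Finset ℤ} (hσ : σ ∈ indep (bonds R))
    (hτ : τ ∈ indep (bonds R)) (h : tile R σ = tile R τ) : σ = τ := by
  rw [← hR.dimers_tile (mem_indep.1 hσ).1, h, hR.dimers_tile (mem_indep.1 hτ).1]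

lemma tilingState_tile (c : ℂ) (hR : IsRoot R) {σ : Finset ℤ} (hσ : σ ∈ indep (bonds R)) :
    tilingState c R (tile R σ) = c ^ σ.card := by
  rw [tilingState_apply, Finset.sum_eq_single_of_mem σ hσ]
  · simp
  · intro τ hτ hne
    rw [if_neg fun h => hne (hR.tile_inj hσ hτ h).symm, mul_zero]

lemma tilingState_eq_zero (c : ℂ) {X : Config a b}
    (h : ∀ σ ∈ indep (bonds R), X ≠ tile R σ) : tilingState c R X = 0 := by
  rw [tilingState_apply]
  exact Finset.sum_eq_zero fun σ hσ => by rw [if_neg (h σ hσ), mul_zero]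

lemma IsRoot.electro_tile (hR : IsRoot R) {σ : Finset ℤ} (hσ : σ ⊆ bonds R) :
    electro (tile R σ) = 0 := by
  rw [electro_eq_zero_iff]
  intro y
  have hb : ∀ z ∈ σ, occ R (z - 1) = 1 ∧ occ R z = 0 ∧ occ R (z + 1) = 1 := fun z hz =>
    (hR.bond (hσ hz)).2
  rw [occ_tile hσ, occ_tile hσ]
  by_cases h1 : y ∈ σ
  · right
    have n : y + 1 ∉ σ := fun h => by
      have := (hb _ h).2.1
      have := (hb _ h1).2.2
      omega
    simp [h1, n]
  by_cases h2 : y + 1 ∈ σ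
  · left
    simp [h1, h2]
  have := hR.apart y
  rw [if_neg h1, if_neg h2]
  split_ifs <;> omega

/-- A hop that ends in a tiling by spreading a pair removes one of its dimers. -/
lemma exists_of_addPair_eq (hR : IsRoot R) {τ : Finset ℤ} (hτ : τ ∈ indep (bonds R)) {x : ℤ}
    (hx : x ∈ Finset.Ioo a b) {ν : Config a b} (h : addPair (x, ν) = tile R τ) :
    ∃ σ ∈ indep (bonds R), x ∈ addable (bonds R) σ ∧ ν = tileHole R σ x := by
  have hsub := (mem_indep.1 hτ).1
  have hxτ : x ∈ τ := by
    have h1 := congrArg (fun X => occ X x) h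
    rw [occ_addPair hx, if_pos rfl, occ_tile hsub] at h1
    by_contra hn
    have := hR.le_one x hx
    rw [if_neg hn] at h1
    split_ifs at h1
    all_goals omega
  have hσ := erase_mem_indep x hτ
  have hadd := mem_addable_erase hτ hxτ
  refine ⟨_, hσ, hadd, ?_⟩
  have h2 := addPair_tileHole hσ hadd
  rw [Finset.insert_erase hxτ, ← h] at h2
  exact (addAt_injective _ (addAt_injective _ h2)).symm

/-- A hop that ends in a tiling by merging two particles joins two consecutive monomers. -/
lemma exists_of_addSplit_eq (hR : IsRoot R) {σ : Finset ℤ} (hσ : σ ∈ indep (bonds R)) {x : ℤ}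
    (hx : x ∈ Finset.Ioo a b) {ν : Config a b} (h : addSplit 1 (x, ν) = tile R σ) :
    x ∈ addable (bonds R) σ ∧ ν = tileHole R σ x := by
  obtain ⟨hsub, hind⟩ := mem_indep.1 hσ
  have hb : ∀ z ∈ σ, occ R (z - 1) = 1 ∧ occ R z = 0 ∧ occ R (z + 1) = 1 := fun z hz =>
    (hR.bond (hsub hz)).2
  have h1 : 1 ≤ occ (tile R σ) (x - 1) := by
    rw [← h, occ_addSplit (Or.inl rfl) hx, if_pos (Or.inl rfl)]; omega
  have h2 : 1 ≤ occ (tile R σ) (x + 1) := by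
    rw [← h, occ_addSplit (Or.inl rfl) hx, if_pos (Or.inr rfl)]; omega
  rw [occ_tile hsub] at h1 h2
  rw [show x - 1 - 1 = x - 2 by ring, sub_add_cancel] at h1
  rw [show x + 1 + 1 = x + 2 by ring, add_sub_cancel_right] at h2
  have a1 := hR.apart (x - 1)
  have a2 := hR.apart x
  rw [sub_add_cancel] at a1
  have n1 : x - 1 ∉ σ := fun hm => by
    have b1 := (hb _ hm).2.2
    rw [sub_add_cancel] at b1
    have n2 : x + 1 ∉ σ := by
      have := hind _ hm
      rwa [show x - 1 + 2 = x + 1 by ring] at this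
    rw [if_neg n2] at h2
    split_ifs at h2 <;> omega
  have n2 : x + 1 ∉ σ := fun hm => by
    have b1 := (hb _ hm).1
    rw [add_sub_cancel_right] at b1
    rw [if_neg n1] at h1
    split_ifs at h1 <;> omega
  rw [if_neg n1] at h1
  rw [if_neg n2] at h2
  have n3 : ¬ (x - 2 ∈ σ ∨ x ∈ σ) := fun hm => by rw [if_pos hm] at h1; omega
  have n4 : ¬ (x ∈ σ ∨ x + 2 ∈ σ) := fun hm => by rw [if_pos hm] at h2; omega
  rw [if_neg n3] at h1
  rw [if_neg n4] at h2
  have hadd : x ∈ addable (bonds R) σ := by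
    rw [mem_addable, mem_bonds]
    tauto
  refine ⟨hadd, ?_⟩
  have h5 := addSplit_tileHole hR hσ hadd
  rw [← h] at h5
  exact (addAt_injective _ (addAt_injective _ h5)).symm

lemma tilingState_mem_groundSpace (hR : IsRoot R) (lam : ℂ) (κ : ℝ) :
    tilingState (lam / (√2 : ℂ)) R ∈ groundSpace a b lam κ := by
  set c := lam / (√2 : ℂ) with hc
  refine mem_groundSpace (fun X hX => ?_) fun x hx ν => ?_
  · refine tilingState_eq_zero c fun σ hσ h => hX ?_
    rw [h]
    exact hR.electro_tile (mem_indep.1 hσ).1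
  · have hhole : ∀ σ ∈ indep (bonds R), x ∈ addable (bonds R) σ → ν = tileHole R σ x →
        hop lam x (tilingState c R) ν = 0 := by
      rintro σ hσ hadd rfl
      rw [hop_tileHole hR hσ hadd, tilingState_tile c hR hσ,
        tilingState_tile c hR (insert_mem_indep hσ hadd),
        Finset.card_insert_of_notMem (mem_addable.1 hadd).2.1, ← hc, pow_succ']
      ring
    by_cases h1 : ∃ τ ∈ indep (bonds R), addPair (x, ν) = tile R τ
    · obtain ⟨τ, hτ, h⟩ := h1
      obtain ⟨σ, hσ, hadd, hν⟩ := exists_of_addPair_eq hR hτ hx h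
      exact hhole σ hσ hadd hν
    by_cases h2 : ∃ σ ∈ indep (bonds R), addSplit 1 (x, ν) = tile R σ
    · obtain ⟨σ, hσ, h⟩ := h2
      obtain ⟨hadd, hν⟩ := exists_of_addSplit_eq hR hσ hx h
      exact hhole σ hσ hadd hν
    push Not at h1 h2
    have e1 : tilingState c R (addAt x (addAt x ν)) = 0 := tilingState_eq_zero c h1
    have e2 : tilingState c R (addAt (x + 1) (addAt (x - 1) ν)) = 0 := tilingState_eq_zero c h2
    rw [hop, e1, e2, mul_zero, mul_zero, sub_zero]

end GroundStates

/-! ### Lower bounds on the energy form -/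

section Bounds

variable {a b : ℤ} {lam : ℂ} {κ : ℝ}

/-- The hopping terms inside the tiling space, as triples `(R, σ, i)`. -/
def tilingHops (a b : ℤ) : Set (Config a b × Finset ℤ × ℤ) :=
  {t | IsRoot t.1 ∧ t.2.1 ∈ indep (bonds t.1) ∧ t.2.2 ∈ addable (bonds t.1) t.2.1}

lemma injOn_tilingHops : Set.InjOn
    (fun t : Config a b × Finset ℤ × ℤ => (t.2.2, tileHole t.1 t.2.1 t.2.2))
    (tilingHops a b) := by
  rintro ⟨R, σ, i⟩ ⟨hR, hσ, hi⟩ ⟨R', σ', i'⟩ ⟨hR', hσ', hi'⟩ h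
  dsimp only at hR hσ hi hR' hσ' hi'
  simp only [Prod.mk.injEq] at h
  obtain ⟨rfl, h⟩ := h
  have h1 := addPair_tileHole hσ hi
  rw [h, addPair_tileHole hσ' hi'] at h1
  have hs := (mem_indep.1 (insert_mem_indep hσ hi)).1
  have hs' := (mem_indep.1 (insert_mem_indep hσ' hi')).1
  have e1 : R = R' := by rw [← hR.rootOf_tile hs, ← h1, hR'.rootOf_tile hs']
  have e2 : insert i σ = insert i σ' := by rw [← hR.dimers_tile hs, ← h1, hR'.dimers_tile hs']
  have e3 : σ = σ' := by
    rw [← Finset.erase_insert (mem_addable.1 hi).2.1, e2,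
      Finset.erase_insert (mem_addable.1 hi').2.1]
  rw [e1, e3]

lemma tsum_indicator_prod {α β : Type*} {S : Set (α × β)} {P : α → Prop} [DecidablePred P]
    {I : α → Finset β} (hS : ∀ x y, (x, y) ∈ S ↔ P x ∧ y ∈ I x) (w : α × β → ENNReal) :
    ∑' t, S.indicator w t = ∑' x, if P x then ∑ y ∈ I x, w (x, y) else 0 := by
  rw [ENNReal.tsum_prod']
  refine tsum_congr fun x => ?_
  by_cases hx : P x
  · rw [if_pos hx, tsum_eq_sum (s := I x) fun y hy =>
      Set.indicator_of_notMem (fun h => hy ((hS x y).1 h).2) _]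
    exact Finset.sum_congr rfl fun y hy => Set.indicator_of_mem ((hS x y).2 ⟨hx, hy⟩) _
  · rw [if_neg hx]
    exact ENNReal.tsum_eq_zero.2 fun y =>
      Set.indicator_of_notMem (fun h => hx ((hS x y).1 h).1) _

lemma sum_addable_eq_sum_filter {M : Type*} [AddCommMonoid M] {B : Finset ℤ}
    (F : Finset ℤ × ℤ → M) :
    ∑ σ ∈ indep B, ∑ i ∈ addable B σ, F (σ, i) =
      ∑ p ∈ (indep B ×ˢ B).filter (fun p => p.2 ∈ addable B p.1), F p := by
  rw [Finset.sum_filter, Finset.sum_product]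
  refine Finset.sum_congr rfl fun σ _ => ?_
  rw [← Finset.sum_filter]
  refine Finset.sum_congr ?_ fun _ _ => rfl
  ext i
  rw [Finset.mem_filter]
  exact ⟨fun h => ⟨(mem_addable.1 h).1, h⟩, And.right⟩

/-- The bound by the gap of the hard-core chain for a single root tiling. -/
lemma sum_weight_tile_le (hlam : lam ≠ 0) (ψ : Config a b → ℂ) {R : Config a b} (hR : IsRoot R)
    (hψ : ∑ σ ∈ indep (bonds R),
      starRingEnd ℂ ((lam / (√2 : ℂ)) ^ σ.card) * ψ (tile R σ) = 0) :
    ENNReal.ofReal (2 / (1 + ‖lam‖ ^ 2 / 2)) * ∑ σ ∈ indep (bonds R), weight ψ (tile R σ) ≤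
      ∑ σ ∈ indep (bonds R), ∑ i ∈ addable (bonds R) σ,
        hopWeight lam ψ (i, tileHole R σ i) := by
  have h2 : (√2 : ℂ) ≠ 0 := by
    rw [Ne, Complex.ofReal_eq_zero]
    positivity
  have hc0 : lam / (√2 : ℂ) ≠ 0 := div_ne_zero hlam h2
  have hcn : ‖lam / (√2 : ℂ)‖ ^ 2 = ‖lam‖ ^ 2 / 2 := by
    rw [norm_div, div_pow, Complex.norm_real, Real.norm_eq_abs, sq_abs,
      Real.sq_sqrt (by norm_num)]
  have hg := hardcore_gap hc0 (bonds R) (fun σ => ψ (tile R σ)) hψ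
  rw [hcn] at hg
  have hr : ∑ σ ∈ indep (bonds R), ∑ i ∈ addable (bonds R) σ,
      hopWeight lam ψ (i, tileHole R σ i) = ENNReal.ofReal (2 * ∑ σ ∈ indep (bonds R),
        ∑ i ∈ addable (bonds R) σ,
          ‖ψ (tile R (insert i σ)) - lam / (√2 : ℂ) * ψ (tile R σ)‖ ^ 2) := by
    rw [Finset.mul_sum, ENNReal.ofReal_sum_of_nonneg fun σ _ => by positivity]
    refine Finset.sum_congr rfl fun σ hσ => ?_
    rw [Finset.mul_sum, ENNReal.ofReal_sum_of_nonneg fun i _ => by positivity]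
    refine Finset.sum_congr rfl fun i hi => ?_
    rw [hopWeight, if_pos (mem_bonds.1 (mem_addable.1 hi).1).1, hop_tileHole hR hσ hi,
      sq_norm_sqrt_mul (by norm_num)]
  simp only [weight]
  rw [hr, ← ENNReal.ofReal_sum_of_nonneg fun σ _ => sq_nonneg _,
    ← ENNReal.ofReal_mul (by positivity)]
  refine ENNReal.ofReal_le_ofReal ?_
  have h3 := mul_le_mul_of_nonneg_left hg zero_le_two
  rwa [← mul_assoc, mul_one_div] at h3

/-- On the tiling space the energy form is bounded below by the gap of the hard-core chains, one
for each root tiling. -/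
lemma tsum_isTiling_le (hlam : lam ≠ 0) (ψ : Config a b → ℂ)
    (hψ : ∀ R : Config a b, IsRoot R → ∑ σ ∈ indep (bonds R),
      starRingEnd ℂ ((lam / (√2 : ℂ)) ^ σ.card) * ψ (tile R σ) = 0) :
    ENNReal.ofReal (2 / (1 + ‖lam‖ ^ 2 / 2)) *
        ∑' X, {X : Config a b | IsTiling X}.indicator (weight ψ) X ≤
      ∑' p, (badHops a b 1 ∪ badHops a b (-1))ᶜ.indicator (hopWeight lam ψ) p := by
  classical
  set S : Set (Config a b × Finset ℤ) := {t | IsRoot t.1 ∧ t.2 ∈ indep (bonds t.1)} with hS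
  have h1 : ∑' X, {X : Config a b | IsTiling X}.indicator (weight ψ) X ≤
      ∑' t, S.indicator (weight ψ ∘ fun t => tile t.1 t.2) t := by
    refine tsum_indicator_le_of_surjOn (C := S) (f := fun t => tile t.1 t.2)
      (fun X (hX : IsTiling X) => ?_) (weight ψ)
    exact ⟨(rootOf X, dimers X), ⟨hX.isRoot_rootOf, hX.dimers_mem⟩, hX.tile_rootOf⟩
  have h3 := tsum_indicator_prod (S := S) (P := IsRoot) (I := fun R => indep (bonds R))
    (fun _ _ => Iff.rfl) (weight ψ ∘ fun t => tile t.1 t.2)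
  have h5 := tsum_indicator_prod (S := tilingHops a b) (P := IsRoot)
    (I := fun R => (indep (bonds R) ×ˢ bonds R).filter fun p => p.2 ∈ addable (bonds R) p.1)
    (fun R p => by
      rw [Finset.mem_filter, Finset.mem_product]
      exact ⟨fun h => ⟨h.1, ⟨h.2.1, (mem_addable.1 h.2.2).1⟩, h.2.2⟩,
        fun h => ⟨h.1, h.2.1.1, h.2.2⟩⟩)
    (hopWeight lam ψ ∘ fun t => (t.2.2, tileHole t.1 t.2.1 t.2.2))
  have h6 : ∑' t, (tilingHops a b).indicator
      (hopWeight lam ψ ∘ fun t => (t.2.2, tileHole t.1 t.2.1 t.2.2)) t ≤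
      ∑' p, (badHops a b 1 ∪ badHops a b (-1))ᶜ.indicator (hopWeight lam ψ) p := by
    refine tsum_indicator_comp_le injOn_tilingHops ?_ _
    rintro ⟨R, σ, i⟩ ⟨hR, hσ, hi⟩ (h | h)
    · exact tileHole_notMem_badHops hR hσ hi (Or.inl rfl) h
    · exact tileHole_notMem_badHops hR hσ hi (Or.inr rfl) h
  refine le_trans ?_ (h5.symm.le.trans h6)
  refine (mul_le_mul_right (h1.trans h3.le) _).trans ?_
  rw [← ENNReal.tsum_mul_left]
  refine ENNReal.tsum_le_tsum fun R => ?_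
  by_cases hR : IsRoot R
  · rw [if_pos hR, if_pos hR]
    refine (sum_weight_tile_le hlam ψ hR (hψ R hR)).trans (le_of_eq ?_)
    exact sum_addable_eq_sum_filter fun p => hopWeight lam ψ (p.2, tileHole R p.1 p.2)
  · rw [if_neg hR, mul_zero]
    exact zero_le

/-- The energy form is bounded below on the vectors orthogonal to the ground states: each
configuration is a tiling, or is controlled by a move of direction `1` or `-1`, or has
electrostatic energy itself. -/
lemma mul_tsum_weight_le (hab : 3 ≤ b - a) (hlam : lam ≠ 0) (hκ : 0 < κ) {m : ℝ}
    (hm1 : m ≤ gammaObc κ (‖lam‖ ^ 2)) (hm2 : m ≤ κ * (2 / (1 + ‖lam‖ ^ 2 / 2)))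
    {ψ : Fock a b} (hψ : ψ ∈ (groundSpace a b lam κ)ᗮ) :
    ENNReal.ofReal m * ∑' μ, weight ψ μ ≤
      ∑' μ, electroWeight ψ μ + ENNReal.ofReal κ * ∑' p, hopWeight lam ψ p := by
  set G := {X : Config a b | IsTiling X}
  set E := {X : Config a b | electro X ≠ 0}
  set B₁ := badConfigs a b 1
  set B₂ := badConfigs a b (-1)
  set H₁ := badHops a b 1
  set H₂ := badHops a b (-1)
  have hcover : ∑' μ, weight ψ μ ≤ ∑' μ, G.indicator (weight ψ) μ + ∑' μ, E.indicator (weight ψ) μ +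
      ∑' μ, B₁.indicator (weight ψ) μ + ∑' μ, B₂.indicator (weight ψ) μ := by
    rw [← ENNReal.tsum_add, ← ENNReal.tsum_add, ← ENNReal.tsum_add]
    refine ENNReal.tsum_le_tsum fun X => ?_
    have hX : X ∈ G ∪ E ∪ B₁ ∪ B₂ := by
      by_contra hX
      simp only [Set.mem_union, not_or] at hX
      obtain ⟨⟨⟨hG, hE⟩, h1⟩, h2⟩ := hX
      exact hG (isTiling_of_notMem hab (not_not.1 hE) h1 h2)
    rw [← Set.indicator_of_mem hX (weight ψ)]
    exact (indicator_union_le_add _ _ _ X).trans (add_le_add ((indicator_union_le_add _ _ _ X).trans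
      (add_le_add (indicator_union_le_add _ _ _ X) le_rfl)) le_rfl)
  have hG : ENNReal.ofReal m * ∑' μ, G.indicator (weight ψ) μ ≤
      ENNReal.ofReal κ * ∑' p, (H₁ ∪ H₂)ᶜ.indicator (hopWeight lam ψ) p := by
    have horth : ∀ R : Config a b, IsRoot R → ∑ σ ∈ indep (bonds R),
        starRingEnd ℂ ((lam / (√2 : ℂ)) ^ σ.card) * ψ (tile R σ) = 0 := fun R hR => by
      rw [← inner_tilingState]
      exact hψ _ (tilingState_mem_groundSpace hR lam κ)
    refine (mul_le_mul_left (ENNReal.ofReal_le_ofReal hm2) _).trans ?_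
    rw [ENNReal.ofReal_mul hκ.le, mul_assoc]
    gcongr
    exact tsum_isTiling_le hlam ψ horth
  have hE : ENNReal.ofReal m * ∑' μ, E.indicator (weight ψ) μ ≤
      ENNReal.ofReal (1 / 5) * ∑' μ, electroWeight ψ μ := by
    refine mul_le_mul' (ENNReal.ofReal_le_ofReal (hm1.trans (gammaObc_le_fifth _ _)))
      (ENNReal.tsum_le_tsum fun X => ?_)
    by_cases hX : X ∈ E
    · rw [Set.indicator_of_mem hX, electroWeight]
      refine le_mul_of_one_le_left zero_le ?_
      rw [← ENNReal.ofReal_one]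
      exact ENNReal.ofReal_le_ofReal (one_le_electro hX)
    · rw [Set.indicator_of_notMem hX]
      exact zero_le
  have hB : ∀ ε : ℤ, ε = 1 ∨ ε = -1 →
      ENNReal.ofReal m * ∑' μ, (badConfigs a b ε).indicator (weight ψ) μ ≤
      ENNReal.ofReal (κ / 2) * ∑' p, (badHops a b ε).indicator (hopWeight lam ψ) p +
        ENNReal.ofReal (2 / 5) * ∑' μ, electroWeight ψ μ := fun ε hε =>
    (mul_le_mul_left (ENNReal.ofReal_le_ofReal hm1) _).trans (tsum_badConfigs_le hlam hκ ψ hε)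
  have hsub : ∀ H : Set (ℤ × Config a b), H ⊆ H₁ ∪ H₂ →
      ∑' p, H.indicator (hopWeight lam ψ) p ≤ ∑' p, (H₁ ∪ H₂).indicator (hopWeight lam ψ) p :=
    fun H hH => ENNReal.tsum_le_tsum fun p => Set.indicator_le_indicator_of_subset hH
      (fun _ => zero_le) p
  have hsplit : ∑' p, hopWeight lam ψ p = ∑' p, (H₁ ∪ H₂)ᶜ.indicator (hopWeight lam ψ) p +
      ∑' p, (H₁ ∪ H₂).indicator (hopWeight lam ψ) p := by
    rw [← ENNReal.tsum_add]
    exact tsum_congr fun p => (congrFun (Set.indicator_compl_add_self _ _) p).symm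
  have hκ2 : ENNReal.ofReal κ = ENNReal.ofReal (κ / 2) + ENNReal.ofReal (κ / 2) := by
    rw [← ENNReal.ofReal_add (by positivity) (by positivity), add_halves]
  have h1 : ENNReal.ofReal (1 / 5) + ENNReal.ofReal (2 / 5) + ENNReal.ofReal (2 / 5) = 1 := by
    rw [← ENNReal.ofReal_add (by norm_num) (by norm_num),
      ← ENNReal.ofReal_add (by norm_num) (by norm_num)]
    norm_num
  calc ENNReal.ofReal m * ∑' μ, weight ψ μ
      ≤ ENNReal.ofReal m * (∑' μ, G.indicator (weight ψ) μ + ∑' μ, E.indicator (weight ψ) μ +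
        ∑' μ, B₁.indicator (weight ψ) μ + ∑' μ, B₂.indicator (weight ψ) μ) :=
        mul_le_mul_right hcover _
    _ ≤ ENNReal.ofReal κ * ∑' p, (H₁ ∪ H₂)ᶜ.indicator (hopWeight lam ψ) p +
        ENNReal.ofReal (1 / 5) * ∑' μ, electroWeight ψ μ +
        (ENNReal.ofReal (κ / 2) * ∑' p, (H₁ ∪ H₂).indicator (hopWeight lam ψ) p +
          ENNReal.ofReal (2 / 5) * ∑' μ, electroWeight ψ μ) +
        (ENNReal.ofReal (κ / 2) * ∑' p, (H₁ ∪ H₂).indicator (hopWeight lam ψ) p +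
          ENNReal.ofReal (2 / 5) * ∑' μ, electroWeight ψ μ) := by
        rw [mul_add, mul_add, mul_add]
        refine add_le_add (add_le_add (add_le_add hG hE) ?_) ?_
        · exact (hB 1 (Or.inl rfl)).trans (add_le_add
            (mul_le_mul_right (hsub _ Set.subset_union_left) _) le_rfl)
        · exact (hB (-1) (Or.inr rfl)).trans (add_le_add
            (mul_le_mul_right (hsub _ Set.subset_union_right) _) le_rfl)
    _ = (ENNReal.ofReal (1 / 5) + ENNReal.ofReal (2 / 5) + ENNReal.ofReal (2 / 5)) *
          ∑' μ, electroWeight ψ μ +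
        (ENNReal.ofReal κ * ∑' p, (H₁ ∪ H₂)ᶜ.indicator (hopWeight lam ψ) p +
        (ENNReal.ofReal (κ / 2) + ENNReal.ofReal (κ / 2)) *
          ∑' p, (H₁ ∪ H₂).indicator (hopWeight lam ψ) p) := by ring
    _ = _ := by rw [h1, one_mul, ← hκ2, ← mul_add, ← hsplit]

end Bounds

end Pseudopotential

end

theorem theorem1p1 :
    MonotoneOn Pseudopotential.overlap (Set.Ici 0) ∧
    (∀ r : ℝ, 0 ≤ r → 0 ≤ Pseudopotential.overlap r) ∧
    ∀ (lam : ℂ) (κ : ℝ), lam ≠ 0 → 0 ≤ κ →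
      Pseudopotential.overlap (‖lam‖ ^ 2 / 2) < 1 / 3 →
      (∀ a b : ℤ, 10 ≤ b - a + 1 →
        ¬ FiniteDimensional ℂ (Pseudopotential.groundSpace a b lam κ)) ∧
      ((min (Pseudopotential.gammaObc κ (‖lam‖ ^ 2))
          (2 * κ / 3 * (1 - Real.sqrt (3 * Pseudopotential.overlap (‖lam‖ ^ 2 / 2))) ^ 2) : ℝ) :
          EReal) ≤
        ⨅ (a : ℤ) (b : ℤ) (_ : 10 ≤ b - a + 1), Pseudopotential.spectralGap a b lam κ := by
  open Pseudopotential in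
  refine ⟨monotoneOn_overlap, fun r hr => overlap_nonneg hr, fun lam κ hlam hκ hov =>
    ⟨fun a b hab => infinite_groundSpace lam κ (by omega), ?_⟩⟩
  refine le_iInf fun a => le_iInf fun b => le_iInf fun hab => ?_
  have hm0 : 0 ≤ min (gammaObc κ (‖lam‖ ^ 2))
      (2 * κ / 3 * (1 - √(3 * overlap (‖lam‖ ^ 2 / 2))) ^ 2) :=
    le_min (gammaObc_nonneg hκ (sq_nonneg _)) (by positivity)
  refine le_spectralGap hκ hm0 fun ψ hψ => ?_
  rcases hκ.eq_or_lt with rfl | hκ'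
  · -- both terms of the minimum vanish without hopping
    have : min (gammaObc 0 (‖lam‖ ^ 2))
        (2 * 0 / 3 * (1 - √(3 * overlap (‖lam‖ ^ 2 / 2))) ^ 2) ≤ 0 :=
      (min_le_right _ _).trans (by simp)
    rw [ENNReal.ofReal_of_nonpos this, zero_mul]
    exact zero_le
  · refine mul_tsum_weight_le (by omega) hlam hκ' (min_le_left _ _)
      ((min_le_right _ _).trans ?_) hψ
    have h := mul_le_mul_of_nonneg_left
      (sq_one_sub_sqrt_overlap_le (by positivity : 0 ≤ ‖lam‖ ^ 2 / 2) hov)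
      (mul_nonneg zero_le_two hκ)
    calc _ = 2 * κ * (1 / 3 * (1 - √(3 * overlap (‖lam‖ ^ 2 / 2))) ^ 2) := by ring
      _ ≤ _ := h
      _ = _ := by ring
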